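/- Let $\mathcal G_0$ be the space of all right continuous nondecreasing maps $g:[0,1)\to[0,1]$ (extended by $g(1):=1$), equipped with the $L^2$-distance $\|g-h\|_{L^2}=\big(\int_0^1|g(t)-h(t)|^2\,dt\big)^{1/2}$ and its Borel $\sigma$-field. Fix $\beta>0$ and let $\mathbb Q_0$ be the Dirichlet process with parameter $\beta$, i.e. the probability measure on $\mathcal G_0$ such that for all $N$ and all $0=t_0<t_1<\dots<t_N<t_{N+1}=1$ the vector $(g(t_1),\dots,g(t_N))$ has under $\mathbb Q_0$ the density $$\frac{\Gamma(\beta)}{\prod_{i=0}^{N}\Gamma(\beta(t_{i+1}-t_i))}\prod_{i=0}^{N}(x_{i+1}-x_i)^{\beta(t_{i+1}-t_i)-1},\qquad x_0:=0,\ x_{N+1}:=1,$$ with respect to Lebesgue measure on $\{0<x_1<\dots<x_N<1\}$. Let $\mathfrak Z^1(\mathcal G_0)$ be the set of functions $u(g)=U\big(\int_0^1\alpha_1(g(s))ds,\dots,\int_0^1\alpha_m(g(s))ds\big)$ with $m\in\mathbb N$, $U\in C^1(\mathbb R^m)$, $\alpha_i\in C^1([0,1])$, with $L^2$-gradient $$\mathbb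 D u(g)(t)=\sum_{i=1}^m\partial_iU\Big(\int_0^1\vec\alpha(g(s))ds\Big)\,\alpha_i'(g(t)).$$ Let $\mathrm{Dom}(\mathbb E)$ be the domain of the closure in $L^2(\mathcal G_0,\mathbb Q_0)$ of the form $\mathbb E(u,u)=\int_{\mathcal G_0}\|\mathbb Du(g)\|^2_{L^2([0,1])}\,d\mathbb Q_0(g)$, $u\in\mathfrak Z^1(\mathcal G_0)$, let $\overline{\mathbb D}$ be the closure of $\mathbb D:\mathfrak Z^1(\mathcal G_0)\to L^2(\mathcal G_0\times[0,1],\mathbb Q_0\otimes\mathrm{Leb})$, and let $\Gamma(u,u)(g)=\|\overline{\mathbb D}u(g)\|^2_{L^2([0,1])}$. Then every function $u:\mathcal G_0\to\mathbb R$ with $|u(g)-u(h)|\le\|g-h\|_{L^2}$ for all $g,h\in\mathcal G_0$ belongs to $\mathrm{Dom}(\mathbb E)$; the closed gradient $\overline{\mathbb D}u$ exists and is $\mathbb Q_0\otimes\mathrm{Leb}$-a.e. unique, and $\Gamma(u,u)\le1$ holds $\mathbb Q_0$-almost everywhere. -/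

import Mathlib

open MeasureTheory Filter Topology

noncomputable section

/-- Lebesgue measure on the unit interval `[0,1]`. -/
def unitLeb : Measure ℝ := volume.restrict (Set.Icc 0 1)

instance : IsProbabilityMeasure unitLeb := ⟨by simp [unitLeb]⟩

/-- The space `𝒢₀` of right continuous nondecreasing maps `g : [0,1) → [0,1]`. -/
@[ext]
structure GZero where
  toFun : Set.Ico (0 : ℝ) 1 → ℝ
  mem_Icc : ∀ t, toFun t ∈ Set.Icc (0 : ℝ) 1
  mono : Monotone toFun
  rightCont : ∀ t, ContinuousWithinAt toFun (Set.Ici t) t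

namespace GZero

/-- The map `g` extended by `g(1) := 1`. (The values at `t < 0` and at `t > 1` are never used;
they are chosen such that the extension is nondecreasing on the whole real line.) -/
def val (g : GZero) (t : ℝ) : ℝ :=
  if h : t ∈ Set.Ico (0 : ℝ) 1 then g.toFun ⟨t, h⟩ else if t < 0 then 0 else 1

lemma val_mem (g : GZero) (t : ℝ) : g.val t ∈ Set.Icc (0 : ℝ) 1 := by
  unfold val
  split_ifs with h h'
  · exact g.mem_Icc _
  · simp
  · simp

lemma val_mono (g : GZero) : Monotone g.val := by
  intro s t hst
  by_cases hs : s < 0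
  · have : g.val s = 0 := by simp [val, hs, not_le.2 hs]
    rw [this]; exact (g.val_mem t).1
  by_cases ht : 1 ≤ t
  · have : g.val t = 1 := by
      have h0 : ¬ t < 0 := by linarith
      simp [val, h0, not_lt.2 ht]
    rw [this]; exact (g.val_mem s).2
  push Not at hs ht
  have h1 : s ∈ Set.Ico (0 : ℝ) 1 := ⟨hs, by linarith⟩
  have h2 : t ∈ Set.Ico (0 : ℝ) 1 := ⟨by linarith, ht⟩
  simp only [val, h1, h2, dite_true]
  exact g.mono hst

lemma val_measurable (g : GZero) : Measurable g.val := g.val_mono.measurable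

lemma val_memLp (g : GZero) : MemLp g.val 2 unitLeb :=
  MemLp.of_bound g.val_measurable.aestronglyMeasurable 1
    (Eventually.of_forall fun t => by
      rw [Real.norm_eq_abs, abs_le]
      have := g.val_mem t
      exact ⟨by linarith [this.1], this.2⟩)

lemma val_rightCont (g : GZero) {t : ℝ} (ht : t ∈ Set.Ico (0 : ℝ) 1) :
    Tendsto g.val (𝓝[>] t) (𝓝 (g.val t)) := by
  have h := (g.rightCont ⟨t, ht⟩).tendsto
  have hv : g.val t = g.toFun ⟨t, ht⟩ := by simp only [val, ht, dite_true]
  rw [hv]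
  rw [Metric.tendsto_nhdsWithin_nhds] at h ⊢
  intro ε hε
  obtain ⟨δ, hδ, H⟩ := h ε hε
  refine ⟨min δ (1 - t), lt_min hδ (by linarith [ht.2]), ?_⟩
  intro s hs hd
  have hs' : t < s := hs
  have h1 : s - t < 1 - t := by
    have h2 := lt_of_lt_of_le hd (min_le_right _ _)
    rw [Real.dist_eq] at h2
    exact lt_of_le_of_lt (le_abs_self _) h2
  have hm : s ∈ Set.Ico (0 : ℝ) 1 := ⟨by linarith [ht.1], by linarith⟩
  have hvs : g.val s = g.toFun ⟨s, hm⟩ := by simp only [val, hm, dite_true]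
  rw [hvs]
  exact H (x := ⟨s, hm⟩) (show (⟨t, ht⟩ : Set.Ico (0 : ℝ) 1) ≤ ⟨s, hm⟩ from hs'.le)
    (lt_of_lt_of_le hd (min_le_left _ _))

/-- The element of `L²([0,1], Leb)` represented by `g`. -/
def toL2 (g : GZero) : Lp ℝ 2 unitLeb := g.val_memLp.toLp g.val

lemma toL2_injective : Function.Injective toL2 := by
  intro g h hgh
  have hae : g.val =ᵐ[unitLeb] h.val := (MemLp.toLp_eq_toLp_iff _ _).1 hgh
  have key : ∀ t ∈ Set.Ico (0 : ℝ) 1, g.val t = h.val t := by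
    intro t ht
    refine tendsto_nhds_unique_of_frequently_eq (g.val_rightCont ht) (h.val_rightCont ht) ?_
    intro hne
    obtain ⟨u, hu, hsub⟩ := (mem_nhdsGT_iff_exists_Ioo_subset' (show t < 1 from ht.2)).1 hne
    have hu' : t < min u 1 := lt_min hu ht.2
    have h0 : unitLeb (Set.Ioo t (min u 1)) = 0 := by
      refine measure_mono_null ?_ hae
      intro s hs
      exact hsub ⟨hs.1, lt_of_lt_of_le hs.2 (min_le_left _ _)⟩
    rw [unitLeb, Measure.restrict_apply measurableSet_Ioo,
      Set.inter_eq_left.2 (show Set.Ioo t (min u 1) ⊆ Set.Icc 0 1 from fun s hs =>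
        ⟨by linarith [ht.1, hs.1], (lt_of_lt_of_le hs.2 (min_le_right _ _)).le⟩),
      Real.volume_Ioo] at h0
    have := ENNReal.ofReal_eq_zero.1 h0
    linarith
  ext t
  have := key t t.2
  simpa only [val, t.2, dite_true, Subtype.coe_eta] using this

/-- `𝒢₀` carries the `L²`-distance, see `GZero.dist_eq`. -/
instance : MetricSpace GZero := MetricSpace.induced toL2 toL2_injective inferInstance

lemma dist_eq (g h : GZero) :
    dist g h = Real.sqrt (∫ t in Set.Icc (0 : ℝ) 1, (g.val t - h.val t) ^ 2) := by
  have h1 : dist g h = dist g.toL2 h.toL2 := rfl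
  have h2 : toL2 g - toL2 h = (g.val_memLp.sub h.val_memLp).toLp (g.val - h.val) :=
    (MemLp.toLp_sub _ _).symm
  rw [h1, dist_eq_norm, h2, Lp.norm_toLp,
    (g.val_memLp.sub h.val_memLp).eLpNorm_eq_integral_rpow_norm (by simp) (by simp),
    ENNReal.toReal_ofReal (by positivity), Real.sqrt_eq_rpow]
  simp [unitLeb]

/-- `𝒢₀` carries the Borel `σ`-field of its `L²`-topology. -/
instance : MeasurableSpace GZero := borel GZero

instance : BorelSpace GZero := ⟨rfl⟩

/-- The evaluations `g ↦ g(t)`, `t ∈ [0,1]`, are Borel measurable (in fact upper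
semicontinuous). -/
lemma measurable_eval (t : ℝ) : Measurable fun g : GZero => g.val t := by
  by_cases ht : t ∈ Set.Ico (0 : ℝ) 1
  swap
  · have : (fun g : GZero => g.val t) = fun _ => if t < 0 then 0 else 1 := by
      funext g; simp only [val, ht, dite_false]
    rw [this]; exact measurable_const
  refine measurable_of_Iio fun c => IsOpen.measurableSet ?_
  rw [Metric.isOpen_iff]
  intro g hg
  have hg' : g.val t < c := hg
  obtain ⟨s, hsc, hst, hs1⟩ : ∃ s, g.val s < c ∧ t < s ∧ s < 1 := by
    have h1 : ∀ᶠ s in 𝓝[>] t, g.val s < c := (g.val_rightCont ht).eventually_lt_const hg'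
    have h2 : ∀ᶠ s in 𝓝[>] t, s ∈ Set.Ioo t 1 := Ioo_mem_nhdsGT ht.2
    obtain ⟨s, hs, hs'⟩ := (h1.and h2).exists
    exact ⟨s, hs, hs'.1, hs'.2⟩
  refine ⟨Real.sqrt ((c - g.val s) ^ 2 * (s - t)), Real.sqrt_pos.2 (by
    have : 0 < c - g.val s := by linarith
    have : 0 < s - t := by linarith
    positivity), ?_⟩
  intro h hh
  by_contra hc
  have hc' : c ≤ h.val t := not_lt.1 hc
  rw [Metric.mem_ball, dist_eq] at hh
  refine absurd hh (not_lt.2 (Real.sqrt_le_sqrt ?_))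
  have hint : IntegrableOn (fun r => (h.val r - g.val r) ^ 2) (Set.Icc (0 : ℝ) 1) :=
    (h.val_memLp.sub g.val_memLp).integrable_sq
  calc (c - g.val s) ^ 2 * (s - t) = ∫ _ in Set.Ioo t s, (c - g.val s) ^ 2 := by
        simp [hst.le, mul_comm]
    _ ≤ ∫ r in Set.Ioo t s, (h.val r - g.val r) ^ 2 := by
        refine setIntegral_mono_on (by simp) (hint.mono_set ?_) measurableSet_Ioo ?_
        · intro r hr; exact ⟨by linarith [ht.1, hr.1], by linarith [hr.2]⟩
        · intro r hr
          have h3 := h.val_mono hr.1.le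
          have h4 := g.val_mono hr.2.le
          exact pow_le_pow_left₀ (by linarith) (by linarith) 2
    _ ≤ _ := by
        refine setIntegral_mono_set hint (Eventually.of_forall fun r => sq_nonneg _) ?_
        refine LE.le.eventuallyLE ?_
        intro r hr; exact ⟨by linarith [ht.1, hr.1], by linarith [hr.2]⟩

end GZero

/-! ### The Dirichlet process -/

/-- The points `x₁, …, x_N` together with the end points `x₀ = 0` and `x_{N+1} = 1`. -/
def withEnds {N : ℕ} (x : Fin N → ℝ) : Fin (N + 2) → ℝ :=
  Fin.cons 0 (Fin.snoc x 1 : Fin (N + 1) → ℝ)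

/-- The increments `x_{i+1} - x_i`, `i = 0, …, N`, where `x₀ = 0` and `x_{N+1} = 1`. -/
def incr {N : ℕ} (x : Fin N → ℝ) (i : Fin (N + 1)) : ℝ :=
  withEnds x i.succ - withEnds x i.castSucc

/-- The set of all `x` with `0 < x₁ < x₂ < … < x_N < 1`. -/
def orderedSimplex (N : ℕ) : Set (Fin N → ℝ) := {x | StrictMono (withEnds x)}

/-- `Γ(β) / ∏ᵢ Γ(β (t_{i+1} - t_i)) · ∏ᵢ (x_{i+1} - x_i) ^ (β (t_{i+1} - t_i) - 1)`, where both
products run over `i = 0, …, N`. -/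
def dirichletDensity (β : ℝ) {N : ℕ} (t x : Fin N → ℝ) : ℝ :=
  Real.Gamma β / (∏ i, Real.Gamma (β * incr t i)) * ∏ i, incr x i ^ (β * incr t i - 1)

/-- `Q` is the Dirichlet process with parameter `β` on `𝒢₀`: the probability measure such that,
for all `0 < t₁ < … < t_N < 1`, the vector `(g(t₁), …, g(t_N))` is distributed according to the
density above on the simplex `0 < x₁ < … < x_N < 1`. -/
structure IsDirichletProcess (β : ℝ) (Q : Measure GZero) : Prop where
  isProbabilityMeasure : IsProbabilityMeasure Q
  map_eval : ∀ (N : ℕ) (t : Fin N → ℝ), t ∈ orderedSimplex N →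
    Q.map (fun g i => g.val (t i)) =
      (volume.restrict (orderedSimplex N)).withDensity
        fun x => ENNReal.ofReal (dirichletDensity β t x)

/-! ### Cylinder functions, the gradient, the Dirichlet form -/

/-- The data of a cylinder function of class `ℨ¹(𝒢₀)`: a number `m`, a `C¹` function `U` on `ℝᵐ`
and `C¹` functions `α₁, …, α_m` on `[0,1]`. -/
structure CylZ where
  m : ℕ
  U : (Fin m → ℝ) → ℝ
  α : Fin m → ℝ → ℝ
  contDiff_U : ContDiff ℝ 1 U
  contDiffOn_α : ∀ i, ContDiffOn ℝ 1 (α i) (Set.Icc 0 1)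

namespace CylZ

/-- The vector `(∫₀¹ α₁(g(s)) ds, …, ∫₀¹ α_m(g(s)) ds)`. -/
def moments (F : CylZ) (g : GZero) (i : Fin F.m) : ℝ :=
  ∫ s in Set.Icc (0 : ℝ) 1, F.α i (g.val s)

/-- The cylinder function `u(g) = U(∫₀¹ α₁(g(s)) ds, …, ∫₀¹ α_m(g(s)) ds)`. -/
def eval (F : CylZ) (g : GZero) : ℝ := F.U (F.moments g)

/-- The `L²`-gradient `𝔻u(g)(t) = ∑ᵢ ∂ᵢU(∫₀¹ α(g(s)) ds) · αᵢ'(g(t))` of the cylinder function,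
as a function of `(g, t)`. -/
def grad (F : CylZ) (p : GZero × ℝ) : ℝ :=
  ∑ i, fderiv ℝ F.U (F.moments p.1) (Pi.single i 1) *
    derivWithin (F.α i) (Set.Icc 0 1) (p.1.val p.2)

end CylZ

/-- `u` belongs to `Dom(𝔼)`, the domain of the closure of the form
`𝔼(v,v) = ∫ ‖𝔻v(g)‖²_{L²} dQ(g)`, `v ∈ ℨ¹(𝒢₀)`, in `L²(𝒢₀, Q)`: there are cylinder functions
`uₙ` with `uₙ → u` in `L²(Q)` and `𝔼(uₙ - u_k, uₙ - u_k) → 0` as `n, k → ∞`. -/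
def MemDomE (Q : Measure GZero) (u : GZero → ℝ) : Prop :=
  MemLp u 2 Q ∧ ∃ F : ℕ → CylZ,
    Tendsto (fun n => eLpNorm (fun g => (F n).eval g - u g) 2 Q) atTop (𝓝 0) ∧
    Tendsto (fun p : ℕ × ℕ =>
        ∫⁻ g, ∫⁻ t, ENNReal.ofReal (((F p.1).grad (g, t) - (F p.2).grad (g, t)) ^ 2) ∂unitLeb ∂Q)
      (atTop ×ˢ atTop) (𝓝 0)

/-- `(u, V)` belongs to the graph of the closed gradient, i.e. of the closure of
`𝔻 : ℨ¹(𝒢₀) ⊂ L²(𝒢₀, Q) → L²(𝒢₀ × [0,1], Q ⊗ Leb)`. -/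
def IsClosedGradient (Q : Measure GZero) (u : GZero → ℝ) (V : GZero × ℝ → ℝ) : Prop :=
  MemLp u 2 Q ∧ MemLp V 2 (Q.prod unitLeb) ∧ ∃ F : ℕ → CylZ,
    Tendsto (fun n => eLpNorm (fun g => (F n).eval g - u g) 2 Q) atTop (𝓝 0) ∧
    Tendsto (fun n => eLpNorm (fun p => (F n).grad p - V p) 2 (Q.prod unitLeb)) atTop (𝓝 0)

/-- `Γ(u,v)(g) = ⟨𝔻̄u(g), 𝔻̄v(g)⟩_{L²(Leb)}`, in terms of the closed gradients `V = 𝔻̄u` and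
`W = 𝔻̄v`. -/
def squareField (V W : GZero × ℝ → ℝ) (g : GZero) : ℝ :=
  ∫ t in Set.Icc (0 : ℝ) 1, V (g, t) * W (g, t)

end

noncomputable section

namespace GZero

lemma val_of_neg (g : GZero) {t : ℝ} (ht : t < 0) : g.val t = 0 := by
  simp [val, ht, not_le.2 ht]

lemma val_of_one_le (g : GZero) {t : ℝ} (ht : 1 ≤ t) : g.val t = 1 := by
  have h0 : ¬ t < 0 := by linarith
  simp [val, h0, not_lt.2 ht]

lemma tendsto_val_nhdsGT (g : GZero) (t : ℝ) : Tendsto g.val (𝓝[>] t) (𝓝 (g.val t)) := by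
  rcases lt_or_ge t 0 with h0 | h0
  · rw [g.val_of_neg h0]
    refine tendsto_const_nhds.congr' ?_
    filter_upwards [Ioo_mem_nhdsGT h0] with s hs using (g.val_of_neg hs.2).symm
  rcases lt_or_ge t 1 with h1 | h1
  · exact g.val_rightCont ⟨h0, h1⟩
  · rw [g.val_of_one_le h1]
    refine tendsto_const_nhds.congr' ?_
    filter_upwards [self_mem_nhdsWithin] with s hs
    exact (g.val_of_one_le (h1.trans (le_of_lt hs))).symm

lemma measurable_uncurry_val : Measurable fun p : GZero × ℝ => p.1.val p.2 := by
  refine measurable_of_Iio fun c => ?_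
  have : (fun p : GZero × ℝ => p.1.val p.2) ⁻¹' Set.Iio c =
      ⋃ q : ℚ, {g : GZero | g.val q < c} ×ˢ Set.Iio (q : ℝ) := by
    ext ⟨g, t⟩
    simp only [Set.mem_preimage, Set.mem_Iio, Set.mem_iUnion, Set.mem_prod, Set.mem_ofPred_eq]
    constructor
    · intro h
      have h1 : ∀ᶠ s in 𝓝[>] t, g.val s < c := (g.tendsto_val_nhdsGT t).eventually_lt_const h
      obtain ⟨u, hu, hsub⟩ := mem_nhdsGT_iff_exists_Ioo_subset.1 h1
      obtain ⟨q, hq1, hq2⟩ := exists_rat_btwn (show t < u from hu)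
      exact ⟨q, hsub ⟨hq1, hq2⟩, hq1⟩
    · rintro ⟨q, h1, h2⟩
      exact (g.val_mono h2.le).trans_lt h1
  rw [this]
  exact MeasurableSet.iUnion fun q =>
    ((measurable_eval (q : ℝ)) measurableSet_Iio).prod measurableSet_Iio

end GZero

namespace CylZ

/-- The derivative of `αᵢ` on `[0,1]`, extended by constants to the real line. -/
def dα (F : CylZ) (i : Fin F.m) : ℝ → ℝ :=
  Set.IccExtend zero_le_one fun x : Set.Icc (0 : ℝ) 1 => derivWithin (F.α i) (Set.Icc 0 1) x

/-- A `C¹` extension of `αᵢ` to the real line. -/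
def αext (F : CylZ) (i : Fin F.m) (x : ℝ) : ℝ := F.α i 0 + ∫ y in (0 : ℝ)..x, F.dα i y

lemma continuous_dα (F : CylZ) (i : Fin F.m) : Continuous (F.dα i) := by
  refine Continuous.Icc_extend' ?_
  exact ((F.contDiffOn_α i).continuousOn_derivWithin (uniqueDiffOn_Icc zero_lt_one)
    le_rfl).domRestrict

lemma dα_eq (F : CylZ) (i : Fin F.m) {x : ℝ} (hx : x ∈ Set.Icc (0 : ℝ) 1) :
    F.dα i x = derivWithin (F.α i) (Set.Icc 0 1) x := by
  rw [dα, Set.IccExtend_of_mem _ _ hx]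

lemma hasDerivAt_αext (F : CylZ) (i : Fin F.m) (x : ℝ) :
    HasDerivAt (F.αext i) (F.dα i x) x :=
  (intervalIntegral.integral_hasDerivAt_right ((F.continuous_dα i).intervalIntegrable _ _)
    (F.continuous_dα i).stronglyMeasurable.stronglyMeasurableAtFilter
    (F.continuous_dα i).continuousAt).const_add _

lemma continuous_αext (F : CylZ) (i : Fin F.m) : Continuous (F.αext i) :=
  continuous_iff_continuousAt.2 fun x => (F.hasDerivAt_αext i x).continuousAt

lemma αext_eq (F : CylZ) (i : Fin F.m) {x : ℝ} (hx : x ∈ Set.Icc (0 : ℝ) 1) :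
    F.αext i x = F.α i x := by
  have h := intervalIntegral.integral_eq_sub_of_hasDerivAt_of_le hx.1 (f := F.α i) (f' := F.dα i)
    ((F.contDiffOn_α i).continuousOn.mono (Set.Icc_subset_Icc_right hx.2)) (fun y hy => by
      have hy' : y ∈ Set.Ioo (0 : ℝ) 1 := ⟨hy.1, hy.2.trans_le hx.2⟩
      rw [F.dα_eq i (Set.Ioo_subset_Icc_self hy')]
      have := ((F.contDiffOn_α i).differentiableOn one_ne_zero) y (Set.Ioo_subset_Icc_self hy')
      exact this.hasDerivWithinAt.hasDerivAt (Icc_mem_nhds hy'.1 hy'.2))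
    ((F.continuous_dα i).intervalIntegrable _ _)
  rw [αext, h]; ring

lemma exists_bound_dα (F : CylZ) : ∃ C, 0 ≤ C ∧ ∀ i x, |F.dα i x| ≤ C := by
  have h : ∀ i, ∃ C, ∀ x, |F.dα i x| ≤ C := by
    intro i
    obtain ⟨C, hC⟩ := isCompact_Icc.exists_bound_of_continuousOn (s := Set.Icc (0 : ℝ) 1)
      (F.continuous_dα i).continuousOn
    refine ⟨C, fun x => ?_⟩
    have := hC (Set.projIcc 0 1 zero_le_one x) (Subtype.coe_prop _)
    simpa [dα, Set.IccExtend] using this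
  choose C hC using h
  refine ⟨∑ i, |C i|, Finset.sum_nonneg fun _ _ => abs_nonneg _, fun i x => ?_⟩
  exact ((hC i x).trans (le_abs_self _)).trans
    (Finset.single_le_sum (f := fun i => |C i|) (fun _ _ => abs_nonneg _) (Finset.mem_univ i))

lemma exists_bound_αext (F : CylZ) :
    ∃ C, 0 ≤ C ∧ ∀ i, ∀ x ∈ Set.Icc (0 : ℝ) 1, |F.αext i x| ≤ C := by
  have h : ∀ i, ∃ C, ∀ x ∈ Set.Icc (0 : ℝ) 1, |F.αext i x| ≤ C := fun i =>
    isCompact_Icc.exists_bound_of_continuousOn (F.continuous_αext i).continuousOn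
  choose C hC using h
  refine ⟨∑ i, |C i|, Finset.sum_nonneg fun _ _ => abs_nonneg _, fun i x hx => ?_⟩
  exact ((hC i x hx).trans (le_abs_self _)).trans
    (Finset.single_le_sum (f := fun i => |C i|) (fun _ _ => abs_nonneg _) (Finset.mem_univ i))

lemma moments_eq (F : CylZ) (g : GZero) (i : Fin F.m) :
    F.moments g i = ∫ s, F.αext i (g.val s) ∂unitLeb := by
  unfold moments unitLeb
  exact integral_congr_ae (Eventually.of_forall fun s => (F.αext_eq i (g.val_mem s)).symm)

lemma grad_eq (F : CylZ) (g : GZero) (t : ℝ) :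
    F.grad (g, t) =
      ∑ i, fderiv ℝ F.U (F.moments g) (Pi.single i 1) * F.dα i (g.val t) := by
  simp only [grad, F.dα_eq _ (g.val_mem t)]

lemma measurable_moments (F : CylZ) : Measurable F.moments := by
  refine measurable_pi_iff.2 fun i => ?_
  simp only [moments_eq]
  have : Measurable fun p : GZero × ℝ => F.αext i (p.1.val p.2) :=
    (F.continuous_αext i).measurable.comp GZero.measurable_uncurry_val
  exact this.stronglyMeasurable.integral_prod_right.measurable

lemma measurable_eval (F : CylZ) : Measurable F.eval :=
  F.contDiff_U.continuous.measurable.comp F.measurable_moments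

lemma measurable_grad (F : CylZ) : Measurable F.grad := by
  have : F.grad = fun p : GZero × ℝ =>
      ∑ i, fderiv ℝ F.U (F.moments p.1) (Pi.single i 1) * F.dα i (p.1.val p.2) :=
    funext fun p => F.grad_eq p.1 p.2
  rw [this]
  refine Finset.measurable_sum _ fun i _ => Measurable.mul ?_ ?_
  · have h : Continuous fun x => fderiv ℝ F.U x (Pi.single i 1) :=
      (F.contDiff_U.continuous_fderiv one_ne_zero).clm_apply continuous_const
    exact h.measurable.comp (F.measurable_moments.comp measurable_fst)
  · exact (F.continuous_dα i).measurable.comp GZero.measurable_uncurry_val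

lemma exists_bound_moments (F : CylZ) : ∃ R, 0 ≤ R ∧ ∀ g, ‖F.moments g‖ ≤ R := by
  obtain ⟨C, hC0, hC⟩ := F.exists_bound_αext
  refine ⟨C, hC0, fun g => (pi_norm_le_iff_of_nonneg hC0).2 fun i => ?_⟩
  rw [moments_eq]
  have := norm_integral_le_of_norm_le_const (μ := unitLeb) (f := fun s => F.αext i (g.val s))
    (C := C) (Eventually.of_forall fun s => hC i _ (g.val_mem s))
  simpa using this

lemma exists_bound_comp_moments (F : CylZ) {E : Type*} [NormedAddCommGroup E]
    {W : (Fin F.m → ℝ) → E} (hW : Continuous W) :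
    ∃ C, 0 ≤ C ∧ ∀ g, ‖W (F.moments g)‖ ≤ C := by
  obtain ⟨R, hR0, hR⟩ := F.exists_bound_moments
  obtain ⟨C, hC⟩ := (isCompact_closedBall (0 : Fin F.m → ℝ) R).exists_bound_of_continuousOn
    hW.continuousOn
  exact ⟨|C|, abs_nonneg _, fun g => (hC _ (by simpa using hR g)).trans (le_abs_self _)⟩

lemma exists_bound_eval (F : CylZ) : ∃ C, 0 ≤ C ∧ ∀ g, |F.eval g| ≤ C :=
  F.exists_bound_comp_moments F.contDiff_U.continuous

lemma exists_bound_grad (F : CylZ) : ∃ C, 0 ≤ C ∧ ∀ p, |F.grad p| ≤ C := by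
  obtain ⟨A, hA0, hA⟩ := F.exists_bound_comp_moments (F.contDiff_U.continuous_fderiv one_ne_zero)
  obtain ⟨B, hB0, hB⟩ := F.exists_bound_dα
  refine ⟨∑ _i : Fin F.m, A * B, by positivity, fun ⟨g, t⟩ => ?_⟩
  rw [grad_eq]
  refine (Finset.abs_sum_le_sum_abs _ _).trans (Finset.sum_le_sum fun i _ => ?_)
  rw [abs_mul]
  refine mul_le_mul ?_ (hB i _) (abs_nonneg _) hA0
  refine ((fderiv ℝ F.U (F.moments g)).le_opNorm _).trans ?_
  have : ‖(Pi.single i 1 : Fin F.m → ℝ)‖ = 1 := by simp [Pi.norm_single]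
  rw [this, mul_one]
  exact hA g

/-- Composition of cylinder functions with a `C¹` function. -/
def comp {k : ℕ} (U : (Fin k → ℝ) → ℝ) (hU : ContDiff ℝ 1 U) (F : Fin k → CylZ) : CylZ where
  m := ∑ j, (F j).m
  U := fun x => U fun j => (F j).U fun i => x (finSigmaFinEquiv ⟨j, i⟩)
  α := fun l => (F (finSigmaFinEquiv.symm l).1).α (finSigmaFinEquiv.symm l).2
  contDiff_U := hU.comp (contDiff_pi.2 fun j =>
    (F j).contDiff_U.comp (contDiff_pi.2 fun _ => contDiff_apply ℝ ℝ _))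
  contDiffOn_α := fun _ => (F _).contDiffOn_α _

lemma comp_moments {k : ℕ} (U : (Fin k → ℝ) → ℝ) (hU : ContDiff ℝ 1 U) (F : Fin k → CylZ)
    (g : GZero) (j : Fin k) (i : Fin (F j).m) :
    (comp U hU F).moments g (finSigmaFinEquiv ⟨j, i⟩) = (F j).moments g i := by
  simp only [moments, comp]
  rw [Equiv.symm_apply_apply]

lemma comp_eval {k : ℕ} (U : (Fin k → ℝ) → ℝ) (hU : ContDiff ℝ 1 U) (F : Fin k → CylZ)
    (g : GZero) : (comp U hU F).eval g = U fun j => (F j).eval g := by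
  have : (comp U hU F).eval g = U fun j => (F j).U fun i =>
    (comp U hU F).moments g (finSigmaFinEquiv ⟨j, i⟩) := rfl
  simp only [this, comp_moments]
  rfl

lemma comp_grad {k : ℕ} (U : (Fin k → ℝ) → ℝ) (hU : ContDiff ℝ 1 U) (F : Fin k → CylZ)
    (p : GZero × ℝ) :
    (comp U hU F).grad p =
      ∑ j, fderiv ℝ U (fun j => (F j).eval p.1) (Pi.single j 1) * (F j).grad p := by
  let x : Fin (∑ j, (F j).m) → ℝ := (comp U hU F).moments p.1
  let V : (Fin (∑ j, (F j).m) → ℝ) → ℝ := (comp U hU F).U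
  have hxj : ∀ j, (fun i => x (finSigmaFinEquiv ⟨j, i⟩)) = (F j).moments p.1 := fun j =>
    funext fun i => comp_moments U hU F p.1 j i
  let P : ∀ j, (Fin (∑ j, (F j).m) → ℝ) →L[ℝ] (Fin (F j).m → ℝ) := fun j =>
    ContinuousLinearMap.pi fun i => ContinuousLinearMap.proj (finSigmaFinEquiv ⟨j, i⟩)
  have hP : ∀ j, P j x = (F j).moments p.1 := hxj
  have hd : HasFDerivAt V ((fderiv ℝ U (fun j => (F j).eval p.1)).comp
      (ContinuousLinearMap.pi fun j =>
        (fderiv ℝ (F j).U ((F j).moments p.1)).comp (P j))) x := by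
    have h1 : HasFDerivAt (fun y : Fin (∑ j, (F j).m) → ℝ => fun j => (F j).U (P j y))
        (ContinuousLinearMap.pi fun j =>
          (fderiv ℝ (F j).U ((F j).moments p.1)).comp (P j)) x := by
      refine hasFDerivAt_pi.2 fun j => ?_
      have h2 := ((F j).contDiff_U.differentiable one_ne_zero ((F j).moments p.1)).hasFDerivAt
      rw [← hP j] at h2 ⊢
      exact h2.comp x (P j).hasFDerivAt
    have h3 := (hU.differentiable one_ne_zero (fun j => (F j).eval p.1)).hasFDerivAt
    have h4 : (fun j => (F j).eval p.1) = (fun j => (F j).U (P j x)) := by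
      funext j; rw [hP]; rfl
    rw [h4] at h3 ⊢
    exact h3.comp x h1
  have hsum : ∀ f : Fin (∑ j, (F j).m) → ℝ,
      ∑ l, f l = ∑ j, ∑ i, f (finSigmaFinEquiv ⟨j, i⟩) := fun f => by
    rw [← finSigmaFinEquiv.sum_comp, Fintype.sum_sigma]
  have hα : ∀ j i, (comp U hU F).α (finSigmaFinEquiv ⟨j, i⟩) = (F j).α i := fun j i => by
    simp only [comp]; rw [Equiv.symm_apply_apply]
  have hsingle : ∀ j i, (ContinuousLinearMap.pi fun j =>
        (fderiv ℝ (F j).U ((F j).moments p.1)).comp (P j))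
          (Pi.single (finSigmaFinEquiv ⟨j, i⟩) 1 : Fin (∑ j, (F j).m) → ℝ) =
      (fderiv ℝ (F j).U ((F j).moments p.1) (Pi.single i 1)) • (Pi.single j 1 : Fin k → ℝ) := by
    intro j i
    funext j'
    simp only [ContinuousLinearMap.pi_apply, ContinuousLinearMap.comp_apply, Pi.smul_apply,
      smul_eq_mul]
    by_cases h : j' = j
    · subst h
      rw [Pi.single_eq_same, mul_one]
      congr 1
      funext i'
      simp only [P, ContinuousLinearMap.pi_apply, ContinuousLinearMap.proj_apply, Pi.single_apply,
        EmbeddingLike.apply_eq_iff_eq, Sigma.mk.injEq, heq_eq_eq, true_and]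
    · rw [Pi.single_eq_of_ne h, mul_zero]
      have : P j' (Pi.single (finSigmaFinEquiv ⟨j, i⟩) 1) = 0 := by
        funext i'
        simp [P, h]
      rw [this, map_zero]
  have : (comp U hU F).grad p = ∑ l : Fin (∑ j, (F j).m),
      fderiv ℝ V x (Pi.single l 1) *
        derivWithin ((comp U hU F).α l) (Set.Icc 0 1) (p.1.val p.2) := rfl
  rw [this, hd.fderiv, hsum]
  refine Finset.sum_congr rfl fun j _ => ?_
  rw [grad, Finset.mul_sum]
  refine Finset.sum_congr rfl fun i _ => ?_
  rw [ContinuousLinearMap.comp_apply, hsingle, map_smul, hα, smul_eq_mul]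
  ring

end CylZ

lemma withEnds_zero {N : ℕ} (x : Fin N → ℝ) : withEnds x 0 = 0 := by simp [withEnds]

lemma withEnds_last {N : ℕ} (x : Fin N → ℝ) : withEnds x (Fin.last (N + 1)) = 1 := by
  rw [withEnds, ← Fin.succ_last, Fin.cons_succ, Fin.snoc_last]

lemma withEnds_castSucc_succ {N : ℕ} (x : Fin N → ℝ) (i : Fin N) :
    withEnds x i.castSucc.succ = x i := by
  rw [withEnds, Fin.cons_succ, Fin.snoc_castSucc]

lemma withEnds_induction {N : ℕ} {P : Fin (N + 2) → Prop} (h0 : P 0)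
    (h1 : P (Fin.last (N + 1))) (h : ∀ i : Fin N, P i.castSucc.succ) (j) : P j := by
  induction j using Fin.cases with
  | zero => exact h0
  | succ j =>
    induction j using Fin.lastCases with
    | last => exact h1
    | cast j => exact h j

lemma withEnds_comp {N : ℕ} {h : ℝ → ℝ} (h0 : h 0 = 0) (h1 : h 1 = 1) (x : Fin N → ℝ)
    (j : Fin (N + 2)) : withEnds (fun i => h (x i)) j = h (withEnds x j) := by
  induction j using withEnds_induction with
  | h0 => simp [withEnds_zero, h0]
  | h1 => simp [withEnds_last, h1]
  | h i => simp [withEnds_castSucc_succ]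

lemma continuous_withEnds {N : ℕ} (j : Fin (N + 2)) :
    Continuous fun x : Fin N → ℝ => withEnds x j := by
  induction j using withEnds_induction with
  | h0 => simp only [withEnds_zero]; exact continuous_const
  | h1 => simp only [withEnds_last]; exact continuous_const
  | h i => simp only [withEnds_castSucc_succ]; exact continuous_apply i

lemma continuous_incr {N : ℕ} (j : Fin (N + 1)) : Continuous fun x : Fin N → ℝ => incr x j :=
  (continuous_withEnds _).sub (continuous_withEnds _)

lemma withEnds_mem_Icc {N : ℕ} {x : Fin N → ℝ} (hx : x ∈ orderedSimplex N) (j : Fin (N + 2)) :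
    withEnds x j ∈ Set.Icc (0 : ℝ) 1 := by
  have hm : Monotone (withEnds x) := StrictMono.monotone hx
  exact ⟨(withEnds_zero x) ▸ hm (Fin.zero_le j), (withEnds_last x) ▸ hm (Fin.le_last j)⟩

lemma incr_pos {N : ℕ} {x : Fin N → ℝ} (hx : x ∈ orderedSimplex N) (i : Fin (N + 1)) :
    0 < incr x i := sub_pos.2 (hx i.castSucc_lt_succ)

lemma sum_succ_sub_castSucc {n : ℕ} (f : Fin (n + 1) → ℝ) :
    ∑ i : Fin n, (f i.succ - f i.castSucc) = f (Fin.last n) - f 0 := by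
  induction n with
  | zero => simp
  | succ n ih =>
    rw [Fin.sum_univ_castSucc]
    have := ih fun i => f i.castSucc
    simp only [Fin.castSucc_zero] at this
    simp only [Fin.succ_castSucc, this, Fin.succ_last]
    ring

lemma sum_incr {N : ℕ} (x : Fin N → ℝ) : ∑ i, incr x i = 1 := by
  simp only [incr, sum_succ_sub_castSucc, withEnds_zero, withEnds_last, sub_zero]

lemma isOpen_orderedSimplex (N : ℕ) : IsOpen (orderedSimplex N) := by
  have : orderedSimplex N = ⋂ i : Fin (N + 1),
      {x : Fin N → ℝ | withEnds x i.castSucc < withEnds x i.succ} := by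
    ext x
    simp only [orderedSimplex, Fin.strictMono_iff_lt_succ, Set.mem_iInter]
    rfl
  rw [this]
  exact isOpen_iInter_of_finite fun i =>
    isOpen_lt (continuous_withEnds _) (continuous_withEnds _)

lemma measurable_dirichletDensity (β : ℝ) {N : ℕ} (t : Fin N → ℝ) :
    Measurable (dirichletDensity β t) := by
  unfold dirichletDensity
  refine measurable_const.mul (Finset.measurable_prod _ fun i _ => ?_)
  exact (continuous_incr i).measurable.pow_const _

lemma dirichletDensity_nonneg {β : ℝ} (hβ : 0 < β) {N : ℕ} {t x : Fin N → ℝ}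
    (ht : t ∈ orderedSimplex N) (hx : x ∈ orderedSimplex N) : 0 ≤ dirichletDensity β t x := by
  unfold dirichletDensity
  refine mul_nonneg (div_nonneg (Real.Gamma_pos_of_pos hβ).le (Finset.prod_nonneg fun i _ =>
    (Real.Gamma_pos_of_pos (mul_pos hβ (incr_pos ht i))).le)) (Finset.prod_nonneg fun i _ =>
    Real.rpow_nonneg (incr_pos hx i).le _)

/-- `h` is an orientation preserving diffeomorphism of `[0,1]` with derivative `h'`, and `log h'`
is bounded by `δ` and Lipschitz with constant `δ`. -/
structure IsUnitDiffeo (h h' : ℝ → ℝ) (δ : ℝ) : Prop where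
  map_zero : h 0 = 0
  map_one : h 1 = 1
  hasDerivAt : ∀ x, HasDerivAt h (h' x) x
  deriv_pos : ∀ x ∈ Set.Icc (0 : ℝ) 1, 0 < h' x
  log_le : ∀ x ∈ Set.Icc (0 : ℝ) 1, |Real.log (h' x)| ≤ δ
  log_lip : ∀ x ∈ Set.Icc (0 : ℝ) 1, ∀ y ∈ Set.Icc (0 : ℝ) 1,
    |Real.log (h' x) - Real.log (h' y)| ≤ δ * |x - y|

namespace IsUnitDiffeo

variable {h h' : ℝ → ℝ} {δ : ℝ}

lemma continuous (H : IsUnitDiffeo h h' δ) : Continuous h :=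
  continuous_iff_continuousAt.2 fun x => (H.hasDerivAt x).continuousAt

lemma nonneg (H : IsUnitDiffeo h h' δ) : 0 ≤ δ :=
  (abs_nonneg _).trans (H.log_le 0 (by simp))

lemma strictMonoOn (H : IsUnitDiffeo h h' δ) : StrictMonoOn h (Set.Icc 0 1) := by
  refine strictMonoOn_of_deriv_pos (convex_Icc 0 1) H.continuous.continuousOn fun x hx => ?_
  rw [interior_Icc] at hx
  rw [(H.hasDerivAt x).deriv]
  exact H.deriv_pos x (Set.Ioo_subset_Icc_self hx)

lemma mapsTo (H : IsUnitDiffeo h h' δ) : Set.MapsTo h (Set.Icc 0 1) (Set.Icc 0 1) := by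
  intro x hx
  have hm := H.strictMonoOn.monotoneOn
  have a := hm (by simp) hx hx.1
  have b := hm hx (by simp) hx.2
  rw [H.map_zero] at a
  rw [H.map_one] at b
  exact ⟨a, b⟩

lemma image_orderedSimplex (H : IsUnitDiffeo h h' δ) (N : ℕ) :
    (fun (x : Fin N → ℝ) i => h (x i)) '' orderedSimplex N = orderedSimplex N := by
  ext y
  constructor
  · rintro ⟨x, hx, rfl⟩ i j hij
    simp only [withEnds_comp H.map_zero H.map_one]
    exact H.strictMonoOn (withEnds_mem_Icc hx i) (withEnds_mem_Icc hx j) (hx hij)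
  · intro hy
    have hsurj : ∀ i, ∃ a ∈ Set.Icc (0 : ℝ) 1, h a = y i := by
      intro i
      have := intermediate_value_Icc zero_le_one H.continuous.continuousOn
      rw [H.map_zero, H.map_one] at this
      have hi := withEnds_mem_Icc hy i.castSucc.succ
      rw [withEnds_castSucc_succ] at hi
      exact this hi
    choose x hx hxy using hsurj
    have hw : ∀ j, withEnds x j ∈ Set.Icc (0 : ℝ) 1 := by
      intro j
      induction j using withEnds_induction with
      | h0 => simp [withEnds_zero]
      | h1 => simp [withEnds_last]
      | h i => rw [withEnds_castSucc_succ]; exact hx i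
    have hyx : (fun i => h (x i)) = y := funext hxy
    refine ⟨x, fun i j hij => ?_, hyx⟩
    have := hy hij
    rw [← hyx, withEnds_comp H.map_zero H.map_one, withEnds_comp H.map_zero H.map_one] at this
    exact (H.strictMonoOn.lt_iff_lt (hw i) (hw j)).1 this

lemma exists_incr_eq (H : IsUnitDiffeo h h' δ) {N : ℕ} {x : Fin N → ℝ}
    (hx : x ∈ orderedSimplex N) (i : Fin (N + 1)) :
    ∃ ξ ∈ Set.Icc (withEnds x i.castSucc) (withEnds x i.succ),
      incr (fun i => h (x i)) i = h' ξ * incr x i := by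
  have hlt : withEnds x i.castSucc < withEnds x i.succ := hx i.castSucc_lt_succ
  obtain ⟨ξ, hξ, e⟩ := exists_hasDerivAt_eq_slope h h' hlt H.continuous.continuousOn
    fun x _ => H.hasDerivAt x
  refine ⟨ξ, Set.Ioo_subset_Icc_self hξ, ?_⟩
  rw [e, incr, incr, withEnds_comp H.map_zero H.map_one, withEnds_comp H.map_zero H.map_one,
    div_mul_cancel₀ _ (sub_pos.2 hlt).ne']

lemma exists_dirichletDensity_comp (H : IsUnitDiffeo h h' δ) {β : ℝ} (hβ : 0 < β) {N : ℕ}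
    {t x : Fin N → ℝ} (ht : t ∈ orderedSimplex N) (hx : x ∈ orderedSimplex N) :
    ∃ r : ℝ, |r| ≤ (β + 2) * δ ∧
      dirichletDensity β t (fun i => h (x i)) * ∏ i, h' (x i) =
        Real.exp r * dirichletDensity β t x := by
  choose ξ hξ hincr using H.exists_incr_eq hx
  have hξ1 : ∀ i, ξ i ∈ Set.Icc (0 : ℝ) 1 := fun i =>
    ⟨(withEnds_mem_Icc hx _).1.trans (hξ i).1, (hξ i).2.trans (withEnds_mem_Icc hx _).2⟩
  have hx1 : ∀ i, x i ∈ Set.Icc (0 : ℝ) 1 := fun i => by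
    have := withEnds_mem_Icc hx i.castSucc.succ
    rwa [withEnds_castSucc_succ] at this
  refine ⟨∑ i, Real.log (h' (ξ i)) * (β * incr t i - 1) + ∑ i, Real.log (h' (x i)), ?_, ?_⟩
  · have e : ∑ i, Real.log (h' (ξ i)) * (β * incr t i - 1) + ∑ i, Real.log (h' (x i)) =
        ∑ i, Real.log (h' (ξ i)) * (β * incr t i) +
          (∑ i : Fin N, (Real.log (h' (x i)) - Real.log (h' (ξ i.castSucc)))
            - Real.log (h' (ξ (Fin.last N)))) := by
      simp only [mul_sub, mul_one, Finset.sum_sub_distrib]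
      rw [Fin.sum_univ_castSucc (fun i => Real.log (h' (ξ i)))]
      ring
    have b1 : |∑ i, Real.log (h' (ξ i)) * (β * incr t i)| ≤ β * δ := by
      calc _ ≤ ∑ i, |Real.log (h' (ξ i)) * (β * incr t i)| := Finset.abs_sum_le_sum_abs _ _
        _ ≤ ∑ i, δ * (β * incr t i) := Finset.sum_le_sum fun i _ => by
            have := mul_pos hβ (incr_pos ht i)
            rw [abs_mul, abs_of_pos this]
            exact mul_le_mul_of_nonneg_right (H.log_le _ (hξ1 i)) this.le
        _ = β * δ := by rw [← Finset.mul_sum, ← Finset.mul_sum, sum_incr]; ring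
    have b2 : |∑ i : Fin N, (Real.log (h' (x i)) - Real.log (h' (ξ i.castSucc)))| ≤ δ := by
      calc _ ≤ ∑ i : Fin N, |Real.log (h' (x i)) - Real.log (h' (ξ i.castSucc))| :=
            Finset.abs_sum_le_sum_abs _ _
        _ ≤ ∑ i : Fin N, δ * incr x i.castSucc := Finset.sum_le_sum fun i _ => by
            refine (H.log_lip _ (hx1 i) _ (hξ1 _)).trans
              (mul_le_mul_of_nonneg_left ?_ H.nonneg)
            have := hξ i.castSucc
            rw [withEnds_castSucc_succ] at this
            rw [abs_of_nonneg (by linarith [this.2]), incr, withEnds_castSucc_succ]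
            linarith [this.1]
        _ ≤ δ * ∑ i, incr x i := by
            rw [← Finset.mul_sum, Fin.sum_univ_castSucc]
            exact mul_le_mul_of_nonneg_left (by linarith [incr_pos hx (Fin.last N)]) H.nonneg
        _ = δ := by rw [sum_incr, mul_one]
    have b3 := H.log_le _ (hξ1 (Fin.last N))
    rw [e]
    rw [abs_le] at b1 b2 b3 ⊢
    constructor <;> nlinarith
  · rw [Real.exp_add, Real.exp_sum, Real.exp_sum]
    have e1 : ∏ i, Real.exp (Real.log (h' (x i))) = ∏ i, h' (x i) :=
      Finset.prod_congr rfl fun i _ => Real.exp_log (H.deriv_pos _ (hx1 i))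
    have e2 : ∏ i, incr (fun i => h (x i)) i ^ (β * incr t i - 1) =
        (∏ i, Real.exp (Real.log (h' (ξ i)) * (β * incr t i - 1))) *
          ∏ i, incr x i ^ (β * incr t i - 1) := by
      rw [← Finset.prod_mul_distrib]
      refine Finset.prod_congr rfl fun i _ => ?_
      have hp := H.deriv_pos _ (hξ1 i)
      rw [hincr, Real.mul_rpow hp.le (incr_pos hx i).le, Real.rpow_def_of_pos hp]
    rw [e1, dirichletDensity, dirichletDensity, e2]
    ring

lemma abs_dirichletDensity_comp_sub_le (H : IsUnitDiffeo h h' δ) {β : ℝ} (hβ : 0 < β)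
    (hδ : (β + 2) * δ ≤ 1) {N : ℕ} {t x : Fin N → ℝ} (ht : t ∈ orderedSimplex N)
    (hx : x ∈ orderedSimplex N) :
    |dirichletDensity β t (fun i => h (x i)) * ∏ i, h' (x i) - dirichletDensity β t x| ≤
      2 * ((β + 2) * δ) * dirichletDensity β t x := by
  obtain ⟨r, hr, e⟩ := H.exists_dirichletDensity_comp hβ ht hx
  have hρ := dirichletDensity_nonneg hβ ht hx
  rw [e, show Real.exp r * dirichletDensity β t x - dirichletDensity β t x =
    (Real.exp r - 1) * dirichletDensity β t x by ring, abs_mul, abs_of_nonneg hρ]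
  refine mul_le_mul_of_nonneg_right ?_ hρ
  exact (Real.abs_exp_sub_one_le (hr.trans hδ)).trans (by linarith)

lemma integral_simplex_comp (H : IsUnitDiffeo h h' δ) {N : ℕ} (f : (Fin N → ℝ) → ℝ) :
    ∫ x in orderedSimplex N, f x =
      ∫ x in orderedSimplex N, (∏ i, h' (x i)) * f (fun i => h (x i)) := by
  have hd : ∀ x ∈ orderedSimplex N, HasFDerivWithinAt (fun (x : Fin N → ℝ) i => h (x i))
      (ContinuousLinearMap.pi fun i =>
        h' (x i) • (ContinuousLinearMap.proj i : (Fin N → ℝ) →L[ℝ] ℝ)) (orderedSimplex N) x := by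
    intro x _
    refine (hasFDerivAt_pi.2 fun i => ?_).hasFDerivWithinAt
    exact (H.hasDerivAt (x i)).comp_hasFDerivAt x (hasFDerivAt_apply i x)
  have hx1 : ∀ x ∈ orderedSimplex N, ∀ i, x i ∈ Set.Icc (0 : ℝ) 1 := fun x hx i => by
    have := withEnds_mem_Icc hx i.castSucc.succ
    rwa [withEnds_castSucc_succ] at this
  have hinj : Set.InjOn (fun (x : Fin N → ℝ) i => h (x i)) (orderedSimplex N) := by
    intro x hx y hy hxy
    funext i
    exact H.strictMonoOn.injOn (hx1 x hx i) (hx1 y hy i) (congrFun hxy i)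
  have := integral_image_eq_integral_abs_det_fderiv_smul volume
    (isOpen_orderedSimplex N).measurableSet hd hinj f
  rw [H.image_orderedSimplex] at this
  rw [this]
  refine setIntegral_congr_fun (isOpen_orderedSimplex N).measurableSet fun x hx => ?_
  have hdet : (ContinuousLinearMap.pi fun i =>
        h' (x i) • (ContinuousLinearMap.proj i : (Fin N → ℝ) →L[ℝ] ℝ)).det = ∏ i, h' (x i) := by
    have := ContinuousLinearMap.det_pi (R := ℝ) (M := ℝ) fun i : Fin N =>
      h' (x i) • ContinuousLinearMap.id ℝ ℝ
    simpa [ContinuousLinearMap.det] using this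
  simp only [hdet, smul_eq_mul]
  rw [abs_of_nonneg (Finset.prod_nonneg fun i _ => (H.deriv_pos _ (hx1 x hx i)).le)]

end IsUnitDiffeo

namespace IsDirichletProcess

variable {β : ℝ} {Q : Measure GZero}

lemma measurable_evals {N : ℕ} (t : Fin N → ℝ) :
    Measurable fun (g : GZero) i => g.val (t i) :=
  measurable_pi_iff.2 fun i => GZero.measurable_eval (t i)

lemma integral_evals (hQ : IsDirichletProcess β Q) (hβ : 0 < β) {N : ℕ} {t : Fin N → ℝ}
    (ht : t ∈ orderedSimplex N) {f : (Fin N → ℝ) → ℝ} (hf : Measurable f) :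
    ∫ g, f (fun i => g.val (t i)) ∂Q =
      ∫ x in orderedSimplex N, dirichletDensity β t x * f x := by
  have h1 : ∫ g, f (fun i => g.val (t i)) ∂Q =
      ∫ x, f x ∂(Q.map fun g i => g.val (t i)) :=
    (integral_map (measurable_evals t).aemeasurable hf.aestronglyMeasurable).symm
  rw [h1, hQ.map_eval N t ht, integral_withDensity_eq_integral_toReal_smul
    (measurable_dirichletDensity β t).ennreal_ofReal (Eventually.of_forall fun _ => by simp)]
  refine setIntegral_congr_fun (isOpen_orderedSimplex N).measurableSet fun x hx => ?_
  simp [ENNReal.toReal_ofReal (dirichletDensity_nonneg hβ ht hx)]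

lemma integrableOn_density (hQ : IsDirichletProcess β Q) (hβ : 0 < β) {N : ℕ} {t : Fin N → ℝ}
    (ht : t ∈ orderedSimplex N) : IntegrableOn (dirichletDensity β t) (orderedSimplex N) := by
  have := hQ.isProbabilityMeasure
  refine ⟨(measurable_dirichletDensity β t).aestronglyMeasurable, ?_⟩
  rw [hasFiniteIntegral_iff_ofReal ((ae_restrict_iff'
    (isOpen_orderedSimplex N).measurableSet).2 (Eventually.of_forall fun x hx =>
      dirichletDensity_nonneg hβ ht hx))]
  have h := congrArg (fun μ => μ Set.univ) (hQ.map_eval N t ht)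
  simp only [withDensity_apply _ MeasurableSet.univ, Measure.restrict_univ] at h
  rw [← h, Measure.map_apply (measurable_evals t) MeasurableSet.univ]
  exact measure_lt_top _ _

/-- Quasi-invariance of the finite dimensional distributions, with a bound that does not depend on
the number of time points. -/
lemma abs_integral_evals_comp_sub_le (hQ : IsDirichletProcess β Q) (hβ : 0 < β)
    {h h' : ℝ → ℝ} {δ : ℝ} (H : IsUnitDiffeo h h' δ) (hh' : Measurable h')
    (hδ : (β + 2) * δ ≤ 1) {N : ℕ}
    {t : Fin N → ℝ} (ht : t ∈ orderedSimplex N) {f : (Fin N → ℝ) → ℝ} (hf : Measurable f)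
    {C : ℝ} (hC : ∀ x, |f x| ≤ C) :
    |∫ g, f (fun i => h (g.val (t i))) ∂Q - ∫ g, f (fun i => g.val (t i)) ∂Q| ≤
      2 * ((β + 2) * δ) * ∫ g, |f (fun i => h (g.val (t i)))| ∂Q := by
  have hT : Measurable fun (x : Fin N → ℝ) i => h (x i) :=
    measurable_pi_iff.2 fun i => H.continuous.measurable.comp (measurable_pi_apply i)
  have hfT : Measurable fun x : Fin N → ℝ => f fun i => h (x i) := hf.comp hT
  have hρ := measurable_dirichletDensity β t
  have hS := (isOpen_orderedSimplex N).measurableSet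
  rw [hQ.integral_evals hβ ht hfT, hQ.integral_evals hβ ht hf,
    hQ.integral_evals hβ ht hfT.abs,
    H.integral_simplex_comp fun x => dirichletDensity β t x * f x]
  have hi := hQ.integrableOn_density hβ ht
  have i1 : IntegrableOn (fun x => dirichletDensity β t x * f fun i => h (x i))
      (orderedSimplex N) :=
    hi.mul_bdd (c := C) hfT.aestronglyMeasurable (Eventually.of_forall fun x => hC _)
  have hJ : Measurable fun x : Fin N → ℝ => ∏ i, h' (x i) :=
    Finset.measurable_prod _ fun i _ => hh'.comp (measurable_pi_apply i)
  have i2 : IntegrableOn (fun x : Fin N → ℝ => (∏ i, h' (x i)) *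
      (dirichletDensity β t (fun i => h (x i)) * f fun i => h (x i))) (orderedSimplex N) := by
    have i3 : IntegrableOn (fun x : Fin N → ℝ =>
        dirichletDensity β t (fun i => h (x i)) * ∏ i, h' (x i)) (orderedSimplex N) := by
      refine (hi.const_mul (1 + 2 * ((β + 2) * δ))).mono'
        ((hρ.comp hT).mul hJ).aestronglyMeasurable ?_
      refine (ae_restrict_iff' hS).2 (Eventually.of_forall fun x hx => ?_)
      have := H.abs_dirichletDensity_comp_sub_le hβ hδ ht hx
      have h0 := dirichletDensity_nonneg hβ ht hx
      have h1 := abs_sub_abs_le_abs_sub (dirichletDensity β t (fun i => h (x i)) *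
        ∏ i, h' (x i)) (dirichletDensity β t x)
      rw [abs_of_nonneg h0] at h1
      rw [Real.norm_eq_abs]
      linarith
    refine (i3.mul_bdd (c := C) hfT.aestronglyMeasurable
      (Eventually.of_forall fun x => hC _)).congr (Eventually.of_forall fun x => ?_)
    simp only
    ring
  rw [← integral_sub i1 i2, ← integral_const_mul]
  refine (abs_integral_le_integral_abs).trans
    (setIntegral_mono_on (i1.sub i2).abs ?_ hS fun x hx => ?_)
  · exact (hi.mul_bdd (c := C) hfT.abs.aestronglyMeasurable
      (Eventually.of_forall fun x => by simpa using hC _)).const_mul _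
  · have := H.abs_dirichletDensity_comp_sub_le hβ hδ ht hx
    have e : dirichletDensity β t x * f (fun i => h (x i)) - (∏ i, h' (x i)) *
        (dirichletDensity β t (fun i => h (x i)) * f fun i => h (x i)) =
        -(dirichletDensity β t (fun i => h (x i)) * ∏ i, h' (x i) - dirichletDensity β t x) *
          f (fun i => h (x i)) := by ring
    rw [e, abs_mul, abs_neg, ← mul_assoc]
    exact mul_le_mul_of_nonneg_right this (abs_nonneg _)

end IsDirichletProcess

lemma integral_unitLeb (f : ℝ → ℝ) : ∫ s, f s ∂unitLeb = ∫ s in (0 : ℝ)..1, f s := by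
  rw [unitLeb, integral_Icc_eq_integral_Ioc, intervalIntegral.integral_of_le zero_le_one]

lemma GZero.intervalIntegrable_comp (g : GZero) {a : ℝ → ℝ} (ha : Continuous a) (x y : ℝ) :
    IntervalIntegrable (fun s => a (g.val s)) volume x y := by
  obtain ⟨C, hC⟩ := isCompact_Icc.exists_bound_of_continuousOn (s := Set.Icc (0 : ℝ) 1)
    ha.continuousOn
  exact (intervalIntegrable_const (c := C)).mono_fun
    (ha.measurable.comp g.val_measurable).aestronglyMeasurable
    (Eventually.of_forall fun s => (hC _ (g.val_mem s)).trans (le_abs_self C))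

/-- Riemann sums of a Lipschitz function of a monotone function converge with rate `1 / N`. -/
lemma GZero.abs_riemannSum_sub_le (g : GZero) {a : ℝ → ℝ} (ha : Continuous a) {L : ℝ}
    (hL0 : 0 ≤ L)
    (hL : ∀ x ∈ Set.Icc (0 : ℝ) 1, ∀ y ∈ Set.Icc (0 : ℝ) 1, |a x - a y| ≤ L * |x - y|) (N : ℕ) :
    |1 / ((N : ℝ) + 1) * ∑ i ∈ Finset.range (N + 1), a (g.val (((i : ℝ) + 1) / (N + 1))) -
      ∫ s, a (g.val s) ∂unitLeb| ≤ L / (N + 1) := by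
  have hN : (0 : ℝ) < (N : ℝ) + 1 := by positivity
  set τ : ℕ → ℝ := fun i => (i : ℝ) / (N + 1) with hτ
  have hτ0 : τ 0 = 0 := by simp [hτ]
  have hτ1 : τ (N + 1) = 1 := by simp only [hτ]; push_cast; exact div_self hN.ne'
  have hτs : ∀ i, τ (i + 1) - τ i = 1 / (N + 1) := fun i => by
    simp only [hτ]; push_cast; ring
  have hτm : ∀ i, τ i ≤ τ (i + 1) := fun i => by
    have := hτs i
    have : (0 : ℝ) < 1 / (N + 1) := by positivity
    linarith
  have hint := fun i (_ : i < N + 1) => g.intervalIntegrable_comp ha (τ i) (τ (i + 1))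
  have h1 := intervalIntegral.sum_integral_adjacent_intervals hint
  rw [hτ0, hτ1] at h1
  have e : ∀ i : ℕ, ((i : ℝ) + 1) / (N + 1) = τ (i + 1) := fun i => by simp [hτ]
  simp only [e]
  rw [integral_unitLeb, ← h1, Finset.mul_sum, ← Finset.sum_sub_distrib]
  have hb : ∀ i ∈ Finset.range (N + 1), |1 / ((N : ℝ) + 1) * a (g.val (τ (i + 1))) -
      ∫ s in τ i..τ (i + 1), a (g.val s)| ≤
        L / (N + 1) * (g.val (τ (i + 1)) - g.val (τ i)) := by
    intro i _
    have e1 : 1 / ((N : ℝ) + 1) * a (g.val (τ (i + 1))) =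
        ∫ s in τ i..τ (i + 1), a (g.val (τ (i + 1))) := by
      rw [intervalIntegral.integral_const, hτs, smul_eq_mul]
    rw [e1, ← intervalIntegral.integral_sub intervalIntegrable_const
      (g.intervalIntegrable_comp ha _ _)]
    have := intervalIntegral.norm_integral_le_of_norm_le_const (a := τ i) (b := τ (i + 1))
      (f := fun s => a (g.val (τ (i + 1))) - a (g.val s))
      (C := L * (g.val (τ (i + 1)) - g.val (τ i))) (fun s hs => by
        rw [Set.uIoc_of_le (hτm i)] at hs
        refine (hL _ (g.val_mem _) _ (g.val_mem _)).trans (mul_le_mul_of_nonneg_left ?_ hL0)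
        have a1 := g.val_mono hs.1.le
        have a2 := g.val_mono hs.2
        rw [abs_of_nonneg (by linarith)]
        linarith)
    rw [hτs, abs_of_pos (by positivity)] at this
    refine this.trans (le_of_eq ?_)
    ring
  refine (Finset.abs_sum_le_sum_abs _ _).trans ((Finset.sum_le_sum hb).trans ?_)
  rw [← Finset.mul_sum, Finset.sum_range_sub (fun i => g.val (τ i))]
  have a1 := (g.val_mem (τ (N + 1))).2
  have a2 := (g.val_mem (τ 0)).1
  calc _ ≤ L / (N + 1) * 1 := mul_le_mul_of_nonneg_left (by linarith) (by positivity)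
    _ = _ := mul_one _

/-- The equidistant time points `1/(N+1), …, N/(N+1)`. -/
def equiPoints (N : ℕ) (i : Fin N) : ℝ := ((i : ℝ) + 1) / (N + 1)

lemma withEnds_equiPoints (N : ℕ) (j : Fin (N + 2)) :
    withEnds (equiPoints N) j = (j : ℝ) / (N + 1) := by
  induction j using withEnds_induction with
  | h0 => simp [withEnds_zero]
  | h1 =>
    rw [withEnds_last, Fin.val_last]
    push_cast
    exact (div_self (by positivity)).symm
  | h i => simp [withEnds_castSucc_succ, equiPoints]

lemma equiPoints_mem (N : ℕ) : equiPoints N ∈ orderedSimplex N := by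
  intro i j hij
  rw [withEnds_equiPoints, withEnds_equiPoints]
  have : (i : ℝ) < j := by exact_mod_cast hij
  gcongr

lemma withEnds_comp_equiPoints_succ {N : ℕ} {k : ℝ → ℝ} (hk : k 1 = 1) (i : Fin (N + 1)) :
    withEnds (fun j => k (equiPoints N j)) i.succ = k (((i : ℝ) + 1) / (N + 1)) := by
  induction i using Fin.lastCases with
  | last =>
    rw [Fin.succ_last, withEnds_last, Fin.val_last, div_self (by positivity), hk]
  | cast i => simp [withEnds_castSucc_succ, equiPoints]

namespace CylZ

/-- The vector of the integrals `∫₀¹ αₖ(h(g(s))) ds`. -/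
def momentsComp (F : CylZ) (h : ℝ → ℝ) (g : GZero) (k : Fin F.m) : ℝ :=
  ∫ s, F.αext k (h (g.val s)) ∂unitLeb

lemma measurable_momentsComp (F : CylZ) {h : ℝ → ℝ} (hh : Continuous h) :
    Measurable (F.momentsComp h) := by
  refine measurable_pi_iff.2 fun i => ?_
  have : Measurable fun p : GZero × ℝ => F.αext i (h (p.1.val p.2)) :=
    ((F.continuous_αext i).comp hh).measurable.comp GZero.measurable_uncurry_val
  exact this.stronglyMeasurable.integral_prod_right.measurable

/-- The discretisation of a cylinder function as a function of finitely many values. -/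
def discrete (F : CylZ) (N : ℕ) (x : Fin N → ℝ) : ℝ :=
  F.U fun k => 1 / ((N : ℝ) + 1) * ∑ i : Fin (N + 1),
    F.αext k (Set.projIcc (0 : ℝ) 1 zero_le_one (withEnds x i.succ))

lemma continuous_discrete (F : CylZ) (N : ℕ) : Continuous (F.discrete N) := by
  refine F.contDiff_U.continuous.comp (continuous_pi fun k => continuous_const.mul ?_)
  refine continuous_finsetSum _ fun i _ => (F.continuous_αext k).comp ?_
  exact continuous_subtype_val.comp (continuous_projIcc.comp (continuous_withEnds _))

lemma exists_bound_discrete (F : CylZ) : ∃ C, ∀ N x, |F.discrete N x| ≤ C := by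
  obtain ⟨R, hR0, hR⟩ := F.exists_bound_αext
  obtain ⟨C, hC⟩ := (isCompact_closedBall (0 : Fin F.m → ℝ) R).exists_bound_of_continuousOn
    F.contDiff_U.continuous.continuousOn
  refine ⟨C, fun N x => hC _ ?_⟩
  rw [mem_closedBall_zero_iff, pi_norm_le_iff_of_nonneg hR0]
  intro k
  rw [Real.norm_eq_abs, abs_mul, abs_of_pos (by positivity)]
  have : |∑ i : Fin (N + 1), F.αext k (Set.projIcc (0 : ℝ) 1 zero_le_one (withEnds x i.succ))| ≤
      ∑ _i : Fin (N + 1), R :=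
    (Finset.abs_sum_le_sum_abs _ _).trans (Finset.sum_le_sum fun i _ =>
      hR k _ (Subtype.coe_prop _))
  rw [Finset.sum_const, Finset.card_univ, Fintype.card_fin, nsmul_eq_mul] at this
  push_cast at this
  calc _ ≤ 1 / ((N : ℝ) + 1) * (((N : ℝ) + 1) * R) :=
        mul_le_mul_of_nonneg_left this (by positivity)
    _ = R := by field_simp

lemma abs_αext_sub_le (F : CylZ) {C : ℝ} (hC : ∀ i x, |F.dα i x| ≤ C) (i : Fin F.m) (x y : ℝ) :
    |F.αext i x - F.αext i y| ≤ C * |x - y| :=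
  Convex.norm_image_sub_le_of_norm_hasDerivWithin_le (s := Set.univ)
    (fun z _ => (F.hasDerivAt_αext i z).hasDerivWithinAt) (fun z _ => hC i z) convex_univ
    (Set.mem_univ y) (Set.mem_univ x)

lemma tendsto_discrete (F : CylZ) {h h' : ℝ → ℝ} {δ : ℝ} (H : IsUnitDiffeo h h' δ) (g : GZero) :
    Tendsto (fun N => F.discrete N fun i => h (g.val (equiPoints N i))) atTop
      (𝓝 (F.U (F.momentsComp h g))) := by
  refine (F.contDiff_U.continuous.tendsto _).comp (tendsto_pi_nhds.2 fun k => ?_)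
  obtain ⟨C, hC0, hC⟩ := F.exists_bound_dα
  have hlip : ∀ x ∈ Set.Icc (0 : ℝ) 1, ∀ y ∈ Set.Icc (0 : ℝ) 1,
      |F.αext k (h x) - F.αext k (h y)| ≤ C * Real.exp δ * |x - y| := by
    intro x hx y hy
    refine (F.abs_αext_sub_le hC k _ _).trans ?_
    rw [mul_assoc]
    refine mul_le_mul_of_nonneg_left ?_ hC0
    refine Convex.norm_image_sub_le_of_norm_hasDerivWithin_le
      (fun z _ => (H.hasDerivAt z).hasDerivWithinAt) (fun z hz => ?_) (convex_Icc 0 1) hy hx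
    have hp := H.deriv_pos z hz
    rw [Real.norm_eq_abs, abs_of_pos hp, ← Real.exp_log hp]
    exact Real.exp_le_exp.2 ((le_abs_self _).trans (H.log_le z hz))
  rw [tendsto_iff_norm_sub_tendsto_zero]
  have hz : Tendsto (fun N : ℕ => C * Real.exp δ / ((N : ℝ) + 1)) atTop (𝓝 0) :=
    tendsto_const_nhds.div_atTop
      (tendsto_natCast_atTop_atTop.atTop_add (tendsto_const_nhds (x := (1 : ℝ))))
  refine squeeze_zero (fun _ => norm_nonneg _) (fun N => ?_) hz
  have e : ∀ i : Fin (N + 1), F.αext k (Set.projIcc (0 : ℝ) 1 zero_le_one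
      (withEnds (fun i => h (g.val (equiPoints N i))) i.succ)) =
        F.αext k (h (g.val (((i : ℝ) + 1) / (N + 1)))) := by
    intro i
    have := withEnds_comp_equiPoints_succ (N := N) (k := fun x => h (g.val x))
      (by rw [g.val_of_one_le le_rfl, H.map_one]) i
    rw [this, Set.projIcc_of_mem _ (H.mapsTo (g.val_mem _))]
  simp only [e]
  rw [Fin.sum_univ_eq_sum_range (fun i => F.αext k (h (g.val (((i : ℝ) + 1) / (N + 1))))) (N + 1)]
  exact g.abs_riemannSum_sub_le ((F.continuous_αext k).comp H.continuous) (by positivity) hlip N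

end CylZ

lemma isUnitDiffeo_id : IsUnitDiffeo (fun x => x) (fun _ => 1) 0 where
  map_zero := rfl
  map_one := rfl
  hasDerivAt := hasDerivAt_id
  deriv_pos := by simp
  log_le := by simp
  log_lip := by simp

lemma CylZ.U_momentsComp_id (F : CylZ) (g : GZero) :
    F.U (F.momentsComp (fun x => x) g) = F.eval g := by
  have : F.momentsComp (fun x => x) g = F.moments g := funext fun k => (F.moments_eq g k).symm
  rw [this]; rfl

/-- Quasi-invariance of the Dirichlet process under `g ↦ h ∘ g`, tested on cylinder functions. -/
lemma IsDirichletProcess.abs_integral_comp_sub_le {β : ℝ} {Q : Measure GZero}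
    (hQ : IsDirichletProcess β Q) (hβ : 0 < β) {h h' : ℝ → ℝ} {δ : ℝ} (H : IsUnitDiffeo h h' δ)
    (hh' : Measurable h') (hδ : (β + 2) * δ ≤ 1) (F : CylZ) :
    |∫ g, F.U (F.momentsComp h g) ∂Q - ∫ g, F.eval g ∂Q| ≤
      2 * ((β + 2) * δ) * ∫ g, |F.U (F.momentsComp h g)| ∂Q := by
  have := hQ.isProbabilityMeasure
  obtain ⟨C, hC⟩ := F.exists_bound_discrete
  have hm : ∀ (k : ℝ → ℝ), Continuous k → ∀ N, Measurable fun g : GZero =>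
      F.discrete N fun i => k (g.val (equiPoints N i)) := fun k hk N =>
    (F.continuous_discrete N).measurable.comp (measurable_pi_iff.2 fun i =>
      hk.measurable.comp (GZero.measurable_eval _))
  have t1 : Tendsto (fun N => ∫ g : GZero, F.discrete N (fun i => h (g.val (equiPoints N i))) ∂Q)
      atTop (𝓝 (∫ g, F.U (F.momentsComp h g) ∂Q)) :=
    tendsto_integral_of_dominated_convergence (fun _ => C)
      (fun N => (hm h H.continuous N).aestronglyMeasurable) (integrable_const C)
      (fun N => Eventually.of_forall fun g => hC N _)
      (Eventually.of_forall fun g => F.tendsto_discrete H g)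
  have t2 : Tendsto (fun N => ∫ g : GZero, F.discrete N (fun i => g.val (equiPoints N i)) ∂Q)
      atTop (𝓝 (∫ g, F.eval g ∂Q)) :=
    tendsto_integral_of_dominated_convergence (fun _ => C)
      (fun N => (hm _ continuous_id N).aestronglyMeasurable) (integrable_const C)
      (fun N => Eventually.of_forall fun g => hC N _)
      (Eventually.of_forall fun g => by
        have := F.tendsto_discrete isUnitDiffeo_id g
        rwa [F.U_momentsComp_id] at this)
  have t3 : Tendsto (fun N => ∫ g : GZero, |F.discrete N fun i => h (g.val (equiPoints N i))| ∂Q)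
      atTop (𝓝 (∫ g, |F.U (F.momentsComp h g)| ∂Q)) :=
    tendsto_integral_of_dominated_convergence (fun _ => C)
      (fun N => (hm h H.continuous N).abs.aestronglyMeasurable) (integrable_const C)
      (fun N => Eventually.of_forall fun g => by simpa using hC N _)
      (Eventually.of_forall fun g => (F.tendsto_discrete H g).abs)
  exact le_of_tendsto_of_tendsto' (t1.sub t2).abs (t3.const_mul _) fun N =>
    hQ.abs_integral_evals_comp_sub_le hβ H hh' hδ (equiPoints_mem N)
      (F.continuous_discrete N).measurable (hC N)

/-- A vector field on `[0,1]` of class `C^{1,1}` that vanishes at the end points. -/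
structure IsUnitField (φ φ' : ℝ → ℝ) (K : ℝ) : Prop where
  map_zero : φ 0 = 0
  map_one : φ 1 = 0
  hasDerivAt : ∀ x, HasDerivAt φ (φ' x) x
  nonneg : 0 ≤ K
  apply_le : ∀ x ∈ Set.Icc (0 : ℝ) 1, |φ x| ≤ K
  deriv_le : ∀ x ∈ Set.Icc (0 : ℝ) 1, |φ' x| ≤ K
  deriv_lip : ∀ x ∈ Set.Icc (0 : ℝ) 1, ∀ y ∈ Set.Icc (0 : ℝ) 1, |φ' x - φ' y| ≤ K * |x - y|

lemma abs_log_sub_log_le {a b : ℝ} (ha : 1 / 2 ≤ a) (hb : 1 / 2 ≤ b) :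
    |Real.log a - Real.log b| ≤ 2 * |a - b| := by
  have key : ∀ x y : ℝ, 1 / 2 ≤ x → 1 / 2 ≤ y → Real.log x - Real.log y ≤ 2 * |x - y| := by
    intro x y hx hy
    rw [← Real.log_div (by linarith) (by linarith)]
    have hy' : 0 < y := by linarith
    have hx' : 0 < x := by linarith
    refine (Real.log_le_sub_one_of_pos (by positivity)).trans ?_
    rw [div_sub_one hy'.ne', div_le_iff₀ hy']
    have := le_abs_self (x - y)
    nlinarith [abs_nonneg (x - y)]
  rw [abs_le]
  constructor
  · have := key b a hb ha
    rw [abs_sub_comm] at this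
    linarith
  · exact key a b ha hb

namespace IsUnitField

variable {φ φ' : ℝ → ℝ} {K : ℝ}

lemma continuous (H : IsUnitField φ φ' K) : Continuous φ :=
  continuous_iff_continuousAt.2 fun x => (H.hasDerivAt x).continuousAt

lemma isUnitDiffeo (H : IsUnitField φ φ' K) {ε : ℝ} (hε : 0 ≤ ε) (hεK : ε * K ≤ 1 / 2) :
    IsUnitDiffeo (fun x => x + ε * φ x) (fun x => 1 + ε * φ' x) (2 * K * ε) := by
  have hhalf : ∀ x ∈ Set.Icc (0 : ℝ) 1, 1 / 2 ≤ 1 + ε * φ' x := by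
    intro x hx
    have := (abs_le.1 (H.deriv_le x hx)).1
    nlinarith
  refine ⟨by simp [H.map_zero], by simp [H.map_one],
    fun x => (hasDerivAt_id x).add ((H.hasDerivAt x).const_mul ε),
    fun x hx => by linarith [hhalf x hx], fun x hx => ?_, fun x hx y hy => ?_⟩
  · have := abs_log_sub_log_le (hhalf x hx) (b := 1) (by norm_num)
    rw [Real.log_one, sub_zero] at this
    refine this.trans ?_
    rw [add_sub_cancel_left, abs_mul, abs_of_nonneg hε]
    nlinarith [H.deriv_le x hx]
  · refine (abs_log_sub_log_le (hhalf x hx) (hhalf y hy)).trans ?_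
    rw [show 1 + ε * φ' x - (1 + ε * φ' y) = ε * (φ' x - φ' y) by ring, abs_mul,
      abs_of_nonneg hε]
    nlinarith [mul_le_mul_of_nonneg_left (H.deriv_lip x hx y hy) hε]

end IsUnitField

namespace CylZ

/-- The derivative of a cylinder function in the direction `φ ∘ g`. -/
def gradDir (F : CylZ) (φ : ℝ → ℝ) (g : GZero) : ℝ := ∫ t, F.grad (g, t) * φ (g.val t) ∂unitLeb

lemma hasDerivAt_eval (F : CylZ) {φ φ' : ℝ → ℝ} {K : ℝ} (H : IsUnitField φ φ' K) (g : GZero) :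
    HasDerivAt (fun ε => F.U (F.momentsComp (fun x => x + ε * φ x) g)) (F.gradDir φ g) 0 := by
  obtain ⟨C, hC0, hC⟩ := F.exists_bound_dα
  have hm : ∀ k, HasDerivAt (fun ε => F.momentsComp (fun x => x + ε * φ x) g k)
      (∫ s, F.dα k (g.val s) * φ (g.val s) ∂unitLeb) 0 := by
    intro k
    have hmeas : ∀ ε, Measurable fun s => F.αext k (g.val s + ε * φ (g.val s)) := fun ε =>
      (((F.continuous_αext k).comp (continuous_id.add (H.continuous.const_mul ε))).measurable).comp
        g.val_measurable
    have := hasDerivAt_integral_of_dominated_loc_of_deriv_le (μ := unitLeb) (𝕜 := ℝ)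
      (F := fun ε s => F.αext k (g.val s + ε * φ (g.val s)))
      (F' := fun ε s => F.dα k (g.val s + ε * φ (g.val s)) * φ (g.val s)) (x₀ := 0)
      (s := Set.univ) (bound := fun _ => C * K) univ_mem
      (Eventually.of_forall fun ε => (hmeas ε).aestronglyMeasurable)
      (by
        obtain ⟨B, hB0, hB⟩ := F.exists_bound_αext
        refine Integrable.of_bound (hmeas 0).aestronglyMeasurable B
          (Eventually.of_forall fun s => ?_)
        simpa using hB k _ (g.val_mem s))
      (by
        refine Measurable.aestronglyMeasurable ?_
        exact (((F.continuous_dα k).comp (continuous_id.add (H.continuous.const_mul 0))).mul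
          H.continuous).measurable.comp g.val_measurable)
      (Eventually.of_forall fun s ε _ => by
        rw [Real.norm_eq_abs, abs_mul]
        exact mul_le_mul (hC k _) (H.apply_le _ (g.val_mem s)) (abs_nonneg _) hC0)
      (integrable_const _)
      (Eventually.of_forall fun s ε _ => by
        have h1 : HasDerivAt (fun ε => g.val s + ε * φ (g.val s)) (φ (g.val s)) ε := by
          simpa using ((hasDerivAt_id ε).mul_const (φ (g.val s))).const_add (g.val s)
        exact (F.hasDerivAt_αext k _).comp ε h1)
    have h2 := this.2
    simp only [zero_mul, add_zero] at h2
    exact h2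
  have h2 := (F.contDiff_U.differentiable one_ne_zero (F.moments g)).hasFDerivAt
  have e0 : F.moments g = F.momentsComp (fun x => x + 0 * φ x) g := by
    funext k
    rw [F.moments_eq]
    simp [momentsComp]
  have h3 := HasFDerivAt.comp_hasDerivAt (x := (0 : ℝ)) (l := F.U)
    (f := fun ε => F.momentsComp (fun x => x + ε * φ x) g) (e0 ▸ h2) (hasDerivAt_pi.2 hm)
  suffices hval : F.gradDir φ g = fderiv ℝ F.U (F.momentsComp (fun x => x + 0 * φ x) g)
      (fun i => ∫ s, F.dα i (g.val s) * φ (g.val s) ∂unitLeb) by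
    rw [hval]; exact h3
  have hsum : ∀ (A : (Fin F.m → ℝ) →L[ℝ] ℝ) (v : Fin F.m → ℝ),
      A v = ∑ i, A (Pi.single i 1) * v i := fun A v => by
    conv_lhs => rw [pi_eq_sum_univ' v]
    simp [mul_comm]
  rw [← e0, hsum]
  simp only [gradDir, grad_eq, Finset.sum_mul]
  rw [integral_finsetSum]
  · refine Finset.sum_congr rfl fun i _ => ?_
    rw [← integral_const_mul]
    exact integral_congr_ae (Eventually.of_forall fun s => by simp only; ring)
  · intro i _
    have : Measurable fun s => F.dα i (g.val s) * φ (g.val s) :=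
      ((F.continuous_dα i).mul H.continuous).measurable.comp g.val_measurable
    simp only [mul_assoc]
    refine (Integrable.of_bound this.aestronglyMeasurable (C * K)
      (Eventually.of_forall fun s => ?_)).const_mul _
    rw [Real.norm_eq_abs, abs_mul]
    exact mul_le_mul (hC i _) (H.apply_le _ (g.val_mem s)) (abs_nonneg _) hC0

lemma exists_lipschitz_eval (F : CylZ) {φ φ' : ℝ → ℝ} {K : ℝ} (H : IsUnitField φ φ' K) :
    ∃ L, ∀ ε, |ε| ≤ 1 → ∀ g,
      |F.U (F.momentsComp (fun x => x + ε * φ x) g) - F.eval g| ≤ L * |ε| := by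
  obtain ⟨C, hC0, hC⟩ := F.exists_bound_dα
  obtain ⟨R, hR0, hR⟩ := F.exists_bound_moments
  obtain ⟨M, hM⟩ := (isCompact_closedBall (0 : Fin F.m → ℝ)
    (R + C * K)).exists_bound_of_continuousOn
      (F.contDiff_U.continuous_fderiv one_ne_zero).continuousOn
  have hK := H.nonneg
  have hd : ∀ ε g, ‖F.momentsComp (fun x => x + ε * φ x) g - F.moments g‖ ≤ C * K * |ε| := by
    intro ε g
    refine (pi_norm_le_iff_of_nonneg (by positivity)).2 fun k => ?_
    have hi : ∀ ε, Integrable (fun s => F.αext k (g.val s + ε * φ (g.val s))) unitLeb := fun ε => by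
      have hc := (F.continuous_αext k).comp (continuous_id.add (H.continuous.const_mul ε))
      obtain ⟨B, hB⟩ := isCompact_Icc.exists_bound_of_continuousOn (s := Set.Icc (0 : ℝ) 1)
        hc.continuousOn
      exact Integrable.of_bound (hc.measurable.comp g.val_measurable).aestronglyMeasurable B
        (Eventually.of_forall fun s => hB _ (g.val_mem s))
    have hi0 : Integrable (fun s => F.αext k (g.val s)) unitLeb := by simpa using hi 0
    rw [Pi.sub_apply, F.moments_eq, momentsComp, ← integral_sub (hi ε) hi0]
    have := norm_integral_le_of_norm_le_const (μ := unitLeb)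
      (f := fun s => F.αext k (g.val s + ε * φ (g.val s)) - F.αext k (g.val s))
      (C := C * K * |ε|) (Eventually.of_forall fun s => by
        refine (F.abs_αext_sub_le hC k _ _).trans ?_
        rw [add_sub_cancel_left, abs_mul, mul_assoc, mul_comm |ε|]
        gcongr
        exact H.apply_le _ (g.val_mem s))
    simpa using this
  refine ⟨M * (C * K), fun ε hε g => ?_⟩
  have hM0 : 0 ≤ M := (norm_nonneg _).trans (hM 0 (by simp; positivity))
  have h1 : F.moments g ∈ Metric.closedBall (0 : Fin F.m → ℝ) (R + C * K) := by
    rw [mem_closedBall_zero_iff]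
    exact (hR g).trans (by linarith [mul_nonneg hC0 hK])
  have h2 : F.momentsComp (fun x => x + ε * φ x) g ∈
      Metric.closedBall (0 : Fin F.m → ℝ) (R + C * K) := by
    rw [mem_closedBall_zero_iff]
    have a := norm_le_norm_add_norm_sub' (F.momentsComp (fun x => x + ε * φ x) g) (F.moments g)
    have b := hd ε g
    have c : C * K * |ε| ≤ C * K := mul_le_of_le_one_right (by positivity) hε
    linarith [hR g]
  have := Convex.norm_image_sub_le_of_norm_hasFDerivWithin_le (𝕜 := ℝ)
    (fun x _ => (F.contDiff_U.differentiable one_ne_zero x).hasFDerivAt.hasFDerivWithinAt)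
    hM (convex_closedBall _ _) h1 h2
  calc _ ≤ M * ‖F.momentsComp (fun x => x + ε * φ x) g - F.moments g‖ := this
    _ ≤ M * (C * K * |ε|) := mul_le_mul_of_nonneg_left (hd ε g) hM0
    _ = _ := by ring

end CylZ

/-- The distribution `u ↦ 𝔼[⟨𝔻u, φ ∘ g⟩]` is dominated by the `L¹` norm. -/
lemma IsDirichletProcess.abs_integral_gradDir_le {β : ℝ} {Q : Measure GZero}
    (hQ : IsDirichletProcess β Q) (hβ : 0 < β) {φ φ' : ℝ → ℝ} {K : ℝ} (H : IsUnitField φ φ' K)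
    (hφ' : Measurable φ') (F : CylZ) :
    |∫ g, F.gradDir φ g ∂Q| ≤ 4 * (β + 2) * K * ∫ g, |F.eval g| ∂Q := by
  have := hQ.isProbabilityMeasure
  obtain ⟨L, hL⟩ := F.exists_lipschitz_eval H
  obtain ⟨C, hC0, hC⟩ := F.exists_bound_eval
  have hcont : ∀ ε, Continuous fun x => x + ε * φ x := fun ε =>
    continuous_id.add (H.continuous.const_mul ε)
  have hm : ∀ ε, Measurable fun g => F.U (F.momentsComp (fun x => x + ε * φ x) g) := fun ε =>
    F.contDiff_U.continuous.measurable.comp (F.measurable_momentsComp (hcont ε))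
  have hsmall : ∀ᶠ ε in 𝓝[>] (0 : ℝ), 0 < ε ∧ ε ≤ 1 ∧ ε * K ≤ 1 / 2 ∧
      (β + 2) * (2 * K * ε) ≤ 1 := by
    have a1 : ∀ᶠ ε in 𝓝 (0 : ℝ), ε < 1 := eventually_lt_nhds one_pos
    have a2 : ∀ᶠ ε in 𝓝 (0 : ℝ), ε * K < 1 / 2 := by
      have : Tendsto (fun ε : ℝ => ε * K) (𝓝 0) (𝓝 (0 * K)) := tendsto_id.mul_const K
      exact this.eventually_lt_const (by norm_num)
    have a3 : ∀ᶠ ε in 𝓝 (0 : ℝ), (β + 2) * (2 * K * ε) < 1 := by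
      have : Tendsto (fun ε : ℝ => (β + 2) * (2 * K * ε)) (𝓝 0) (𝓝 ((β + 2) * (2 * K * 0))) :=
        (tendsto_id.const_mul _).const_mul _
      exact this.eventually_lt_const (by norm_num)
    filter_upwards [self_mem_nhdsWithin, nhdsWithin_le_nhds a1, nhdsWithin_le_nhds a2,
      nhdsWithin_le_nhds a3] with ε h0 h1 h2 h3 using ⟨h0, h1.le, h2.le, h3.le⟩
  have habs : ∀ ε, 0 < ε → ε ≤ 1 → ∀ g,
      |F.U (F.momentsComp (fun x => x + ε * φ x) g)| ≤ C + |L| := by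
    intro ε h0 h1 g
    have a := hL ε (by rwa [abs_of_pos h0]) g
    have b := abs_sub_abs_le_abs_sub (F.U (F.momentsComp (fun x => x + ε * φ x) g)) (F.eval g)
    have c : L * |ε| ≤ |L| := by
      rw [abs_of_pos h0]
      nlinarith [le_abs_self L, abs_nonneg L]
    linarith [hC g]
  have t1 : Tendsto (fun ε => ∫ g, ε⁻¹ * (F.U (F.momentsComp (fun x => x + ε * φ x) g) -
      F.eval g) ∂Q) (𝓝[>] 0) (𝓝 (∫ g, F.gradDir φ g ∂Q)) := by
    refine tendsto_integral_filter_of_dominated_convergence (fun _ => |L|)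
      (Eventually.of_forall fun ε => (((hm ε).sub F.measurable_eval).const_mul
        _).aestronglyMeasurable) ?_ (integrable_const _) (Eventually.of_forall fun g => ?_)
    · filter_upwards [hsmall] with ε hε
      refine Eventually.of_forall fun g => ?_
      have a := hL ε (by rw [abs_of_pos hε.1]; exact hε.2.1) g
      rw [Real.norm_eq_abs, abs_mul, abs_of_pos (inv_pos.2 hε.1), inv_mul_le_iff₀ hε.1]
      rw [abs_of_pos hε.1] at a
      nlinarith [le_abs_self L, hε.1]
    · have := (F.hasDerivAt_eval H g).tendsto_slope_zero_right
      refine this.congr fun ε => ?_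
      have e : F.U (F.momentsComp (fun x => x + 0 * φ x) g) = F.eval g := by
        rw [← F.U_momentsComp_id]; simp
      rw [e, zero_add, smul_eq_mul]
  have t2 : Tendsto (fun ε => ∫ g, |F.U (F.momentsComp (fun x => x + ε * φ x) g)| ∂Q) (𝓝[>] 0)
      (𝓝 (∫ g, |F.eval g| ∂Q)) := by
    refine tendsto_integral_filter_of_dominated_convergence (fun _ => C + |L|)
      (Eventually.of_forall fun ε => (hm ε).abs.aestronglyMeasurable) ?_ (integrable_const _)
      (Eventually.of_forall fun g => ?_)
    · filter_upwards [hsmall] with ε hε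
      exact Eventually.of_forall fun g => by simpa using habs ε hε.1 hε.2.1 g
    · have := (F.hasDerivAt_eval H g).continuousAt.tendsto
      have e : F.U (F.momentsComp (fun x => x + 0 * φ x) g) = F.eval g := by
        rw [← F.U_momentsComp_id]; simp
      rw [e] at this
      exact (this.mono_left nhdsWithin_le_nhds).abs
  refine le_of_tendsto_of_tendsto t1.abs (t2.const_mul _) ?_
  filter_upwards [hsmall] with ε ⟨h0, h1, h2, h3⟩
  have key := hQ.abs_integral_comp_sub_le hβ (H.isUnitDiffeo h0.le h2)
    (measurable_const.add (hφ'.const_mul ε)) h3 F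
  have i1 : Integrable (fun g => F.U (F.momentsComp (fun x => x + ε * φ x) g)) Q :=
    Integrable.of_bound (hm ε).aestronglyMeasurable (C + |L|)
      (Eventually.of_forall fun g => habs ε h0 h1 g)
  have i2 : Integrable F.eval Q :=
    Integrable.of_bound F.measurable_eval.aestronglyMeasurable C (Eventually.of_forall hC)
  rw [integral_const_mul, integral_sub i1 i2, abs_mul, abs_of_pos (inv_pos.2 h0),
    inv_mul_le_iff₀ h0]
  refine key.trans (le_of_eq ?_)
  ring

section L2

variable {Ω : Type*} [MeasurableSpace Ω] {μ : Measure Ω}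

lemma integral_sq_eq_eLpNorm {f : Ω → ℝ} (hf : MemLp f 2 μ) :
    ∫ x, f x ^ 2 ∂μ = (eLpNorm f 2 μ).toReal ^ 2 := by
  rw [hf.eLpNorm_eq_integral_rpow_norm (by simp) (by simp),
    ENNReal.toReal_ofReal (by positivity)]
  have e : (fun x => ‖f x‖ ^ (2 : ENNReal).toReal) = fun x => f x ^ 2 := by
    funext x; simp
  rw [e, ENNReal.toReal_ofNat, ← Real.rpow_natCast, ← Real.rpow_mul
    (integral_nonneg fun x => sq_nonneg _)]
  norm_num

lemma tendsto_integral_sq_zero {f : ℕ → Ω → ℝ} (hf : ∀ n, MemLp (f n) 2 μ)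
    (h : Tendsto (fun n => eLpNorm (f n) 2 μ) atTop (𝓝 0)) :
    Tendsto (fun n => ∫ x, f n x ^ 2 ∂μ) atTop (𝓝 0) := by
  simp only [fun n => integral_sq_eq_eLpNorm (hf n)]
  have := ((ENNReal.tendsto_toReal ENNReal.zero_ne_top).comp h).pow 2
  simpa using this

lemma tendsto_integral_mul_of_tendsto_eLpNorm [IsProbabilityMeasure μ] {f : ℕ → Ω → ℝ}
    {g b : Ω → ℝ} (hf : ∀ n, MemLp (f n) 2 μ) (hg : MemLp g 2 μ)
    (h : Tendsto (fun n => eLpNorm (fun x => f n x - g x) 2 μ) atTop (𝓝 0))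
    (hb : AEStronglyMeasurable b μ) {C : ℝ} (hC : ∀ x, |b x| ≤ C) :
    Tendsto (fun n => ∫ x, f n x * b x ∂μ) atTop (𝓝 (∫ x, g x * b x ∂μ)) := by
  refine tendsto_integral_of_L1' _ (hg.aestronglyMeasurable.mul hb)
    (Eventually.of_forall fun n => ((hf n).integrable one_le_two).mul_bdd (c := C) hb
      (Eventually.of_forall hC)) ?_
  have h0 : Tendsto (fun n => ENNReal.ofReal C * eLpNorm (fun x => f n x - g x) 2 μ) atTop
      (𝓝 0) := by
    have := ENNReal.Tendsto.const_mul h (Or.inr (ENNReal.ofReal_ne_top (r := C)))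
    rwa [mul_zero] at this
  refine tendsto_of_tendsto_of_tendsto_of_le_of_le tendsto_const_nhds h0 (fun _ => zero_le)
    fun n => ?_
  have hm : AEStronglyMeasurable (fun x => f n x - g x) μ := ((hf n).sub hg).aestronglyMeasurable
  refine (eLpNorm_le_mul_eLpNorm_of_ae_le_mul (c := C) (g := fun x => f n x - g x)
    (Eventually.of_forall fun x => ?_) 1).trans
    (mul_le_mul_right (eLpNorm_le_eLpNorm_of_exponent_le one_le_two hm) _)
  simp only [Pi.sub_apply, Pi.mul_apply]
  rw [← sub_mul, norm_mul, mul_comm]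
  exact mul_le_mul_of_nonneg_right (hC x) (norm_nonneg _)

lemma integral_mul_eq_zero_of_approx {f b : Ω → ℝ} (hf : Integrable f μ)
    (h : ∀ ε > 0, ∃ b' : Ω → ℝ, (∀ x, |b x - b' x| ≤ ε) ∧
      Integrable (fun x => f x * b' x) μ ∧ ∫ x, f x * b' x ∂μ = 0)
    (hfb : Integrable (fun x => f x * b x) μ) : ∫ x, f x * b x ∂μ = 0 := by
  have key : ∀ ε > 0, |∫ x, f x * b x ∂μ| ≤ ε * ∫ x, |f x| ∂μ := by
    intro ε hε
    obtain ⟨b', hb, hi, h0⟩ := h ε hε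
    calc |∫ x, f x * b x ∂μ| = |∫ x, (f x * b x - f x * b' x) ∂μ| := by
          rw [integral_sub hfb hi, h0, sub_zero]
      _ ≤ ∫ x, |f x * b x - f x * b' x| ∂μ := abs_integral_le_integral_abs
      _ ≤ ∫ x, ε * |f x| ∂μ := integral_mono (hfb.sub hi).abs (hf.abs.const_mul ε) fun x => by
          simp only
          rw [← mul_sub, abs_mul, mul_comm]
          exact mul_le_mul_of_nonneg_right (hb x) (abs_nonneg _)
      _ = _ := integral_const_mul _ _
  have hA : 0 ≤ ∫ x, |f x| ∂μ := integral_nonneg fun x => abs_nonneg _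
  by_contra hne
  have hp : 0 < |∫ x, f x * b x ∂μ| := abs_pos.2 hne
  have := key (|∫ x, f x * b x ∂μ| / (2 * ((∫ x, |f x| ∂μ) + 1))) (by positivity)
  rw [div_mul_eq_mul_div, le_div_iff₀ (by positivity)] at this
  nlinarith

end L2

namespace CylZ

/-- Linear combinations of two cylinder functions. -/
def lin (a b : ℝ) (F G : CylZ) : CylZ :=
  comp (fun x : Fin 2 → ℝ => a * x 0 + b * x 1)
    ((contDiff_const.mul (contDiff_apply ℝ ℝ 0)).add (contDiff_const.mul (contDiff_apply ℝ ℝ 1)))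
    ![F, G]

lemma lin_eval (a b : ℝ) (F G : CylZ) (g : GZero) :
    (lin a b F G).eval g = a * F.eval g + b * G.eval g := by
  simp [lin, comp_eval]

lemma lin_grad (a b : ℝ) (F G : CylZ) (p : GZero × ℝ) :
    (lin a b F G).grad p = a * F.grad p + b * G.grad p := by
  rw [lin, comp_grad]
  have : ∀ x : Fin 2 → ℝ, HasFDerivAt (fun x : Fin 2 → ℝ => a * x 0 + b * x 1)
      (a • (ContinuousLinearMap.proj 0 : (Fin 2 → ℝ) →L[ℝ] ℝ) +
        b • (ContinuousLinearMap.proj 1 : (Fin 2 → ℝ) →L[ℝ] ℝ)) x := fun x =>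
    ((hasFDerivAt_apply 0 x).const_mul a).add ((hasFDerivAt_apply 1 x).const_mul b)
  rw [(this _).fderiv]
  simp

/-- Products of two cylinder functions. -/
def mul (F G : CylZ) : CylZ :=
  comp (fun x : Fin 2 → ℝ => x 0 * x 1)
    ((contDiff_apply ℝ ℝ 0).mul (contDiff_apply ℝ ℝ 1)) ![F, G]

lemma mul_eval (F G : CylZ) (g : GZero) : (mul F G).eval g = F.eval g * G.eval g := by
  simp [mul, comp_eval]

lemma mul_grad (F G : CylZ) (p : GZero × ℝ) :
    (mul F G).grad p = G.eval p.1 * F.grad p + F.eval p.1 * G.grad p := by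
  rw [mul, comp_grad]
  have : ∀ x : Fin 2 → ℝ, HasFDerivAt (fun x : Fin 2 → ℝ => x 0 * x 1)
      (x 0 • (ContinuousLinearMap.proj 1 : (Fin 2 → ℝ) →L[ℝ] ℝ) +
        x 1 • (ContinuousLinearMap.proj 0 : (Fin 2 → ℝ) →L[ℝ] ℝ)) x := fun x =>
    (hasFDerivAt_apply 0 x).mul (hasFDerivAt_apply 1 x)
  rw [(this _).fderiv]
  simp

lemma memLp_eval (F : CylZ) (Q : Measure GZero) [IsFiniteMeasure Q] : MemLp F.eval 2 Q := by
  obtain ⟨C, -, hC⟩ := F.exists_bound_eval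
  exact MemLp.of_bound F.measurable_eval.aestronglyMeasurable C (Eventually.of_forall hC)

lemma memLp_grad (F : CylZ) (Q : Measure GZero) [IsFiniteMeasure Q] :
    MemLp F.grad 2 (Q.prod unitLeb) := by
  obtain ⟨C, -, hC⟩ := F.exists_bound_grad
  exact MemLp.of_bound F.measurable_grad.aestronglyMeasurable C (Eventually.of_forall hC)

lemma exists_eval_near (F : CylZ) {W : (Fin F.m → ℝ) → ℝ} (hW : Continuous W) {ε : ℝ}
    (hε : 0 < ε) : ∃ G : CylZ, ∀ g, |W (F.moments g) - G.eval g| ≤ ε := by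
  obtain ⟨U, hU, hUW, -⟩ := hW.exists_contDiff_approx 1 (ε := fun _ => ε) continuous_const
    fun _ => hε
  refine ⟨⟨F.m, U, F.α, hU, F.contDiffOn_α⟩, fun g => ?_⟩
  have := (hUW (F.moments g)).le
  rw [Real.dist_eq, abs_sub_comm] at this
  exact this

end CylZ

lemma Polynomial.exists_isUnitField {q : Polynomial ℝ} (h0 : q.eval 0 = 0) (h1 : q.eval 1 = 0) :
    ∃ K, IsUnitField (fun x => q.eval x) (fun x => q.derivative.eval x) K := by
  have hb : ∀ p : Polynomial ℝ, ∃ C, ∀ x ∈ Set.Icc (0 : ℝ) 1, |p.eval x| ≤ C := fun p =>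
    isCompact_Icc.exists_bound_of_continuousOn p.continuous.continuousOn
  obtain ⟨A, hA⟩ := hb q
  obtain ⟨B, hB⟩ := hb q.derivative
  obtain ⟨C, hC⟩ := hb q.derivative.derivative
  refine ⟨|A| + |B| + |C|, h0, h1, fun x => q.hasDerivAt x, by positivity, fun x hx => ?_,
    fun x hx => ?_, fun x hx y hy => ?_⟩
  · linarith [hA x hx, le_abs_self A, abs_nonneg B, abs_nonneg C]
  · linarith [hB x hx, le_abs_self B, abs_nonneg A, abs_nonneg C]
  · refine Convex.norm_image_sub_le_of_norm_hasDerivWithin_le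
      (fun z _ => (q.derivative.hasDerivAt z).hasDerivWithinAt) (fun z hz => ?_)
      (convex_Icc 0 1) hy hx
    rw [Real.norm_eq_abs]
    linarith [hC z hz, le_abs_self C, abs_nonneg A, abs_nonneg B]

namespace IsDirichletProcess

variable {β : ℝ} {Q : Measure GZero}

lemma ae_evals_mem (hQ : IsDirichletProcess β Q) {N : ℕ} {t : Fin N → ℝ}
    (ht : t ∈ orderedSimplex N) : ∀ᵐ g ∂Q, (fun i => g.val (t i)) ∈ orderedSimplex N := by
  have h : ∀ᵐ x ∂(Q.map fun g i => g.val (t i)), x ∈ orderedSimplex N := by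
    rw [hQ.map_eval N t ht]
    exact (withDensity_absolutelyContinuous _ _).ae_le
      (ae_restrict_mem (isOpen_orderedSimplex N).measurableSet)
  exact ae_of_ae_map (measurable_evals t).aemeasurable h

lemma pair_mem_orderedSimplex {p q : ℝ} :
    ![p, q] ∈ orderedSimplex 2 ↔ 0 < p ∧ p < q ∧ q < 1 := by
  have e1 : withEnds ![p, q] 1 = p := withEnds_castSucc_succ ![p, q] 0
  have e2 : withEnds ![p, q] 2 = q := withEnds_castSucc_succ ![p, q] 1
  have e3 : withEnds ![p, q] 3 = 1 := withEnds_last ![p, q]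
  have e0 : withEnds ![p, q] 0 = 0 := withEnds_zero ![p, q]
  change StrictMono (withEnds ![p, q]) ↔ _
  rw [Fin.strictMono_iff_lt_succ, Fin.forall_fin_succ, Fin.forall_fin_two]
  simp [e0, e1, e2, e3]

/-- Almost every path is strictly increasing with values in the open unit interval. -/
lemma ae_strictMonoOn (hQ : IsDirichletProcess β Q) :
    ∀ᵐ g ∂Q, StrictMonoOn g.val (Set.Ioo 0 1) ∧
      ∀ t ∈ Set.Ioo (0 : ℝ) 1, g.val t ∈ Set.Ioo (0 : ℝ) 1 := by
  have h : ∀ᵐ g ∂Q, ∀ p q : ℚ, (0 : ℝ) < p → (p : ℝ) < q → (q : ℝ) < 1 →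
      0 < g.val p ∧ g.val p < g.val q ∧ g.val q < 1 := by
    rw [ae_all_iff]; intro p
    rw [ae_all_iff]; intro q
    by_cases hpq : (0 : ℝ) < p ∧ (p : ℝ) < q ∧ (q : ℝ) < 1
    · filter_upwards [hQ.ae_evals_mem (pair_mem_orderedSimplex.2 hpq)] with g hg _ _ _
      have e : (fun i => g.val (![(p : ℝ), (q : ℝ)] i)) = ![g.val p, g.val q] := by
        funext i; fin_cases i <;> rfl
      rw [e] at hg
      exact pair_mem_orderedSimplex.1 hg
    · exact Eventually.of_forall fun g h1 h2 h3 => absurd ⟨h1, h2, h3⟩ hpq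
  filter_upwards [h] with g hg
  constructor
  · intro s hs t ht hst
    obtain ⟨p, hp1, hp2⟩ := exists_rat_btwn hst
    obtain ⟨q, hq1, hq2⟩ := exists_rat_btwn hp2
    have := (hg p q (hs.1.trans hp1) hq1 (hq2.trans ht.2)).2.1
    exact (g.val_mono hp1.le).trans_lt (this.trans_le (g.val_mono hq2.le))
  · intro t ht
    obtain ⟨p, hp1, hp2⟩ := exists_rat_btwn ht.1
    obtain ⟨q, hq1, hq2⟩ := exists_rat_btwn ht.2
    have := hg p q hp1 (hp2.trans hq1) hq2
    exact ⟨this.1.trans_le (g.val_mono hp2.le), (g.val_mono hq1.le).trans_lt this.2.2⟩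

lemma ae_unitLeb_mem_Ioo : ∀ᵐ t ∂unitLeb, t ∈ Set.Ioo (0 : ℝ) 1 := by
  rw [unitLeb, ← restrict_Ioo_eq_restrict_Icc]
  exact ae_restrict_mem measurableSet_Ioo

lemma ae_prod_val_mem_Ioo (hQ : IsDirichletProcess β Q) :
    ∀ᵐ p ∂(Q.prod unitLeb), p.1.val p.2 ∈ Set.Ioo (0 : ℝ) 1 := by
  rw [Measure.ae_prod_iff_ae_ae (GZero.measurable_uncurry_val measurableSet_Ioo)]
  filter_upwards [hQ.ae_strictMonoOn] with g hg
  filter_upwards [ae_unitLeb_mem_Ioo] with t ht using hg.2 t ht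

/-- A limit of gradients of cylinder functions tending to zero is orthogonal to `w · φ(g)`, for
all cylinder functions `w` and all vector fields `φ`. -/
lemma integral_mul_field_eq_zero (hQ : IsDirichletProcess β Q) (hβ : 0 < β) {F : ℕ → CylZ}
    {V : GZero × ℝ → ℝ} (hV : MemLp V 2 (Q.prod unitLeb))
    (h0 : Tendsto (fun n => eLpNorm (F n).eval 2 Q) atTop (𝓝 0))
    (h1 : Tendsto (fun n => eLpNorm (fun p => (F n).grad p - V p) 2 (Q.prod unitLeb)) atTop (𝓝 0))
    (G : CylZ) {φ φ' : ℝ → ℝ} {K : ℝ} (H : IsUnitField φ φ' K) (hφ' : Measurable φ') :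
    ∫ p, V p * (G.eval p.1 * φ (p.1.val p.2)) ∂(Q.prod unitLeb) = 0 := by
  have := hQ.isProbabilityMeasure
  obtain ⟨A, hA0, hA⟩ := G.exists_bound_eval
  obtain ⟨B, hB0, hB⟩ := G.exists_bound_grad
  have hK := H.nonneg
  have hφm : Measurable fun p : GZero × ℝ => φ (p.1.val p.2) :=
    H.continuous.measurable.comp GZero.measurable_uncurry_val
  have hφb : ∀ p : GZero × ℝ, |φ (p.1.val p.2)| ≤ K := fun p => H.apply_le _ (p.1.val_mem _)
  have hbm : Measurable fun p : GZero × ℝ => G.eval p.1 * φ (p.1.val p.2) :=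
    (G.measurable_eval.comp measurable_fst).mul hφm
  have hbb : ∀ p : GZero × ℝ, |G.eval p.1 * φ (p.1.val p.2)| ≤ A * K := fun p => by
    rw [abs_mul]
    exact mul_le_mul (hA _) (hφb p) (abs_nonneg _) hA0
  have t1 := tendsto_integral_mul_of_tendsto_eLpNorm (fun n => (F n).memLp_grad Q) hV h1
    hbm.aestronglyMeasurable hbb
  have t0 : Tendsto (fun n => ∫ g, |(F n).eval g| ∂Q) atTop (𝓝 0) := by
    have h0' : Tendsto (fun n => eLpNorm (fun g => |(F n).eval g| - (fun _ => (0 : ℝ)) g) 2 Q)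
        atTop (𝓝 0) := by
      refine h0.congr fun n => ?_
      simp only [sub_zero]
      exact (eLpNorm_norm (F n).eval).symm
    have := tendsto_integral_mul_of_tendsto_eLpNorm (b := fun _ => 1) (C := 1)
      (fun n => ((F n).memLp_eval Q).abs) (MemLp.zero' (μ := Q)) h0' aestronglyMeasurable_const
      (fun _ => by simp)
    simpa using this
  have hbound : ∀ n, |∫ p, (F n).grad p * (G.eval p.1 * φ (p.1.val p.2)) ∂(Q.prod unitLeb)| ≤
      (4 * (β + 2) * K * A + B * K) * ∫ g, |(F n).eval g| ∂Q := by
    intro n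
    have iF : Integrable (fun g => |(F n).eval g|) Q :=
      (((F n).memLp_eval Q).integrable one_le_two).abs
    have i1 : Integrable (fun p : GZero × ℝ => ((F n).mul G).grad p * φ (p.1.val p.2))
        (Q.prod unitLeb) :=
      ((((F n).mul G).memLp_grad Q).integrable one_le_two).mul_bdd (c := K)
        hφm.aestronglyMeasurable (Eventually.of_forall hφb)
    have iF' : Integrable (fun p : GZero × ℝ => |(F n).eval p.1|) (Q.prod unitLeb) :=
      iF.comp_fst unitLeb
    have hm2 : Measurable fun p : GZero × ℝ => G.grad p * φ (p.1.val p.2) :=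
      G.measurable_grad.mul hφm
    have hb2 : ∀ p : GZero × ℝ, |G.grad p * φ (p.1.val p.2)| ≤ B * K := fun p => by
      rw [abs_mul]
      exact mul_le_mul (hB _) (hφb p) (abs_nonneg _) hB0
    have i2 : Integrable (fun p : GZero × ℝ => (F n).eval p.1 * (G.grad p * φ (p.1.val p.2)))
        (Q.prod unitLeb) :=
      ((((F n).memLp_eval Q).integrable one_le_two).comp_fst unitLeb).mul_bdd (c := B * K)
        hm2.aestronglyMeasurable (Eventually.of_forall hb2)
    have e : ∫ p, (F n).grad p * (G.eval p.1 * φ (p.1.val p.2)) ∂(Q.prod unitLeb) =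
        ∫ g, ((F n).mul G).gradDir φ g ∂Q -
          ∫ p, (F n).eval p.1 * (G.grad p * φ (p.1.val p.2)) ∂(Q.prod unitLeb) := by
      have : ∫ g, ((F n).mul G).gradDir φ g ∂Q =
          ∫ p, ((F n).mul G).grad p * φ (p.1.val p.2) ∂(Q.prod unitLeb) :=
        (integral_prod _ i1).symm
      rw [this, ← integral_sub i1 i2]
      refine integral_congr_ae (Eventually.of_forall fun p => ?_)
      simp only [CylZ.mul_grad]
      ring
    have b1 : |∫ g, ((F n).mul G).gradDir φ g ∂Q| ≤
        4 * (β + 2) * K * (A * ∫ g, |(F n).eval g| ∂Q) := by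
      refine (hQ.abs_integral_gradDir_le hβ H hφ' _).trans
        (mul_le_mul_of_nonneg_left ?_ (by positivity))
      rw [← integral_const_mul]
      refine integral_mono ((((F n).mul G).memLp_eval Q).integrable one_le_two).abs
        (iF.const_mul A) fun g => ?_
      simp only [CylZ.mul_eval, abs_mul]
      rw [mul_comm]
      exact mul_le_mul_of_nonneg_right (hA g) (abs_nonneg _)
    have b2 : |∫ p, (F n).eval p.1 * (G.grad p * φ (p.1.val p.2)) ∂(Q.prod unitLeb)| ≤
        B * K * ∫ g, |(F n).eval g| ∂Q := by
      have : ∫ g, |(F n).eval g| ∂Q = ∫ p, |(F n).eval p.1| ∂(Q.prod unitLeb) := by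
        rw [integral_prod _ iF']
        simp
      rw [this, ← integral_const_mul]
      refine abs_integral_le_integral_abs.trans (integral_mono i2.abs (iF'.const_mul _) fun p => ?_)
      simp only
      rw [abs_mul, mul_comm]
      exact mul_le_mul_of_nonneg_right (hb2 p) (abs_nonneg _)
    rw [e]
    refine (abs_sub _ _).trans ?_
    linarith
  have t2 : Tendsto (fun n => ∫ p, (F n).grad p * (G.eval p.1 * φ (p.1.val p.2))
      ∂(Q.prod unitLeb)) atTop (𝓝 0) := by
    refine squeeze_zero_norm hbound ?_
    have := t0.const_mul (4 * (β + 2) * K * A + B * K)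
    rwa [mul_zero] at this
  exact tendsto_nhds_unique t1 t2

/-- The weight `x (1 - x)`. -/
def weight (x : ℝ) : ℝ := x * (1 - x)

lemma continuous_weight : Continuous weight := continuous_id.mul (continuous_const.sub continuous_id)

lemma weight_nonneg {x : ℝ} (hx : x ∈ Set.Icc (0 : ℝ) 1) : 0 ≤ weight x :=
  mul_nonneg hx.1 (by linarith [hx.2])

lemma weight_le_one {x : ℝ} (hx : x ∈ Set.Icc (0 : ℝ) 1) : weight x ≤ 1 := by
  unfold weight; nlinarith [hx.1, hx.2]

lemma abs_weight_le_one {x : ℝ} (hx : x ∈ Set.Icc (0 : ℝ) 1) : |weight x| ≤ 1 := by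
  rw [abs_of_nonneg (weight_nonneg hx)]; exact weight_le_one hx

lemma measurable_weight_val : Measurable fun p : GZero × ℝ => weight (p.1.val p.2) :=
  continuous_weight.measurable.comp GZero.measurable_uncurry_val

/-- Weighted version of the orthogonality for all gradients of cylinder functions. -/
lemma integral_mul_weight_grad_eq_zero (hQ : IsDirichletProcess β Q) (hβ : 0 < β) {F : ℕ → CylZ}
    {V : GZero × ℝ → ℝ} (hV : MemLp V 2 (Q.prod unitLeb))
    (h0 : Tendsto (fun n => eLpNorm (F n).eval 2 Q) atTop (𝓝 0))
    (h1 : Tendsto (fun n => eLpNorm (fun p => (F n).grad p - V p) 2 (Q.prod unitLeb)) atTop (𝓝 0))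
    (G : CylZ) :
    ∫ p, V p * (weight (p.1.val p.2) * G.grad p) ∂(Q.prod unitLeb) = 0 := by
  have := hQ.isProbabilityMeasure
  have hVi : Integrable V (Q.prod unitLeb) := hV.integrable one_le_two
  obtain ⟨D, hD0, hD⟩ := G.exists_bound_dα
  have hψm : ∀ i, Measurable fun p : GZero × ℝ => G.dα i (p.1.val p.2) := fun i =>
    (G.continuous_dα i).measurable.comp GZero.measurable_uncurry_val
  have hi : ∀ (b : GZero × ℝ → ℝ), Measurable b → (∃ C, ∀ p, |b p| ≤ C) →
      Integrable (fun p => V p * b p) (Q.prod unitLeb) := fun b hb ⟨C, hC⟩ =>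
    hVi.mul_bdd (c := C) hb.aestronglyMeasurable (Eventually.of_forall hC)
  have hη : ∀ p : GZero × ℝ, |weight (p.1.val p.2)| ≤ 1 := fun p =>
    abs_weight_le_one (p.1.val_mem _)
  -- polynomial coefficients
  have s1 : ∀ (w : CylZ) (i : Fin G.m),
      ∫ p, V p * (weight (p.1.val p.2) * (w.eval p.1 * G.dα i (p.1.val p.2)))
        ∂(Q.prod unitLeb) = 0 := by
    intro w i
    obtain ⟨A, hA0, hA⟩ := w.exists_bound_eval
    have hwm : Measurable fun p : GZero × ℝ => w.eval p.1 := w.measurable_eval.comp measurable_fst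
    refine integral_mul_eq_zero_of_approx hVi (fun ε hε => ?_)
      (hi _ (measurable_weight_val.mul (hwm.mul (hψm i))) ⟨1 * (A * D), fun p => by
        rw [abs_mul, abs_mul]
        exact mul_le_mul (hη p) (mul_le_mul (hA _) (hD i _) (abs_nonneg _) hA0)
          (by positivity) zero_le_one⟩)
    obtain ⟨q, hq⟩ := exists_polynomial_near_of_continuousOn 0 1 (G.dα i)
      (G.continuous_dα i).continuousOn (ε / (A + 1)) (by positivity)
    obtain ⟨K, H⟩ := Polynomial.exists_isUnitField
      (q := Polynomial.X * (1 - Polynomial.X) * q) (by simp) (by simp)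
    have e : ∀ x, (Polynomial.X * (1 - Polynomial.X) * q).eval x = weight x * q.eval x := by
      intro x; simp [weight]
    have hz := hQ.integral_mul_field_eq_zero hβ hV h0 h1 w H
      (Polynomial.continuous _).measurable
    refine ⟨fun p => w.eval p.1 * (Polynomial.X * (1 - Polynomial.X) * q).eval (p.1.val p.2),
      fun p => ?_, ?_, hz⟩
    · have hx := p.1.val_mem p.2
      simp only
      rw [e, show weight (p.1.val p.2) * (w.eval p.1 * G.dα i (p.1.val p.2)) -
        w.eval p.1 * (weight (p.1.val p.2) * q.eval (p.1.val p.2)) =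
        -(weight (p.1.val p.2) * (w.eval p.1 * (q.eval (p.1.val p.2) - G.dα i (p.1.val p.2))))
        by ring, abs_neg, abs_mul, abs_mul]
      calc _ ≤ 1 * (A * (ε / (A + 1))) :=
            mul_le_mul (hη p) (mul_le_mul (hA _) (hq _ hx).le (abs_nonneg _) hA0)
              (by positivity) zero_le_one
        _ ≤ ε := by
            rw [one_mul, mul_div_assoc', div_le_iff₀ (by positivity)]
            nlinarith
    · refine hi _ (hwm.mul ((Polynomial.continuous _).measurable.comp
        GZero.measurable_uncurry_val)) ⟨A * K, fun p => ?_⟩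
      rw [abs_mul]
      exact mul_le_mul (hA _) (H.apply_le _ (p.1.val_mem _)) (abs_nonneg _) hA0
  -- general continuous coefficients
  have s2 : ∀ (W : (Fin G.m → ℝ) → ℝ) (_ : Continuous W) (i : Fin G.m),
      Integrable (fun p : GZero × ℝ => V p * (weight (p.1.val p.2) *
        (W (G.moments p.1) * G.dα i (p.1.val p.2)))) (Q.prod unitLeb) ∧
      ∫ p, V p * (weight (p.1.val p.2) * (W (G.moments p.1) * G.dα i (p.1.val p.2)))
        ∂(Q.prod unitLeb) = 0 := by
    intro W hW i
    obtain ⟨A, hA0, hA⟩ := G.exists_bound_comp_moments hW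
    have hWm : Measurable fun p : GZero × ℝ => W (G.moments p.1) :=
      hW.measurable.comp (G.measurable_moments.comp measurable_fst)
    have hint : Integrable (fun p : GZero × ℝ => V p * (weight (p.1.val p.2) *
        (W (G.moments p.1) * G.dα i (p.1.val p.2)))) (Q.prod unitLeb) :=
      hi _ (measurable_weight_val.mul (hWm.mul (hψm i))) ⟨1 * (A * D), fun p => by
        rw [abs_mul, abs_mul]
        exact mul_le_mul (hη p) (mul_le_mul (hA _) (hD i _) (abs_nonneg _) hA0)
          (by positivity) zero_le_one⟩
    refine ⟨hint, integral_mul_eq_zero_of_approx hVi (fun ε hε => ?_) hint⟩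
    obtain ⟨w, hw⟩ := G.exists_eval_near hW (ε := ε / (D + 1)) (by positivity)
    obtain ⟨A', hA'0, hA'⟩ := w.exists_bound_eval
    have hwm : Measurable fun p : GZero × ℝ => w.eval p.1 := w.measurable_eval.comp measurable_fst
    refine ⟨fun p => weight (p.1.val p.2) * (w.eval p.1 * G.dα i (p.1.val p.2)), fun p => ?_,
      hi _ (measurable_weight_val.mul (hwm.mul (hψm i)))
      ⟨1 * (A' * D), fun p => by
        rw [abs_mul, abs_mul]
        exact mul_le_mul (hη p) (mul_le_mul (hA' _) (hD i _) (abs_nonneg _) hA'0)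
          (by positivity) zero_le_one⟩, s1 w i⟩
    rw [← mul_sub, ← sub_mul, abs_mul, abs_mul]
    calc _ ≤ 1 * (ε / (D + 1) * D) :=
          mul_le_mul (hη p) (mul_le_mul (hw _) (hD i _) (abs_nonneg _) (by positivity))
            (by positivity) zero_le_one
      _ ≤ ε := by
          rw [one_mul, div_mul_eq_mul_div, div_le_iff₀ (by positivity)]
          nlinarith
  have hsum : ∀ p : GZero × ℝ, V p * (weight (p.1.val p.2) * G.grad p) =
      ∑ i, V p * (weight (p.1.val p.2) *
        (fderiv ℝ G.U (G.moments p.1) (Pi.single i 1) * G.dα i (p.1.val p.2))) := by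
    rintro ⟨g, t⟩
    rw [G.grad_eq, Finset.mul_sum, Finset.mul_sum]
  have hc : ∀ i, Continuous fun x => fderiv ℝ G.U x (Pi.single i 1) := fun i =>
    (G.contDiff_U.continuous_fderiv one_ne_zero).clm_apply continuous_const
  simp only [hsum]
  rw [integral_finsetSum _ fun i _ => (s2 _ (hc i) i).1]
  exact Finset.sum_eq_zero fun i _ => (s2 _ (hc i) i).2

/-- The gradient on cylinder functions is closable. -/
lemma closable (hQ : IsDirichletProcess β Q) (hβ : 0 < β) {F : ℕ → CylZ}
    {V : GZero × ℝ → ℝ} (hV : MemLp V 2 (Q.prod unitLeb))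
    (h0 : Tendsto (fun n => eLpNorm (F n).eval 2 Q) atTop (𝓝 0))
    (h1 : Tendsto (fun n => eLpNorm (fun p => (F n).grad p - V p) 2 (Q.prod unitLeb)) atTop
      (𝓝 0)) : V =ᵐ[Q.prod unitLeb] 0 := by
  have := hQ.isProbabilityMeasure
  have hd : ∀ n, MemLp (fun p => (F n).grad p - V p) 2 (Q.prod unitLeb) := fun n =>
    ((F n).memLp_grad Q).sub hV
  have hsq := tendsto_integral_sq_zero hd h1
  have hη0 : ∀ p : GZero × ℝ, 0 ≤ weight (p.1.val p.2) := fun p => weight_nonneg (p.1.val_mem _)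
  have hη1 : ∀ p : GZero × ℝ, |weight (p.1.val p.2)| ≤ 1 := fun p =>
    abs_weight_le_one (p.1.val_mem _)
  have hηm := measurable_weight_val.aestronglyMeasurable (μ := Q.prod unitLeb)
  have hwi : ∀ f : GZero × ℝ → ℝ, Integrable f (Q.prod unitLeb) →
      Integrable (fun p => f p * weight (p.1.val p.2)) (Q.prod unitLeb) := fun f hf =>
    hf.mul_bdd (c := 1) hηm (Eventually.of_forall hη1)
  have hVV := hwi _ hV.integrable_sq
  have hle : ∀ n, ∫ p, V p ^ 2 * weight (p.1.val p.2) ∂(Q.prod unitLeb) ≤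
      ∫ p, ((F n).grad p - V p) ^ 2 ∂(Q.prod unitLeb) := by
    intro n
    have hz := hQ.integral_mul_weight_grad_eq_zero hβ hV h0 h1 (F n)
    have i1 := hwi _ ((F n).memLp_grad Q).integrable_sq
    have i2 : Integrable (fun p => V p * (weight (p.1.val p.2) * (F n).grad p))
        (Q.prod unitLeb) := by
      refine (hwi _ (hV.integrable_mul ((F n).memLp_grad Q))).congr
        (Eventually.of_forall fun p => ?_)
      simp only [Pi.mul_apply]
      ring
    calc ∫ p, V p ^ 2 * weight (p.1.val p.2) ∂(Q.prod unitLeb)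
        ≤ ∫ p, (F n).grad p ^ 2 * weight (p.1.val p.2) ∂(Q.prod unitLeb) +
          ∫ p, V p ^ 2 * weight (p.1.val p.2) ∂(Q.prod unitLeb) := by
          have : 0 ≤ ∫ p, (F n).grad p ^ 2 * weight (p.1.val p.2) ∂(Q.prod unitLeb) :=
            integral_nonneg fun p => mul_nonneg (sq_nonneg _) (hη0 p)
          linarith
      _ = ∫ p, ((F n).grad p - V p) ^ 2 * weight (p.1.val p.2) ∂(Q.prod unitLeb) := by
          rw [← integral_add i1 hVV]
          have e : ∀ p, ((F n).grad p - V p) ^ 2 * weight (p.1.val p.2) =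
              ((F n).grad p ^ 2 * weight (p.1.val p.2) + V p ^ 2 * weight (p.1.val p.2)) -
                2 * (V p * (weight (p.1.val p.2) * (F n).grad p)) := fun p => by ring
          simp only [e]
          have := integral_sub (i1.add hVV) (i2.const_mul 2)
          simp only [Pi.add_apply] at this
          rw [this, integral_const_mul, hz, mul_zero, sub_zero]
      _ ≤ _ := by
          refine integral_mono (hwi _ (hd n).integrable_sq) (hd n).integrable_sq fun p => ?_
          exact mul_le_of_le_one_right (sq_nonneg _) ((le_abs_self _).trans (hη1 p))
  have h2 : ∫ p, V p ^ 2 * weight (p.1.val p.2) ∂(Q.prod unitLeb) = 0 :=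
    le_antisymm (ge_of_tendsto' hsq hle)
      (integral_nonneg fun p => mul_nonneg (sq_nonneg _) (hη0 p))
  have h3 := (integral_eq_zero_iff_of_nonneg (fun p => mul_nonneg (sq_nonneg _) (hη0 p)) hVV).1 h2
  filter_upwards [h3, hQ.ae_prod_val_mem_Ioo] with p hp hpI
  have hpos : 0 < weight (p.1.val p.2) := mul_pos hpI.1 (by linarith [hpI.2])
  have : V p ^ 2 = 0 := (mul_eq_zero.1 hp).resolve_right hpos.ne'
  exact pow_eq_zero_iff two_ne_zero |>.1 this

end IsDirichletProcess

/-- Almost everywhere uniqueness of the closed gradient. -/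
lemma IsClosedGradient.ae_eq {β : ℝ} {Q : Measure GZero} (hQ : IsDirichletProcess β Q)
    (hβ : 0 < β) {u : GZero → ℝ} {V W : GZero × ℝ → ℝ} (hV : IsClosedGradient Q u V)
    (hW : IsClosedGradient Q u W) : W =ᵐ[Q.prod unitLeb] V := by
  have := hQ.isProbabilityMeasure
  obtain ⟨hu, hV2, F, hF0, hF1⟩ := hV
  obtain ⟨-, hW2, G, hG0, hG1⟩ := hW
  have key := hQ.closable hβ (F := fun n => CylZ.lin 1 (-1) (G n) (F n)) (hW2.sub hV2) ?_ ?_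
  · filter_upwards [key] with p hp
    have : W p - V p = 0 := hp
    linarith
  · have h := hG0.add hF0
    rw [add_zero] at h
    refine tendsto_of_tendsto_of_tendsto_of_le_of_le tendsto_const_nhds h (fun _ => zero_le)
      fun n => ?_
    have e : (CylZ.lin 1 (-1) (G n) (F n)).eval =
        (fun g => (G n).eval g - u g) - fun g => (F n).eval g - u g := by
      funext g
      simp only [CylZ.lin_eval, Pi.sub_apply]
      ring
    simp only [e]
    exact eLpNorm_sub_le (((G n).memLp_eval Q).sub hu).aestronglyMeasurable
      (((F n).memLp_eval Q).sub hu).aestronglyMeasurable one_le_two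
  · have h := hG1.add hF1
    rw [add_zero] at h
    refine tendsto_of_tendsto_of_tendsto_of_le_of_le tendsto_const_nhds h (fun _ => zero_le)
      fun n => ?_
    have e : (fun p => (CylZ.lin 1 (-1) (G n) (F n)).grad p - (W - V) p) =
        (fun p => (G n).grad p - W p) - fun p => (F n).grad p - V p := by
      funext p
      simp only [CylZ.lin_grad, Pi.sub_apply]
      ring
    rw [e]
    exact eLpNorm_sub_le (((G n).memLp_grad Q).sub hW2).aestronglyMeasurable
      (((F n).memLp_grad Q).sub hV2).aestronglyMeasurable one_le_two

/-- The positive part. -/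
def ramp (y : ℝ) : ℝ := max 0 y

/-- The hat function on `[-1,1]`. -/
def hat (y : ℝ) : ℝ := (ramp (y + 1) - ramp y) - (ramp y - ramp (y - 1))

/-- The primitive of the positive part. -/
def rampInt (y : ℝ) : ℝ := ∫ s in (0 : ℝ)..y, ramp s

/-- The primitive of the hat function, a smoothed Heaviside function. -/
def softStep (y : ℝ) : ℝ := rampInt (y + 1) - 2 * rampInt y + rampInt (y - 1)

lemma continuous_ramp : Continuous ramp := continuous_const.max continuous_id

lemma ramp_of_nonneg {y : ℝ} (hy : 0 ≤ y) : ramp y = y := max_eq_right hy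

lemma ramp_of_nonpos {y : ℝ} (hy : y ≤ 0) : ramp y = 0 := max_eq_left hy

lemma continuous_hat : Continuous hat := by
  unfold hat
  have := continuous_ramp
  fun_prop

lemma hat_nonneg (y : ℝ) : 0 ≤ hat y := by
  unfold hat ramp
  rcases le_total 0 y with h | h <;> rcases le_total 0 (y + 1) with h1 | h1 <;>
    rcases le_total 0 (y - 1) with h2 | h2 <;> simp [h, h1, h2] <;> linarith

lemma hat_eq_zero {y : ℝ} (hy : 1 ≤ |y|) : hat y = 0 := by
  unfold hat
  rcases le_abs.1 hy with h | h
  · rw [ramp_of_nonneg (by linarith), ramp_of_nonneg (by linarith), ramp_of_nonneg (by linarith)]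
    ring
  · rw [ramp_of_nonpos (by linarith), ramp_of_nonpos (by linarith), ramp_of_nonpos (by linarith)]
    ring

lemma sum_hat {n : ℕ} {z : ℝ} (h0 : 0 ≤ z) (hn : z ≤ n) :
    ∑ j ∈ Finset.range (n + 1), hat (j - z) = 1 := by
  have e : ∀ j : ℕ, hat (j - z) = (ramp (((j + 1 : ℕ) : ℝ) - z) - ramp (((j + 1 : ℕ) : ℝ) - 1 - z))
      - (ramp ((j : ℝ) - z) - ramp ((j : ℝ) - 1 - z)) := by
    intro j
    unfold hat
    push_cast
    ring_nf
  simp only [e]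
  rw [Finset.sum_range_sub (fun j : ℕ => ramp ((j : ℝ) - z) - ramp ((j : ℝ) - 1 - z))]
  push_cast
  rw [ramp_of_nonneg (by linarith), ramp_of_nonneg (by linarith), ramp_of_nonpos (by linarith),
    ramp_of_nonpos (by linarith)]
  ring

lemma rampInt_of_nonneg {y : ℝ} (hy : 0 ≤ y) : rampInt y = y ^ 2 / 2 := by
  unfold rampInt
  rw [intervalIntegral.integral_congr (g := fun s => s), integral_id]
  · ring
  · intro s hs
    rw [Set.uIcc_of_le hy] at hs
    exact ramp_of_nonneg hs.1

lemma rampInt_of_nonpos {y : ℝ} (hy : y ≤ 0) : rampInt y = 0 := by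
  unfold rampInt
  rw [intervalIntegral.integral_congr (g := fun _ => 0), intervalIntegral.integral_zero]
  intro s hs
  rw [Set.uIcc_of_ge hy] at hs
  exact ramp_of_nonpos hs.2

lemma hasDerivAt_rampInt (y : ℝ) : HasDerivAt rampInt (ramp y) y :=
  intervalIntegral.integral_hasDerivAt_right (continuous_ramp.intervalIntegrable _ _)
    continuous_ramp.stronglyMeasurable.stronglyMeasurableAtFilter continuous_ramp.continuousAt

lemma hasDerivAt_softStep (y : ℝ) : HasDerivAt softStep (hat y) y := by
  have h1 : HasDerivAt (fun y => rampInt (y + 1)) (ramp (y + 1)) y :=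
    (hasDerivAt_rampInt (y + 1)).comp_add_const y 1
  have h2 : HasDerivAt (fun y => rampInt (y - 1)) (ramp (y - 1)) y :=
    (hasDerivAt_rampInt (y - 1)).comp_sub_const y 1
  have := (h1.sub ((hasDerivAt_rampInt y).const_mul 2)).add h2
  have e : hat y = ramp (y + 1) - 2 * ramp y + ramp (y - 1) := by unfold hat; ring
  rw [e]
  exact this

lemma continuous_softStep : Continuous softStep :=
  continuous_iff_continuousAt.2 fun x => (hasDerivAt_softStep x).continuousAt

lemma softStep_of_le {y : ℝ} (hy : y ≤ -1) : softStep y = 0 := by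
  unfold softStep
  rw [rampInt_of_nonpos (by linarith), rampInt_of_nonpos (by linarith),
    rampInt_of_nonpos (by linarith)]
  ring

lemma softStep_of_ge {y : ℝ} (hy : 1 ≤ y) : softStep y = 1 := by
  unfold softStep
  rw [rampInt_of_nonneg (by linarith), rampInt_of_nonneg (by linarith),
    rampInt_of_nonneg (by linarith)]
  ring

lemma softStep_mono : Monotone softStep :=
  monotone_of_hasDerivAt_nonneg hasDerivAt_softStep hat_nonneg

lemma softStep_mem (y : ℝ) : softStep y ∈ Set.Icc (0 : ℝ) 1 := by
  constructor
  · rcases le_total y (-1) with h | h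
    · rw [softStep_of_le h]
    · rw [← softStep_of_le le_rfl]; exact softStep_mono h
  · rcases le_total 1 y with h | h
    · rw [softStep_of_ge h]
    · rw [← softStep_of_ge le_rfl]; exact softStep_mono h

namespace GZero

/-- A smoothed distribution function of `g` at level `j / n`. -/
def softCdf (n j : ℕ) (g : GZero) : ℝ := ∫ s, softStep (j - n * g.val s) ∂unitLeb

lemma integrable_softStep (n j : ℕ) (g : GZero) :
    Integrable (fun s => softStep (j - n * g.val s)) unitLeb := by
  refine Integrable.of_bound ?_ 1 (Eventually.of_forall fun s => ?_)
  · exact (continuous_softStep.measurable.comp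
      ((g.val_measurable.const_mul _).const_sub _)).aestronglyMeasurable
  · rw [Real.norm_eq_abs, abs_of_nonneg (softStep_mem _).1]
    exact (softStep_mem _).2

lemma softCdf_mem (n j : ℕ) (g : GZero) : softCdf n j g ∈ Set.Icc (0 : ℝ) 1 := by
  constructor
  · exact integral_nonneg fun s => (softStep_mem _).1
  · have := integral_mono (integrable_softStep n j g) (integrable_const (μ := unitLeb) (1 : ℝ))
      fun s => (softStep_mem _).2
    simpa [softCdf] using this

lemma integral_indicator_unitLeb {s : ℝ} (hs : s ∈ Set.Icc (0 : ℝ) 1) :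
    ∫ r, (Set.Icc (0 : ℝ) s).indicator (fun _ => (1 : ℝ)) r ∂unitLeb = s := by
  rw [integral_indicator_const _ measurableSet_Icc, smul_eq_mul, mul_one, unitLeb,
    measureReal_restrict_apply measurableSet_Icc,
    Set.inter_eq_left.2 (Set.Icc_subset_Icc_right hs.2), Real.volume_real_Icc_of_le hs.1, sub_zero]

lemma integrable_indicator_unitLeb (s : ℝ) :
    Integrable ((Set.Icc (0 : ℝ) s).indicator fun _ => (1 : ℝ)) unitLeb :=
  (integrable_const _).indicator measurableSet_Icc

lemma le_softCdf {n j : ℕ} {g : GZero} {s : ℝ} (hs : s ∈ Set.Icc (0 : ℝ) 1)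
    (h : 1 ≤ j - n * g.val s) : s ≤ softCdf n j g := by
  have := integral_mono (integrable_indicator_unitLeb s) (integrable_softStep n j g) fun r => by
    by_cases hr : r ∈ Set.Icc (0 : ℝ) s
    · rw [Set.indicator_of_mem hr, softStep_of_ge]
      have := mul_le_mul_of_nonneg_left (g.val_mono hr.2) (Nat.cast_nonneg (α := ℝ) n)
      linarith
    · rw [Set.indicator_of_notMem hr]
      exact (softStep_mem _).1
  rwa [integral_indicator_unitLeb hs] at this

lemma softCdf_le {n j : ℕ} {g : GZero} {s : ℝ} (hs : s ∈ Set.Icc (0 : ℝ) 1)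
    (h : j - n * g.val s ≤ -1) : softCdf n j g ≤ s := by
  have := integral_mono_ae (integrable_softStep n j g) (integrable_indicator_unitLeb s) (by
    have h0 : ∀ᵐ r ∂unitLeb, r ∈ Set.Icc (0 : ℝ) 1 := ae_restrict_mem measurableSet_Icc
    filter_upwards [h0] with r hr0
    by_cases hr : r ∈ Set.Icc (0 : ℝ) s
    · rw [Set.indicator_of_mem hr]
      exact (softStep_mem _).2
    · rw [Set.indicator_of_notMem hr, softStep_of_le]
      have hsr : s ≤ r := by
        by_contra hc
        exact hr ⟨hr0.1, (not_le.1 hc).le⟩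
      have := mul_le_mul_of_nonneg_left (g.val_mono hsr) (Nat.cast_nonneg (α := ℝ) n)
      linarith)
  rwa [integral_indicator_unitLeb hs] at this

/-- The number of levels whose smoothed distribution function is below `s` is about `n g(s)`. -/
lemma abs_count_sub_le (n : ℕ) (g : GZero) {s : ℝ} (hs : s ∈ Set.Icc (0 : ℝ) 1)
    (hne : ∀ j ∈ Finset.range (n + 1), softCdf n j g ≠ s) :
    |∑ j ∈ Finset.range (n + 1), (if softCdf n j g < s then (1 : ℝ) else 0) - n * g.val s| ≤ 2 := by
  have hg := g.val_mem s
  set z := n * g.val s with hz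
  have hz0 : 0 ≤ z := mul_nonneg (Nat.cast_nonneg _) hg.1
  have hzn : z ≤ n := mul_le_of_le_one_right (Nat.cast_nonneg _) hg.2
  rw [Finset.sum_boole]
  have up : ((Finset.range (n + 1)).filter fun j => softCdf n j g < s) ⊆
      Finset.range (⌊z⌋₊ + 2) := by
    intro j hj
    rw [Finset.mem_filter] at hj
    rw [Finset.mem_range]
    by_contra hc
    have h1 : ((⌊z⌋₊ + 2 : ℕ) : ℝ) ≤ j := by exact_mod_cast not_lt.1 hc
    push_cast at h1
    have h2 := Nat.lt_floor_add_one z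
    exact absurd hj.2 (not_lt.2 (le_softCdf hs (by linarith)))
  have lo : Finset.range ⌊z⌋₊ ⊆ (Finset.range (n + 1)).filter fun j => softCdf n j g < s := by
    intro j hj
    rw [Finset.mem_range] at hj
    have h1 : ((j + 1 : ℕ) : ℝ) ≤ ⌊z⌋₊ := by exact_mod_cast hj
    push_cast at h1
    have h2 := Nat.floor_le hz0
    have hjn : j ∈ Finset.range (n + 1) := by
      rw [Finset.mem_range]
      have : (j : ℝ) < n + 1 := by linarith
      exact_mod_cast this
    exact Finset.mem_filter.2 ⟨hjn, lt_of_le_of_ne (softCdf_le hs (by linarith)) (hne j hjn)⟩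
  have a1 := Finset.card_le_card up
  have a2 := Finset.card_le_card lo
  rw [Finset.card_range] at a1 a2
  have b1 : ((((Finset.range (n + 1)).filter fun j => softCdf n j g < s).card : ℕ) : ℝ) ≤
      ⌊z⌋₊ + 2 := by exact_mod_cast a1
  have b2 : ((⌊z⌋₊ : ℕ) : ℝ) ≤
      (((Finset.range (n + 1)).filter fun j => softCdf n j g < s).card : ℕ) := by
    exact_mod_cast a2
  have c1 := Nat.lt_floor_add_one z
  have c2 := Nat.floor_le hz0
  rw [abs_le]
  constructor <;> linarith

end GZero

/-- The cylinder function approximating the linear functional `g ↦ ∫₀¹ f(t) g(t) dt`. -/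
def linApprox (f : ℝ → ℝ) (hf : Continuous f) (n : ℕ) : CylZ where
  m := n + 1
  U := fun y => (1 / (n : ℝ)) * ∑ j, ∫ s in (y j)..1, f s
  α := fun j x => softStep (j - n * x)
  contDiff_U := by
    refine contDiff_const.mul (ContDiff.sum fun j _ => ?_)
    have h1 : ∀ y, HasDerivAt (fun y => ∫ s in y..(1 : ℝ), f s) (-f y) y := fun y =>
      intervalIntegral.integral_hasDerivAt_left (hf.intervalIntegrable _ _)
        hf.stronglyMeasurable.stronglyMeasurableAtFilter hf.continuousAt
    have h2 : ContDiff ℝ 1 (fun y => ∫ s in y..(1 : ℝ), f s) := by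
      refine contDiff_one_iff_deriv.2 ⟨fun y => (h1 y).differentiableAt, ?_⟩
      rw [funext fun y => (h1 y).deriv]
      exact hf.neg
    exact h2.comp (contDiff_apply ℝ ℝ j)
  contDiffOn_α := fun j => by
    have h2 : ContDiff ℝ 1 softStep := by
      refine contDiff_one_iff_deriv.2 ⟨fun y => (hasDerivAt_softStep y).differentiableAt, ?_⟩
      rw [funext fun y => (hasDerivAt_softStep y).deriv]
      exact continuous_hat
    exact (h2.comp (contDiff_const.sub (contDiff_const.mul contDiff_id))).contDiffOn

lemma linApprox_grad (f : ℝ → ℝ) (hf : Continuous f) {n : ℕ} (hn : n ≠ 0) (p : GZero × ℝ) :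
    (linApprox f hf n).grad p =
      ∑ j ∈ Finset.range (n + 1), f (p.1.softCdf n j) * hat (j - n * p.1.val p.2) := by
  have h1 : ∀ y, HasDerivAt (fun y => ∫ s in y..(1 : ℝ), f s) (-f y) y := fun y =>
    intervalIntegral.integral_hasDerivAt_left (hf.intervalIntegrable _ _)
      hf.stronglyMeasurable.stronglyMeasurableAtFilter hf.continuousAt
  let W : (Fin (n + 1) → ℝ) → ℝ := (linApprox f hf n).U
  let x : Fin (n + 1) → ℝ := (linApprox f hf n).moments p.1
  have hU : ∀ y : Fin (n + 1) → ℝ, HasFDerivAt W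
      ((1 / (n : ℝ)) • ∑ j, (-f (y j)) •
        (ContinuousLinearMap.proj j : (Fin (n + 1) → ℝ) →L[ℝ] ℝ)) y := fun y =>
    (HasFDerivAt.fun_sum fun j _ =>
      HasDerivAt.comp_hasFDerivAt (h₂ := fun y => ∫ s in y..(1 : ℝ), f s) (f := fun y => y j)
        y (h1 (y j)) (hasFDerivAt_apply j y)).const_mul (1 / (n : ℝ))
  have hα : ∀ j : Fin (n + 1), ∀ x ∈ Set.Icc (0 : ℝ) 1,
      derivWithin ((linApprox f hf n).α j) (Set.Icc 0 1) x = hat (j - n * x) * (-n) := by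
    intro j x hx
    have h3 : HasDerivAt (fun x : ℝ => (j : ℝ) - n * x) (-n) x := by
      simpa using ((hasDerivAt_id x).const_mul (n : ℝ)).const_sub (j : ℝ)
    exact ((hasDerivAt_softStep _).comp x h3).hasDerivWithinAt.derivWithin
      (uniqueDiffOn_Icc zero_lt_one x hx)
  have hn' : (n : ℝ) ≠ 0 := Nat.cast_ne_zero.2 hn
  have e : (linApprox f hf n).grad p = ∑ j : Fin (n + 1),
      fderiv ℝ W x (Pi.single j 1) *
        derivWithin ((linApprox f hf n).α j) (Set.Icc 0 1) (p.1.val p.2) := rfl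
  rw [e, ← Fin.sum_univ_eq_sum_range
    (fun j : ℕ => f (p.1.softCdf n j) * hat (j - n * p.1.val p.2)) (n + 1)]
  refine Finset.sum_congr rfl fun j _ => ?_
  rw [hα j _ (p.1.val_mem _), (hU _).fderiv]
  have e2 : ((1 / (n : ℝ)) • ∑ i, (-f (x i)) •
      (ContinuousLinearMap.proj i : (Fin (n + 1) → ℝ) →L[ℝ] ℝ)) (Pi.single j 1) =
        1 / (n : ℝ) * -f (p.1.softCdf n j) := by
    simp only [_root_.smul_apply, _root_.sum_apply,
      ContinuousLinearMap.proj_apply, smul_eq_mul, Pi.single_apply, mul_ite, mul_one, mul_zero]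
    rw [Finset.sum_ite_eq' Finset.univ j]
    simp only [Finset.mem_univ, if_true]
    rfl
  refine (congrArg (· * (hat (j - n * p.1.val p.2) * (-n))) e2).trans ?_
  field_simp

lemma abs_linApprox_eval_sub_le (f : ℝ → ℝ) (hf : Continuous f) {M : ℝ}
    (hM : ∀ x ∈ Set.Icc (0 : ℝ) 1, |f x| ≤ M) {n : ℕ} (hn : n ≠ 0) (g : GZero) :
    |(linApprox f hf n).eval g - ∫ t, f t * g.val t ∂unitLeb| ≤ M * (2 / n) := by
  have hn' : (0 : ℝ) < n := Nat.cast_pos.2 (Nat.pos_of_ne_zero hn)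
  have hM0 : 0 ≤ M := (abs_nonneg _).trans (hM 0 (by simp))
  have hI : ∀ᵐ r ∂unitLeb, r ∈ Set.Icc (0 : ℝ) 1 := ae_restrict_mem measurableSet_Icc
  have hfi : Integrable f unitLeb := Integrable.of_bound hf.aestronglyMeasurable M
    (hI.mono fun x hx => hM x hx)
  have e1 : ∀ c ∈ Set.Icc (0 : ℝ) 1, ∫ s in c..1, f s =
      ∫ s, f s * (if c < s then (1 : ℝ) else 0) ∂unitLeb := by
    intro c hc
    have : (fun s => f s * (if c < s then (1 : ℝ) else 0)) = (Set.Ioi c).indicator f := by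
      funext s
      by_cases h : c < s <;> simp [h]
    rw [this, integral_indicator measurableSet_Ioi, unitLeb,
      Measure.restrict_restrict measurableSet_Ioi, intervalIntegral.integral_of_le hc.2]
    congr 2
    ext s
    simp only [Set.mem_Ioc, Set.mem_inter_iff, Set.mem_Ioi, Set.mem_Icc]
    constructor
    · rintro ⟨h1, h2⟩; exact ⟨h1, hc.1.trans h1.le, h2⟩
    · rintro ⟨h1, h2, h3⟩; exact ⟨h1, h3⟩
  have hmi : ∀ c : ℝ, Integrable (fun s => f s * (if c < s then (1 : ℝ) else 0)) unitLeb := by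
    intro c
    refine hfi.mul_bdd (c := 1) ?_ (Eventually.of_forall fun s => ?_)
    · exact (Measurable.ite measurableSet_Ioi measurable_const measurable_const).aestronglyMeasurable
    · split_ifs <;> simp
  have e2 : (linApprox f hf n).eval g = ∫ s, f s * ((1 / (n : ℝ)) *
      ∑ j ∈ Finset.range (n + 1), (if g.softCdf n j < s then (1 : ℝ) else 0)) ∂unitLeb := by
    have : (linApprox f hf n).eval g =
        (1 / (n : ℝ)) * ∑ j : Fin (n + 1), ∫ s in (g.softCdf n j)..1, f s := rfl
    rw [this, Fin.sum_univ_eq_sum_range (fun j : ℕ => ∫ s in (g.softCdf n j)..1, f s) (n + 1)]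
    have e3 : ∀ s, f s * ((1 / (n : ℝ)) *
        ∑ j ∈ Finset.range (n + 1), (if g.softCdf n j < s then (1 : ℝ) else 0)) =
          (1 / (n : ℝ)) * ∑ j ∈ Finset.range (n + 1),
            f s * (if g.softCdf n j < s then (1 : ℝ) else 0) := by
      intro s
      rw [← Finset.mul_sum]
      ring
    simp only [e3]
    rw [integral_const_mul, integral_finsetSum _ fun j _ => hmi _]
    exact congrArg _ (Finset.sum_congr rfl fun j _ => e1 _ (GZero.softCdf_mem n j g))
  have i1 : Integrable (fun s => f s * ((1 / (n : ℝ)) *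
      ∑ j ∈ Finset.range (n + 1), (if g.softCdf n j < s then (1 : ℝ) else 0))) unitLeb := by
    have := (integrable_finsetSum (Finset.range (n + 1))
      fun j _ => hmi (g.softCdf n j)).const_mul (1 / (n : ℝ))
    refine this.congr (Eventually.of_forall fun s => ?_)
    simp only [← Finset.mul_sum]
    ring
  have i2 : Integrable (fun s => f s * g.val s) unitLeb :=
    hfi.mul_bdd (c := 1) g.val_measurable.aestronglyMeasurable (Eventually.of_forall fun s => by
      rw [Real.norm_eq_abs, abs_of_nonneg (g.val_mem s).1]; exact (g.val_mem s).2)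
  have hne : ∀ᵐ s ∂unitLeb, ∀ j ∈ Finset.range (n + 1), g.softCdf n j ≠ s := by
    have : ∀ᵐ s : ℝ, s ∉ ((Finset.range (n + 1)).image fun j => g.softCdf n j : Set ℝ) :=
      (Finset.countable_toSet _).ae_notMem _
    filter_upwards [ae_restrict_of_ae this] with s hs j hj h
    exact hs (Finset.mem_coe.2 (Finset.mem_image.2 ⟨j, hj, h⟩))
  rw [e2, ← integral_sub i1 i2]
  have := norm_integral_le_of_norm_le_const (μ := unitLeb) (f := fun s => f s * ((1 / (n : ℝ)) *
      ∑ j ∈ Finset.range (n + 1), (if g.softCdf n j < s then (1 : ℝ) else 0)) - f s * g.val s)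
    (C := M * (2 / n)) (by
      filter_upwards [hI, hne] with s hs hs'
      have hc := g.abs_count_sub_le n hs hs'
      rw [← mul_sub, norm_mul]
      refine mul_le_mul (hM s hs) ?_ (norm_nonneg _) hM0
      have e4 : (1 / (n : ℝ)) * ∑ j ∈ Finset.range (n + 1),
          (if g.softCdf n j < s then (1 : ℝ) else 0) - g.val s =
          (∑ j ∈ Finset.range (n + 1), (if g.softCdf n j < s then (1 : ℝ) else 0) -
            n * g.val s) / n := by
        field_simp
      rw [e4, Real.norm_eq_abs, abs_div, abs_of_pos hn']
      gcongr)
  simpa using this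

lemma abs_linApprox_grad_le (f : ℝ → ℝ) (hf : Continuous f) {M : ℝ}
    (hM : ∀ x ∈ Set.Icc (0 : ℝ) 1, |f x| ≤ M) {n : ℕ} (hn : n ≠ 0) (p : GZero × ℝ) :
    |(linApprox f hf n).grad p| ≤ M := by
  have hz0 : 0 ≤ n * p.1.val p.2 := mul_nonneg (Nat.cast_nonneg _) (p.1.val_mem _).1
  have hzn : n * p.1.val p.2 ≤ n := mul_le_of_le_one_right (Nat.cast_nonneg _) (p.1.val_mem _).2
  rw [linApprox_grad f hf hn]
  calc _ ≤ ∑ j ∈ Finset.range (n + 1), |f (p.1.softCdf n j) * hat (j - n * p.1.val p.2)| :=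
        Finset.abs_sum_le_sum_abs _ _
    _ ≤ ∑ j ∈ Finset.range (n + 1), M * hat (j - n * p.1.val p.2) :=
        Finset.sum_le_sum fun j _ => by
          rw [abs_mul, abs_of_nonneg (hat_nonneg _)]
          exact mul_le_mul_of_nonneg_right (hM _ (GZero.softCdf_mem _ _ _)) (hat_nonneg _)
    _ = M := by rw [← Finset.mul_sum, sum_hat hz0 hzn, mul_one]

lemma tendsto_linApprox_grad (f : ℝ → ℝ) (hf : Continuous f) {g : GZero}
    (hg : StrictMonoOn g.val (Set.Ioo 0 1)) {t : ℝ} (ht : t ∈ Set.Ioo (0 : ℝ) 1) :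
    Tendsto (fun n => (linApprox f hf (n + 1)).grad (g, t)) atTop (𝓝 (f t)) := by
  rw [Metric.tendsto_atTop]
  intro ε hε
  obtain ⟨δ, hδ, hδf⟩ := Metric.continuousAt_iff.1 (hf.continuousAt (x := t)) (ε / 2) (half_pos hε)
  obtain ⟨t₁, h1, h1t⟩ := exists_between (max_lt ht.1 (show t - δ < t by linarith))
  obtain ⟨t₂, ht2, h2⟩ := exists_between (lt_min ht.2 (show t < t + δ by linarith))
  rw [max_lt_iff] at h1
  rw [lt_min_iff] at h2
  have ht₁ : t₁ ∈ Set.Ioo (0 : ℝ) 1 := ⟨h1.1, h1t.trans ht.2⟩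
  have ht₂ : t₂ ∈ Set.Ioo (0 : ℝ) 1 := ⟨ht.1.trans ht2, h2.1⟩
  have g1 := hg ht₁ ht h1t
  have g2 := hg ht ht₂ ht2
  obtain ⟨n₁, hn₁⟩ := exists_nat_gt (2 / (g.val t - g.val t₁))
  obtain ⟨n₂, hn₂⟩ := exists_nat_gt (2 / (g.val t₂ - g.val t))
  refine ⟨max n₁ n₂, fun n hn => ?_⟩
  have hn1 : (n₁ : ℝ) ≤ ((n + 1 : ℕ) : ℝ) := by
    exact_mod_cast (le_max_left _ _).trans (hn.trans n.le_succ)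
  have hn2 : (n₂ : ℝ) ≤ ((n + 1 : ℕ) : ℝ) := by
    exact_mod_cast (le_max_right _ _).trans (hn.trans n.le_succ)
  have k1 : 2 ≤ ((n + 1 : ℕ) : ℝ) * (g.val t - g.val t₁) :=
    (div_le_iff₀ (by linarith)).1 (hn₁.le.trans hn1)
  have k2 : 2 ≤ ((n + 1 : ℕ) : ℝ) * (g.val t₂ - g.val t) :=
    (div_le_iff₀ (by linarith)).1 (hn₂.le.trans hn2)
  generalize hN : n + 1 = N at *
  have hN0 : N ≠ 0 := by omega
  have hz0 : 0 ≤ N * g.val t := mul_nonneg (Nat.cast_nonneg _) (g.val_mem _).1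
  have hzn : N * g.val t ≤ N := mul_le_of_le_one_right (Nat.cast_nonneg _) (g.val_mem _).2
  have e : (linApprox f hf N).grad (g, t) - f t = ∑ j ∈ Finset.range (N + 1),
      (f (g.softCdf N j) - f t) * hat (j - N * g.val t) := by
    simp only [sub_mul, Finset.sum_sub_distrib]
    rw [← Finset.mul_sum, sum_hat hz0 hzn, mul_one, linApprox_grad f hf hN0]
  rw [Real.dist_eq, e]
  calc _ ≤ ∑ j ∈ Finset.range (N + 1), |(f (g.softCdf N j) - f t) * hat (j - N * g.val t)| :=
        Finset.abs_sum_le_sum_abs _ _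
    _ ≤ ∑ j ∈ Finset.range (N + 1), ε / 2 * hat (j - N * g.val t) :=
        Finset.sum_le_sum fun j _ => by
          rcases le_or_gt 1 |j - N * g.val t| with h | h
          · rw [hat_eq_zero h]; simp
          · rw [abs_mul, abs_of_nonneg (hat_nonneg _)]
            refine mul_le_mul_of_nonneg_right ?_ (hat_nonneg _)
            rw [abs_lt] at h
            have c1 : t₁ ≤ g.softCdf N j :=
              GZero.le_softCdf (Set.Ioo_subset_Icc_self ht₁) (by linarith [h.1])
            have c2 : g.softCdf N j ≤ t₂ :=
              GZero.softCdf_le (Set.Ioo_subset_Icc_self ht₂) (by linarith [h.2])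
            have : dist (g.softCdf N j) t < δ := by
              rw [Real.dist_eq, abs_lt]
              constructor <;> linarith [h1.2, h2.2]
            exact (hδf this).le
    _ = ε / 2 := by rw [← Finset.mul_sum, sum_hat hz0 hzn, mul_one]
    _ < ε := half_lt_self hε

section L2

variable {Ω : Type*} [MeasurableSpace Ω] {μ : Measure Ω}

lemma tendsto_eLpNorm_zero_of_dominated {f : ℕ → Ω → ℝ} {b : Ω → ℝ}
    (hf : ∀ n, AEStronglyMeasurable (f n) μ) (hb : MemLp b 2 μ)
    (hle : ∀ n, ∀ᵐ x ∂μ, |f n x| ≤ b x)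
    (h : ∀ᵐ x ∂μ, Tendsto (fun n => f n x) atTop (𝓝 0)) :
    Tendsto (fun n => eLpNorm (f n) 2 μ) atTop (𝓝 0) := by
  have hm : ∀ n, MemLp (f n) 2 μ := fun n => hb.mono' (hf n) (hle n)
  have h1 : Tendsto (fun n => ∫ x, f n x ^ 2 ∂μ) atTop (𝓝 0) := by
    have := tendsto_integral_of_dominated_convergence (μ := μ) (F := fun n x => f n x ^ 2)
      (f := fun _ => (0 : ℝ)) (fun x => b x ^ 2) (fun n => (hf n).pow 2) hb.integrable_sq
      (fun n => (hle n).mono fun x hx => by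
        rw [Real.norm_eq_abs, abs_pow]
        exact pow_le_pow_left₀ (abs_nonneg _) hx 2)
      (h.mono fun x hx => by simpa using hx.pow 2)
    simpa using this
  have h2 : Tendsto (fun n => (eLpNorm (f n) 2 μ).toReal) atTop (𝓝 0) := by
    have := h1.sqrt
    rw [Real.sqrt_zero] at this
    refine this.congr fun n => ?_
    rw [integral_sq_eq_eLpNorm (hm n), Real.sqrt_sq ENNReal.toReal_nonneg]
  exact (ENNReal.tendsto_toReal_zero_iff fun n => (hm n).2.ne).1 h2

end L2

/-- `(ℓ, V)` is a limit of cylinder functions and their gradients, uniformly in the first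
component. -/
def UnifApprox (Q : Measure GZero) (ℓ : GZero → ℝ) (V : GZero × ℝ → ℝ) : Prop :=
  ∀ ε > 0, ∃ F : CylZ, (∀ g, |F.eval g - ℓ g| ≤ ε) ∧
    eLpNorm (fun p => F.grad p - V p) 2 (Q.prod unitLeb) ≤ ENNReal.ofReal ε

namespace IsDirichletProcess

variable {β : ℝ} {Q : Measure GZero}

lemma unifApprox_linear_of_continuous (hQ : IsDirichletProcess β Q) {f : ℝ → ℝ}
    (hf : Continuous f) :
    UnifApprox Q (fun g => ∫ t, f t * g.val t ∂unitLeb) fun p => f p.2 := by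
  have := hQ.isProbabilityMeasure
  obtain ⟨M, hM⟩ := isCompact_Icc.exists_bound_of_continuousOn (s := Set.Icc (0 : ℝ) 1)
    hf.continuousOn
  have hM' : ∀ x ∈ Set.Icc (0 : ℝ) 1, |f x| ≤ M := hM
  have hae : ∀ᵐ p ∂(Q.prod unitLeb), p.2 ∈ Set.Icc (0 : ℝ) 1 := by
    rw [Measure.ae_prod_iff_ae_ae (measurable_snd measurableSet_Icc)]
    exact Eventually.of_forall fun g => ae_restrict_mem measurableSet_Icc
  have h1 : Tendsto (fun n => eLpNorm (fun p => (linApprox f hf (n + 1)).grad p - f p.2) 2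
      (Q.prod unitLeb)) atTop (𝓝 0) := by
    have hms : ∀ n, Measurable fun p : GZero × ℝ => (linApprox f hf (n + 1)).grad p - f p.2 :=
      fun n => (CylZ.measurable_grad _).sub (hf.measurable.comp measurable_snd)
    refine tendsto_eLpNorm_zero_of_dominated (b := fun _ => M + M)
      (fun n => (hms n).aestronglyMeasurable)
      (memLp_const _) (fun n => ?_) ?_
    · filter_upwards [hae] with p hp
      exact (abs_sub _ _).trans
        (add_le_add (abs_linApprox_grad_le f hf hM' n.succ_ne_zero p) (hM' _ hp))
    · have hset : MeasurableSet {p : GZero × ℝ | Tendsto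
          (fun n => (linApprox f hf (n + 1)).grad p - f p.2) atTop (𝓝 0)} :=
        measurableSet_tendsto _ hms
      rw [Measure.ae_prod_iff_ae_ae hset]
      filter_upwards [hQ.ae_strictMonoOn] with g hg
      filter_upwards [ae_unitLeb_mem_Ioo] with t ht
      have := (tendsto_linApprox_grad f hf hg.1 ht).sub_const (f t)
      rwa [sub_self] at this
  have h2 : Tendsto (fun n : ℕ => M * (2 / ((n + 1 : ℕ) : ℝ))) atTop (𝓝 0) := by
    have := (tendsto_const_nhds (x := (2 : ℝ))).div_atTop
      (tendsto_natCast_atTop_atTop.comp (tendsto_add_atTop_nat 1))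
    simpa using this.const_mul M
  intro ε hε
  obtain ⟨n, hn1, hn2⟩ := ((h1.eventually_lt_const (ENNReal.ofReal_pos.2 hε)).and
    (h2.eventually_lt_const hε)).exists
  exact ⟨_, fun g => (abs_linApprox_eval_sub_le f hf hM' n.succ_ne_zero g).trans hn2.le, hn1.le⟩

lemma unifApprox_linear (hQ : IsDirichletProcess β Q) {e : ℝ → ℝ} (he : MemLp e 2 unitLeb) :
    UnifApprox Q (fun g => ∫ t, e t * g.val t ∂unitLeb) fun p => e p.2 := by
  have := hQ.isProbabilityMeasure
  intro ε hε
  have hε2 : ENNReal.ofReal (ε / 2) ≠ 0 := (ENNReal.ofReal_pos.2 (half_pos hε)).ne'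
  obtain ⟨f, hf1, hf2⟩ := he.exists_boundedContinuous_eLpNorm_sub_le (by simp) hε2
  obtain ⟨F, hF1, hF2⟩ := hQ.unifApprox_linear_of_continuous f.continuous (ε / 2) (half_pos hε)
  have hd : MemLp (fun t => f t - e t) 2 unitLeb := hf2.sub he
  have hd1 : eLpNorm (fun t => f t - e t) 2 unitLeb ≤ ENNReal.ofReal (ε / 2) := by
    rw [← eLpNorm_neg]
    refine le_trans (le_of_eq ?_) hf1
    congr 1
    funext t
    simp
  refine ⟨F, fun g => ?_, ?_⟩
  · have hb : ∀ t, |g.val t| ≤ 1 := fun t => by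
      rw [abs_of_nonneg (g.val_mem t).1]; exact (g.val_mem t).2
    have hi : ∀ h : ℝ → ℝ, MemLp h 2 unitLeb → Integrable (fun t => h t * g.val t) unitLeb :=
      fun h hh => (hh.integrable one_le_two).mul_bdd (c := 1)
        g.val_measurable.aestronglyMeasurable (Eventually.of_forall hb)
    have h1 : |∫ t, f t * g.val t ∂unitLeb - ∫ t, e t * g.val t ∂unitLeb| ≤ ε / 2 := by
      rw [← integral_sub (hi _ hf2) (hi _ he)]
      have hdi := hd.integrable one_le_two
      calc _ ≤ ∫ t, |f t * g.val t - e t * g.val t| ∂unitLeb := abs_integral_le_integral_abs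
        _ ≤ ∫ t, ‖f t - e t‖ ∂unitLeb := by
            refine integral_mono ((hi _ hf2).sub (hi _ he)).abs hdi.norm fun t => ?_
            simp only
            rw [← sub_mul, abs_mul]
            exact mul_le_of_le_one_right (abs_nonneg _) (hb t)
        _ = (eLpNorm (fun t => f t - e t) 1 unitLeb).toReal := by
            rw [integral_norm_eq_lintegral_enorm hdi.aestronglyMeasurable,
              eLpNorm_one_eq_lintegral_enorm]
        _ ≤ ε / 2 := ENNReal.toReal_le_of_le_ofReal (half_pos hε).le
            ((eLpNorm_le_eLpNorm_of_exponent_le one_le_two hd.aestronglyMeasurable).trans hd1)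
    calc _ ≤ |F.eval g - ∫ t, f t * g.val t ∂unitLeb| +
          |∫ t, f t * g.val t ∂unitLeb - ∫ t, e t * g.val t ∂unitLeb| := abs_sub_le _ _ _
      _ ≤ ε := by linarith [hF1 g]
  · have h2 : eLpNorm (fun p : GZero × ℝ => f p.2 - e p.2) 2 (Q.prod unitLeb) ≤
        ENNReal.ofReal (ε / 2) := by
      have := eLpNorm_comp_measurePreserving (p := 2) hd.aestronglyMeasurable
        (measurePreserving_snd (μ := Q) (ν := unitLeb))
      exact (le_of_eq this).trans hd1
    have e1 : (fun p : GZero × ℝ => F.grad p - e p.2) =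
        (fun p : GZero × ℝ => F.grad p - f p.2) + fun p : GZero × ℝ => f p.2 - e p.2 := by
      funext p; simp
    rw [e1]
    refine (eLpNorm_add_le ?_ ?_ one_le_two).trans ((add_le_add hF2 h2).trans ?_)
    · exact (F.measurable_grad.sub
        (f.continuous.measurable.comp measurable_snd)).aestronglyMeasurable
    · exact hd.aestronglyMeasurable.comp_snd
    · rw [← ENNReal.ofReal_add (by positivity) (by positivity), add_halves]

end IsDirichletProcess

/-- Along a bounded sequence in a closed convex subset of a Hilbert space, closed convex relations
pass to the limit in the first component. -/
lemma exists_mem_of_tendsto_of_bounded {E H : Type*} [NormedAddCommGroup E] [NormedSpace ℝ E]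
    [NormedAddCommGroup H] [InnerProductSpace ℝ H] [CompleteSpace H] {C : Set (E × H)}
    (hC : IsClosed C) (hCc : Convex ℝ C) {K : Set H} (hK : IsClosed K) (hKc : Convex ℝ K)
    {u : E} {a : ℕ → E} {B : ℕ → H} (ha : Tendsto a atTop (𝓝 u)) (hB : ∀ n, B n ∈ K)
    (hm : ∀ n, (a n, B n) ∈ C) {R : ℝ} (hR : ∀ n, ‖B n‖ ≤ R) : ∃ V ∈ K, (u, V) ∈ C := by
  let T : ℕ → Set H := fun n =>
    {V | V ∈ K ∧ ∃ b ∈ Metric.closedBall u (1 / ((n : ℝ) + 1)), (b, V) ∈ C}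
  have hTne : ∀ n, ∃ k, B k ∈ T n := by
    intro n
    have h1 : (0 : ℝ) < 1 / ((n : ℝ) + 1) := by positivity
    obtain ⟨k, hk⟩ := (ha.eventually (Metric.closedBall_mem_nhds u h1)).exists
    exact ⟨k, hB k, a k, hk, hm k⟩
  have hTc : ∀ n, Convex ℝ (T n) := by
    rintro n V ⟨hV, b, hb, hbV⟩ W ⟨hW, c, hc, hcW⟩ s t hs ht hst
    exact ⟨hKc hV hW hs ht hst, s • b + t • c, convex_closedBall _ _ hb hc hs ht hst,
      hCc hbV hcW hs ht hst⟩
  have hTa : ∀ n m, n ≤ m → T m ⊆ T n := by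
    rintro n m hnm V ⟨hV, b, hb, hbV⟩
    refine ⟨hV, b, Metric.closedBall_subset_closedBall ?_ hb, hbV⟩
    have : (n : ℝ) ≤ m := by exact_mod_cast hnm
    gcongr
  let d : ℕ → ℝ := fun n => sInf (norm '' T n)
  have hbdd : ∀ n, BddBelow (norm '' T n) := fun n =>
    ⟨0, by rintro _ ⟨V, _, rfl⟩; exact norm_nonneg V⟩
  have hne : ∀ n, (norm '' T n).Nonempty := fun n =>
    let ⟨k, hk⟩ := hTne n
    ⟨_, B k, hk, rfl⟩
  have hd0 : ∀ n, 0 ≤ d n := fun n => le_csInf (hne n) (by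
    rintro _ ⟨V, _, rfl⟩; exact norm_nonneg V)
  have hdle : ∀ n, ∀ V ∈ T n, d n ≤ ‖V‖ := fun n V hV => csInf_le (hbdd n) ⟨V, hV, rfl⟩
  have hdR : ∀ n, d n ≤ R := fun n => let ⟨k, hk⟩ := hTne n; (hdle n _ hk).trans (hR k)
  have hdm : Monotone d := fun n m hnm =>
    csInf_le_csInf (hbdd n) (hne m) (Set.image_mono (hTa n m hnm))
  have hdB : BddAbove (Set.range d) := ⟨R, by rintro _ ⟨n, rfl⟩; exact hdR n⟩
  have hlim := tendsto_atTop_ciSup hdm hdB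
  set D := ⨆ n, d n with hD
  have hdD : ∀ n, d n ≤ D := fun n => le_ciSup hdB n
  have hε : Tendsto (fun n : ℕ => 1 / ((n : ℝ) + 1)) atTop (𝓝 0) :=
    tendsto_one_div_add_atTop_nhds_zero_nat
  have hex : ∀ n, ∃ V ∈ T n, ‖V‖ < d n + 1 / ((n : ℝ) + 1) := by
    intro n
    have h1 : (0 : ℝ) < 1 / ((n : ℝ) + 1) := by positivity
    obtain ⟨_, ⟨V, hV, rfl⟩, hlt⟩ :=
      exists_lt_of_csInf_lt (hne n) (show d n < d n + 1 / ((n : ℝ) + 1) by linarith)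
    exact ⟨V, hV, hlt⟩
  choose y hyT hyd using hex
  have hcauchy : CauchySeq y := by
    refine cauchySeq_of_le_tendsto_0'
      (fun n : ℕ => Real.sqrt (4 * ((D + 1 / ((n : ℝ) + 1)) ^ 2 - d n ^ 2))) ?_ ?_
    · intro n m hnm
      rw [dist_eq_norm]
      refine Real.le_sqrt_of_sq_le ?_
      have hmid : (1 / 2 : ℝ) • y n + (1 / 2 : ℝ) • y m ∈ T n :=
        hTc n (hyT n) (hTa n m hnm (hyT m)) (by norm_num) (by norm_num) (by norm_num)
      have h1 := hdle n _ hmid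
      rw [← smul_add, norm_smul, Real.norm_of_nonneg (by norm_num : (0 : ℝ) ≤ 1 / 2)] at h1
      have h2 := parallelogram_law_with_norm ℝ (y n) (y m)
      have hmn : 1 / ((m : ℝ) + 1) ≤ 1 / ((n : ℝ) + 1) := by
        have : (n : ℝ) ≤ m := by exact_mod_cast hnm
        gcongr
      have h3 : ‖y n‖ ^ 2 ≤ (D + 1 / ((n : ℝ) + 1)) ^ 2 :=
        pow_le_pow_left₀ (norm_nonneg _) (by linarith [hyd n, hdD n]) 2
      have h4 : ‖y m‖ ^ 2 ≤ (D + 1 / ((n : ℝ) + 1)) ^ 2 :=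
        pow_le_pow_left₀ (norm_nonneg _) (by linarith [hyd m, hdD m]) 2
      have h5 : d n ^ 2 ≤ (1 / 2 * ‖y n + y m‖) ^ 2 := pow_le_pow_left₀ (hd0 n) h1 2
      nlinarith
    · have : Tendsto (fun n : ℕ => 4 * ((D + 1 / ((n : ℝ) + 1)) ^ 2 - d n ^ 2)) atTop
          (𝓝 (4 * ((D + 0) ^ 2 - D ^ 2))) :=
        (((hε.const_add D).pow 2).sub (hlim.pow 2)).const_mul 4
      have h2 := this.sqrt
      simpa using h2
  obtain ⟨V, hV⟩ := cauchySeq_tendsto_of_complete hcauchy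
  choose hyK b hb hbC using hyT
  have hbu : Tendsto b atTop (𝓝 u) := tendsto_iff_dist_tendsto_zero.2
    (squeeze_zero (fun _ => dist_nonneg) (fun n => Metric.mem_closedBall.1 (hb n)) hε)
  exact ⟨V, hK.mem_of_tendsto hV (Eventually.of_forall hyK),
    hC.mem_of_tendsto (hbu.prodMk_nhds hV) (Eventually.of_forall hbC)⟩

/-- Lipschitz functions on a finite dimensional space are uniform limits of smooth functions with
the same Lipschitz constant. -/
lemma LipschitzWith.exists_contDiff_near {E : Type*} [NormedAddCommGroup E] [NormedSpace ℝ E]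
    [FiniteDimensional ℝ E] {f : E → ℝ} {K : NNReal} (hf : LipschitzWith K f) {ε : ℝ}
    (hε : 0 < ε) :
    ∃ g : E → ℝ, ContDiff ℝ 1 g ∧ LipschitzWith K g ∧ ∀ x, |g x - f x| ≤ ε := by
  borelize E
  let μ : Measure E := Measure.addHaar
  obtain ⟨r, hr0, hr⟩ : ∃ r > 0, K * r ≤ ε := by
    refine ⟨ε / (K + 1), by positivity, ?_⟩
    rw [mul_div_assoc', div_le_iff₀ (by positivity)]
    nlinarith [K.coe_nonneg]
  let φ : ContDiffBump (0 : E) := ⟨r / 2, r, half_pos hr0, half_lt_self hr0⟩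
  have hli : LocallyIntegrable f μ := hf.continuous.locallyIntegrable
  refine ⟨convolution (φ.normed μ) f (ContinuousLinearMap.lsmul ℝ ℝ) μ, ?_, ?_, fun x => ?_⟩
  · exact φ.hasCompactSupport_normed.contDiff_convolution_left _ φ.contDiff_normed hli
  · have hi : ∀ x, Integrable (fun t => φ.normed μ t * f (x - t)) μ := fun x =>
      (φ.continuous_normed.mul (hf.continuous.comp
        (continuous_const.sub continuous_id))).integrable_of_hasCompactSupport
          φ.hasCompactSupport_normed.mul_right
    refine LipschitzWith.of_dist_le_mul fun x y => ?_
    simp only [convolution_def, ContinuousLinearMap.lsmul_apply, smul_eq_mul]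
    rw [Real.dist_eq, ← integral_sub (hi x) (hi y)]
    calc _ ≤ ∫ t, |φ.normed μ t * f (x - t) - φ.normed μ t * f (y - t)| ∂μ :=
          abs_integral_le_integral_abs
      _ ≤ ∫ t, φ.normed μ t * (K * dist x y) ∂μ := by
          refine integral_mono ((hi x).sub (hi y)).abs (φ.integrable_normed.mul_const _) fun t => ?_
          simp only
          rw [← mul_sub, abs_mul, abs_of_nonneg (φ.nonneg_normed t)]
          refine mul_le_mul_of_nonneg_left ?_ (φ.nonneg_normed t)
          have := hf.dist_le_mul (x - t) (y - t)
          rwa [dist_sub_right, Real.dist_eq] at this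
      _ = K * dist x y := by rw [integral_mul_const, φ.integral_normed, one_mul]
  · refine φ.dist_normed_convolution_le hf.continuous.aestronglyMeasurable fun y hy => ?_
    refine (hf.dist_le_mul y x).trans (le_trans ?_ hr)
    exact mul_le_mul_of_nonneg_left (le_of_lt hy) K.coe_nonneg

lemma sum_sq_le_of_opNorm_le_one {k : ℕ} (A : EuclideanSpace ℝ (Fin k) →L[ℝ] ℝ) (hA : ‖A‖ ≤ 1) :
    ∑ i, A (EuclideanSpace.single i 1) ^ 2 ≤ 1 := by
  let y : EuclideanSpace ℝ (Fin k) := WithLp.toLp 2 fun i => A (EuclideanSpace.single i 1)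
  have h1 : A y = ∑ i, A (EuclideanSpace.single i 1) ^ 2 := by
    have : y = ∑ i, A (EuclideanSpace.single i 1) • EuclideanSpace.single i (1 : ℝ) := by
      ext j
      simp [y, Finset.sum_apply, Pi.single_apply]
    rw [this, map_sum]
    exact Finset.sum_congr rfl fun i _ => by rw [map_smul, smul_eq_mul, sq]
  have h2 : ‖y‖ ^ 2 = ∑ i, A (EuclideanSpace.single i 1) ^ 2 := by
    rw [EuclideanSpace.norm_sq_eq]
    simp [y]
  have h3 : A y ≤ ‖y‖ := (le_abs_self _).trans ((A.le_opNorm y).trans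
    (mul_le_of_le_one_left (norm_nonneg _) hA))
  rw [h1, ← h2] at h3
  rw [← h2]
  nlinarith [norm_nonneg y]

lemma GZero.continuous_toL2 : Continuous GZero.toL2 := continuous_induced_dom

lemma GZero.dist_toL2 (g h : GZero) : dist g.toL2 h.toL2 = dist g h := rfl

lemma GZero.norm_toL2_le (g : GZero) : ‖g.toL2‖ ≤ 1 := by
  have := Lp.norm_le_of_ae_bound (f := g.toL2) (C := 1) zero_le_one (by
    filter_upwards [g.val_memLp.coeFn_toLp] with t ht
    have e : g.toL2 t = g.val t := ht
    rw [e, Real.norm_eq_abs, abs_of_nonneg (g.val_mem t).1]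
    exact (g.val_mem t).2)
  have e : measureUnivNNReal unitLeb = 1 := by simp [measureUnivNNReal]
  simpa [e] using this

lemma GZero.inner_toL2 (e : Lp ℝ 2 unitLeb) (g : GZero) :
    inner ℝ e g.toL2 = ∫ t, e t * g.val t ∂unitLeb := by
  rw [L2.inner_def]
  refine integral_congr_ae ?_
  filter_upwards [g.val_memLp.coeFn_toLp] with t ht
  have e' : g.toL2 t = g.val t := ht
  rw [e']
  simp [mul_comm]

lemma lintegral_ofReal_sq_eq {Ω : Type*} [MeasurableSpace Ω] {μ : Measure Ω}
    {f : Ω → ℝ} (hf : MemLp f 2 μ) :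
    ∫⁻ x, ENNReal.ofReal (f x ^ 2) ∂μ = eLpNorm f 2 μ ^ 2 := by
  rw [← ofReal_integral_eq_lintegral_ofReal hf.integrable_sq
    (Eventually.of_forall fun x => sq_nonneg _), integral_sq_eq_eLpNorm hf,
    ENNReal.ofReal_pow ENNReal.toReal_nonneg, ENNReal.ofReal_toReal hf.2.ne]

/-- The domain of the closed gradient is contained in the domain of the Dirichlet form. -/
lemma IsClosedGradient.memDomE {Q : Measure GZero} [IsProbabilityMeasure Q] {u : GZero → ℝ}
    {V : GZero × ℝ → ℝ} (h : IsClosedGradient Q u V) : MemDomE Q u := by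
  obtain ⟨hu, hV, F, h0, h1⟩ := h
  refine ⟨hu, F, h0, ?_⟩
  have hd : ∀ p : ℕ × ℕ, MemLp (fun q => (F p.1).grad q - (F p.2).grad q) 2 (Q.prod unitLeb) :=
    fun p => ((F p.1).memLp_grad Q).sub ((F p.2).memLp_grad Q)
  have e : ∀ p : ℕ × ℕ, ∫⁻ g, ∫⁻ t,
      ENNReal.ofReal (((F p.1).grad (g, t) - (F p.2).grad (g, t)) ^ 2) ∂unitLeb ∂Q =
        eLpNorm (fun q => (F p.1).grad q - (F p.2).grad q) 2 (Q.prod unitLeb) ^ 2 := by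
    intro p
    rw [← lintegral_ofReal_sq_eq (hd p), lintegral_prod]
    exact (((F p.1).measurable_grad.sub (F p.2).measurable_grad).pow_const
      2).ennreal_ofReal.aemeasurable
  simp only [e]
  have h2 : Tendsto (fun p : ℕ × ℕ =>
      eLpNorm (fun q => (F p.1).grad q - V q) 2 (Q.prod unitLeb) +
        eLpNorm (fun q => (F p.2).grad q - V q) 2 (Q.prod unitLeb)) (atTop ×ˢ atTop) (𝓝 0) := by
    have := (h1.comp tendsto_fst).add (h1.comp (tendsto_snd (f := (atTop : Filter ℕ))))
    rwa [add_zero] at this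
  have h3 : Tendsto (fun p : ℕ × ℕ =>
      eLpNorm (fun q => (F p.1).grad q - (F p.2).grad q) 2 (Q.prod unitLeb)) (atTop ×ˢ atTop)
        (𝓝 0) := by
    refine tendsto_of_tendsto_of_tendsto_of_le_of_le tendsto_const_nhds h2 (fun _ => zero_le)
      fun p => ?_
    have e2 : (fun q => (F p.1).grad q - (F p.2).grad q) =
        (fun q => (F p.1).grad q - V q) - fun q => (F p.2).grad q - V q := by
      funext q; simp
    simp only [e2]
    exact eLpNorm_sub_le (((F p.1).memLp_grad Q).sub hV).aestronglyMeasurable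
      (((F p.2).memLp_grad Q).sub hV).aestronglyMeasurable one_le_two
  have h4 := ENNReal.Tendsto.pow (n := 2) h3
  simpa using h4

/-- The chain rule for the closed gradient. -/
lemma isClosedGradient_comp {Q : Measure GZero} [IsProbabilityMeasure Q] {k : ℕ}
    {ℓ : Fin k → GZero → ℝ} {V : Fin k → GZero × ℝ → ℝ} (hℓ : ∀ i, Measurable (ℓ i))
    {R : ℝ} (hR : ∀ i g, |ℓ i g| ≤ R) (hV : ∀ i, MemLp (V i) 2 (Q.prod unitLeb))
    (h : ∀ i, UnifApprox Q (ℓ i) (V i)) {U : (Fin k → ℝ) → ℝ} (hU : ContDiff ℝ 1 U) :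
    IsClosedGradient Q (fun g => U fun i => ℓ i g)
      (fun p => ∑ i, fderiv ℝ U (fun i => ℓ i p.1) (Pi.single i 1) * V i p) := by
  have hpos : ∀ n : ℕ, (0 : ℝ) < 1 / ((n : ℝ) + 1) := fun n => by positivity
  have hε : Tendsto (fun n : ℕ => 1 / ((n : ℝ) + 1)) atTop (𝓝 0) :=
    tendsto_one_div_add_atTop_nhds_zero_nat
  choose F hF1 hF2 using fun (n : ℕ) (i : Fin k) => h i _ (hpos n)
  have hlim : ∀ g, Tendsto (fun n => fun i => (F n i).eval g) atTop (𝓝 fun i => ℓ i g) := by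
    intro g
    refine tendsto_pi_nhds.2 fun i => ?_
    rw [tendsto_iff_norm_sub_tendsto_zero]
    exact squeeze_zero (fun _ => norm_nonneg _) (fun n => hF1 n i g) hε
  have hR' : ∀ i g, |ℓ i g| ≤ |R| := fun i g => (hR i g).trans (le_abs_self R)
  have hball : ∀ g, (fun i => ℓ i g) ∈ Metric.closedBall (0 : Fin k → ℝ) (|R| + 1) := by
    intro g
    rw [mem_closedBall_zero_iff, pi_norm_le_iff_of_nonneg (by positivity)]
    exact fun i => (hR' i g).trans (by linarith)
  have hballF : ∀ n g, (fun i => (F n i).eval g) ∈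
      Metric.closedBall (0 : Fin k → ℝ) (|R| + 1) := by
    intro n g
    rw [mem_closedBall_zero_iff, pi_norm_le_iff_of_nonneg (by positivity)]
    intro i
    have h1 := hF1 n i g
    have h2 : 1 / ((n : ℝ) + 1) ≤ 1 := by
      rw [div_le_one (by positivity)]
      linarith [Nat.cast_nonneg (α := ℝ) n]
    have h3 := abs_sub_abs_le_abs_sub ((F n i).eval g) (ℓ i g)
    rw [Real.norm_eq_abs]
    linarith [hR' i g]
  obtain ⟨A, hA⟩ := (isCompact_closedBall (0 : Fin k → ℝ) (|R| + 1)).exists_bound_of_continuousOn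
    hU.continuous.continuousOn
  have hc : ∀ i, Continuous fun x => fderiv ℝ U x (Pi.single i 1) := fun i =>
    (hU.continuous_fderiv one_ne_zero).clm_apply continuous_const
  have hb : ∀ i, ∃ B, 0 ≤ B ∧ ∀ x ∈ Metric.closedBall (0 : Fin k → ℝ) (|R| + 1),
      |fderiv ℝ U x (Pi.single i 1)| ≤ B := fun i => by
    obtain ⟨B, hB⟩ := (isCompact_closedBall (0 : Fin k → ℝ)
      (|R| + 1)).exists_bound_of_continuousOn (hc i).continuousOn
    exact ⟨B, (norm_nonneg _).trans (hB 0 (by simp; positivity)), hB⟩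
  choose B hB0 hB using hb
  have hℓm : Measurable fun g => fun i => ℓ i g := measurable_pi_iff.2 hℓ
  have hFm : ∀ n, Measurable fun g => fun i => (F n i).eval g := fun n =>
    measurable_pi_iff.2 fun i => (F n i).measurable_eval
  have hum : Measurable fun g => U fun i => ℓ i g := hU.continuous.measurable.comp hℓm
  have hterm : ∀ i, MemLp (fun p => fderiv ℝ U (fun i => ℓ i p.1) (Pi.single i 1) * V i p) 2
      (Q.prod unitLeb) := by
    intro i
    refine ((hV i).norm.const_mul (B i)).mono'
      (((hc i).measurable.comp (hℓm.comp measurable_fst)).aestronglyMeasurable.mul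
        (hV i).aestronglyMeasurable) (Eventually.of_forall fun p => ?_)
    rw [norm_mul]
    exact mul_le_mul_of_nonneg_right (hB i _ (hball p.1)) (norm_nonneg _)
  refine ⟨MemLp.of_bound hum.aestronglyMeasurable A (Eventually.of_forall fun g => hA _ (hball g)),
    memLp_finsetSum _ fun i _ => hterm i, fun n => CylZ.comp U hU (F n), ?_, ?_⟩
  · refine tendsto_eLpNorm_zero_of_dominated (b := fun _ => A + A)
      (fun n => ((CylZ.measurable_eval _).sub hum).aestronglyMeasurable) (memLp_const _)
      (fun n => Eventually.of_forall fun g => ?_) (Eventually.of_forall fun g => ?_)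
    · rw [CylZ.comp_eval]
      exact (abs_sub _ _).trans (add_le_add (hA _ (hballF n g)) (hA _ (hball g)))
    · simp only [CylZ.comp_eval]
      have := ((hU.continuous.tendsto _).comp (hlim g)).sub_const (U fun i => ℓ i g)
      rwa [sub_self] at this
  · have e : ∀ n, (fun p => (CylZ.comp U hU (F n)).grad p -
        ∑ i, fderiv ℝ U (fun i => ℓ i p.1) (Pi.single i 1) * V i p) =
        ∑ i, ((fun p => fderiv ℝ U (fun j => (F n j).eval p.1) (Pi.single i 1) *
          ((F n i).grad p - V i p)) +
          fun p => (fderiv ℝ U (fun j => (F n j).eval p.1) (Pi.single i 1) -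
            fderiv ℝ U (fun i => ℓ i p.1) (Pi.single i 1)) * V i p) := by
      intro n
      funext p
      rw [CylZ.comp_grad, ← Finset.sum_sub_distrib, Finset.sum_apply]
      refine Finset.sum_congr rfl fun i _ => ?_
      simp only [Pi.add_apply]
      ring
    have hFc : ∀ n i, Measurable fun p : GZero × ℝ =>
        fderiv ℝ U (fun j => (F n j).eval p.1) (Pi.single i 1) := fun n i =>
      (hc i).measurable.comp ((hFm n).comp measurable_fst)
    have hℓc : ∀ i, Measurable fun p : GZero × ℝ =>
        fderiv ℝ U (fun i => ℓ i p.1) (Pi.single i 1) := fun i =>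
      (hc i).measurable.comp (hℓm.comp measurable_fst)
    have m1 : ∀ n i, AEStronglyMeasurable (fun p : GZero × ℝ =>
        fderiv ℝ U (fun j => (F n j).eval p.1) (Pi.single i 1) * ((F n i).grad p - V i p))
        (Q.prod unitLeb) := fun n i =>
      (hFc n i).aestronglyMeasurable.mul
        ((F n i).measurable_grad.aestronglyMeasurable.sub (hV i).aestronglyMeasurable)
    have m2 : ∀ n i, AEStronglyMeasurable (fun p : GZero × ℝ =>
        (fderiv ℝ U (fun j => (F n j).eval p.1) (Pi.single i 1) -
            fderiv ℝ U (fun i => ℓ i p.1) (Pi.single i 1)) * V i p) (Q.prod unitLeb) := fun n i =>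
      ((hFc n i).sub (hℓc i)).aestronglyMeasurable.mul (hV i).aestronglyMeasurable
    have t1 : ∀ i, Tendsto (fun n => eLpNorm (fun p : GZero × ℝ =>
        fderiv ℝ U (fun j => (F n j).eval p.1) (Pi.single i 1) * ((F n i).grad p - V i p)) 2
        (Q.prod unitLeb)) atTop (𝓝 0) := by
      intro i
      have hz : Tendsto (fun n : ℕ => ENNReal.ofReal (B i) * ENNReal.ofReal (1 / ((n : ℝ) + 1)))
          atTop (𝓝 0) := by
        have h1 := ENNReal.tendsto_ofReal hε
        rw [ENNReal.ofReal_zero] at h1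
        have := ENNReal.Tendsto.const_mul h1 (Or.inr (ENNReal.ofReal_ne_top (r := B i)))
        rwa [mul_zero] at this
      refine tendsto_of_tendsto_of_tendsto_of_le_of_le tendsto_const_nhds hz (fun _ => zero_le)
        fun n => ?_
      refine (eLpNorm_le_mul_eLpNorm_of_ae_le_mul (c := B i)
        (g := fun p => (F n i).grad p - V i p) (Eventually.of_forall fun p => ?_) 2).trans
        (mul_le_mul_right (hF2 n i) _)
      rw [norm_mul]
      exact mul_le_mul_of_nonneg_right (hB i _ (hballF n p.1)) (norm_nonneg _)
    have t2 : ∀ i, Tendsto (fun n => eLpNorm (fun p : GZero × ℝ =>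
        (fderiv ℝ U (fun j => (F n j).eval p.1) (Pi.single i 1) -
            fderiv ℝ U (fun i => ℓ i p.1) (Pi.single i 1)) * V i p) 2
        (Q.prod unitLeb)) atTop (𝓝 0) := by
      intro i
      refine tendsto_eLpNorm_zero_of_dominated (m2 · i) ((hV i).norm.const_mul (B i + B i))
        (fun n => Eventually.of_forall fun p => ?_) (Eventually.of_forall fun p => ?_)
      · rw [abs_mul]
        exact mul_le_mul_of_nonneg_right ((abs_sub _ _).trans
          (add_le_add (hB i _ (hballF n p.1)) (hB i _ (hball p.1)))) (abs_nonneg _)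
      · have := ((((hc i).tendsto _).comp (hlim p.1)).sub_const
          (fderiv ℝ U (fun i => ℓ i p.1) (Pi.single i 1))).mul_const (V i p)
        rwa [sub_self, zero_mul] at this
    have t3 := tendsto_finsetSum Finset.univ fun i _ => (t1 i).add (t2 i)
    simp only [add_zero, Finset.sum_const_zero] at t3
    refine tendsto_of_tendsto_of_tendsto_of_le_of_le tendsto_const_nhds t3 (fun _ => zero_le)
      fun n => ?_
    simp only [e]
    exact (eLpNorm_sum_le (fun i _ => (m1 n i).add (m2 n i)) one_le_two).trans
      (Finset.sum_le_sum fun i _ => eLpNorm_add_le (m1 n i) (m2 n i) one_le_two)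

lemma integral_sum_mul_sq {k : ℕ} {S : Submodule ℝ (Lp ℝ 2 unitLeb)}
    (b : OrthonormalBasis (Fin k) ℝ S) (c : Fin k → ℝ) :
    ∫ t, (∑ i, c i * (b i : Lp ℝ 2 unitLeb) t) ^ 2 ∂unitLeb = ∑ i, c i ^ 2 := by
  set w : Lp ℝ 2 unitLeb := ∑ i, c i • (b i : Lp ℝ 2 unitLeb) with hw
  have hwS : w = ((b.repr.symm (WithLp.toLp 2 c) : S) : Lp ℝ 2 unitLeb) := by
    rw [← OrthonormalBasis.sum_repr_symm, hw]
    simp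
  have h1 : ‖w‖ ^ 2 = ∑ i, c i ^ 2 := by
    rw [hwS, ← Submodule.coe_norm, LinearIsometryEquiv.norm_map, EuclideanSpace.norm_sq_eq]
    simp
  rw [← h1, ← real_inner_self_eq_norm_sq, L2.inner_def]
  refine integral_congr_ae ?_
  have h2 : ∀ᵐ t ∂unitLeb, ∀ i, (c i • (b i : Lp ℝ 2 unitLeb)) t =
      c i * (b i : Lp ℝ 2 unitLeb) t := by
    rw [ae_all_iff]
    intro i
    filter_upwards [Lp.coeFn_smul (c i) (b i : Lp ℝ 2 unitLeb)] with t ht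
    rw [ht]; rfl
  filter_upwards [Lp.coeFn_finsetSum Finset.univ fun i => c i • (b i : Lp ℝ 2 unitLeb), h2]
    with t ht ht2
  rw [hw, ht, Finset.sum_apply, Finset.sum_congr rfl fun i _ => ht2 i]
  simp [sq]

namespace IsDirichletProcess

variable {β : ℝ} {Q : Measure GZero}

/-- A Lipschitz function of the projection to a finite dimensional subspace is a uniform limit of
functions whose closed gradient is bounded by the Lipschitz constant. -/
lemma exists_isClosedGradient_comp_projection (hQ : IsDirichletProcess β Q)
    (S : Submodule ℝ (Lp ℝ 2 unitLeb)) [FiniteDimensional ℝ S] {v : Lp ℝ 2 unitLeb → ℝ}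
    (hv : LipschitzWith 1 v) {ε : ℝ} (hε : 0 < ε) :
    ∃ (a : GZero → ℝ) (V : GZero × ℝ → ℝ), IsClosedGradient Q a V ∧
      (∀ g, ∫ t, V (g, t) ^ 2 ∂unitLeb ≤ 1) ∧
      ∀ g, |a g - v (S.starProjection g.toL2)| ≤ ε := by
  have := hQ.isProbabilityMeasure
  let b := stdOrthonormalBasis ℝ S
  let e : Fin (Module.finrank ℝ S) → Lp ℝ 2 unitLeb := fun i => (b i : Lp ℝ 2 unitLeb)
  have hv0 : LipschitzWith 1 fun x => v (b.repr.symm x : S) := by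
    have h1 : LipschitzWith 1 fun x => ((b.repr.symm x : S) : Lp ℝ 2 unitLeb) :=
      (LipschitzWith.subtype_val _).comp b.repr.symm.isometry.lipschitz |>.weaken (by simp)
    exact (hv.comp h1).weaken (by simp)
  obtain ⟨U, hU, hU1, hUv⟩ := hv0.exists_contDiff_near hε
  let L : (Fin (Module.finrank ℝ S) → ℝ) ≃L[ℝ] EuclideanSpace ℝ (Fin (Module.finrank ℝ S)) :=
    (EuclideanSpace.equiv (Fin (Module.finrank ℝ S)) ℝ).symm
  let W : (Fin (Module.finrank ℝ S) → ℝ) → ℝ := fun x => U (L x)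
  have hW : ContDiff ℝ 1 W := hU.comp L.contDiff
  have hWd : ∀ x i, fderiv ℝ W x (Pi.single i 1) =
      fderiv ℝ U (L x) (EuclideanSpace.single i 1) := by
    intro x i
    have h1 : HasFDerivAt W ((fderiv ℝ U (L x)).comp (L : _ →L[ℝ] _)) x :=
      ((hU.differentiable one_ne_zero (L x)).hasFDerivAt).comp x L.hasFDerivAt
    rw [h1.fderiv]
    rfl
  let ℓ : Fin (Module.finrank ℝ S) → GZero → ℝ := fun i g => ∫ t, e i t * g.val t ∂unitLeb
  have hℓ : ∀ i g, ℓ i g = inner ℝ (e i) g.toL2 := fun i g => (g.inner_toL2 (e i)).symm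
  have hbn : ∀ i, ‖e i‖ = 1 := fun i => by
    have := b.orthonormal.1 i
    rwa [Submodule.coe_norm] at this
  have hℓb : ∀ i g, |ℓ i g| ≤ 1 := fun i g => by
    rw [hℓ]
    refine (abs_real_inner_le_norm _ _).trans ?_
    rw [hbn, one_mul]
    exact g.norm_toL2_le
  have hℓm : ∀ i, Measurable (ℓ i) := fun i => by
    have : Continuous fun g : GZero => (inner ℝ (e i) g.toL2 : ℝ) :=
      continuous_const.inner GZero.continuous_toL2
    rw [funext (hℓ i)]
    exact this.measurable
  have key := isClosedGradient_comp (Q := Q) hℓm hℓb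
    (V := fun i p => e i p.2) (fun i => (Lp.memLp (e i)).comp_measurePreserving
      (measurePreserving_snd (μ := Q) (ν := unitLeb)))
    (fun i => hQ.unifApprox_linear (Lp.memLp (e i))) hW
  refine ⟨_, _, key, fun g => ?_, fun g => ?_⟩
  · simp only
    rw [integral_sum_mul_sq b]
    simp only [hWd]
    exact sum_sq_le_of_opNorm_le_one _ (by
      have := norm_fderiv_le_of_lipschitz ℝ (x₀ := L fun i => ℓ i g) hU1
      simpa using this)
  · have hp : b.repr.symm (L fun i => ℓ i g) = S.orthogonalProjectionOnto g.toL2 := by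
      rw [LinearIsometryEquiv.symm_apply_eq]
      ext i
      rw [OrthonormalBasis.repr_apply_apply,
        Submodule.inner_orthogonalProjectionOnto_eq_of_mem_left]
      exact hℓ i g
    have := hUv (L fun i => ℓ i g)
    rw [hp] at this
    exact this

lemma exists_seq_isClosedGradient (hQ : IsDirichletProcess β Q) {v : Lp ℝ 2 unitLeb → ℝ}
    (hv : LipschitzWith 1 v) :
    ∃ (a : ℕ → GZero → ℝ) (V : ℕ → GZero × ℝ → ℝ), (∀ n, IsClosedGradient Q (a n) (V n)) ∧
      (∀ n g, ∫ t, V n (g, t) ^ 2 ∂unitLeb ≤ 1) ∧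
      Tendsto (fun n => eLpNorm (fun g => a n g - v g.toL2) 2 Q) atTop (𝓝 0) := by
  have := hQ.isProbabilityMeasure
  have : Fact ((2 : ENNReal) ≠ ⊤) := ⟨by simp⟩
  obtain ⟨d, hd⟩ := TopologicalSpace.exists_dense_seq (Lp ℝ 2 unitLeb)
  let S : ℕ → Submodule ℝ (Lp ℝ 2 unitLeb) := fun n => Submodule.span ℝ (d '' Set.Iic n)
  have hS : ∀ n, FiniteDimensional ℝ (S n) := fun n =>
    FiniteDimensional.span_of_finite ℝ ((Set.finite_Iic n).image d)
  choose a V hV hV1 ha using fun n : ℕ =>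
    hQ.exists_isClosedGradient_comp_projection (S n) hv (show (0 : ℝ) < 1 / ((n : ℝ) + 1) by
      positivity)
  refine ⟨a, V, hV, hV1, ?_⟩
  have hε : Tendsto (fun n : ℕ => 1 / ((n : ℝ) + 1)) atTop (𝓝 0) :=
    tendsto_one_div_add_atTop_nhds_zero_nat
  have hmin : ∀ n, ∀ w : Lp ℝ 2 unitLeb, ∀ x ∈ S n, ‖w - (S n).starProjection w‖ ≤ ‖w - x‖ := by
    intro n w x hx
    rw [Submodule.starProjection_minimal]
    exact ciInf_le ⟨0, by rintro _ ⟨y, rfl⟩; exact norm_nonneg _⟩ (⟨x, hx⟩ : S n)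
  have hproj : ∀ w : Lp ℝ 2 unitLeb,
      Tendsto (fun n => ‖w - (S n).starProjection w‖) atTop (𝓝 0) := by
    intro w
    rw [Metric.tendsto_atTop]
    intro ε hε
    obtain ⟨k, hk⟩ := hd.exists_dist_lt w hε
    refine ⟨k, fun n hn => ?_⟩
    rw [Real.dist_0_eq_abs, abs_of_nonneg (norm_nonneg _)]
    refine (hmin n w (d k) (Submodule.subset_span ⟨k, hn, rfl⟩)).trans_lt ?_
    rwa [← dist_eq_norm]
  have hle : ∀ n (g : GZero), |a n g - v g.toL2| ≤
      1 / ((n : ℝ) + 1) + ‖g.toL2 - (S n).starProjection g.toL2‖ := by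
    intro n g
    have h1 := hv.dist_le_mul ((S n).starProjection g.toL2) g.toL2
    rw [NNReal.coe_one, one_mul, Real.dist_eq, dist_comm, dist_eq_norm] at h1
    exact (abs_sub_le _ _ _).trans (add_le_add (ha n g) h1)
  refine tendsto_eLpNorm_zero_of_dominated (b := fun _ => 2) (fun n => ?_) (memLp_const _)
    (fun n => Eventually.of_forall fun g => ?_) (Eventually.of_forall fun g => ?_)
  · exact (hV n).1.aestronglyMeasurable.sub
      (hv.continuous.comp GZero.continuous_toL2).aestronglyMeasurable
  · have h1 := hmin n g.toL2 0 (zero_mem _)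
    rw [sub_zero] at h1
    have h2 : 1 / ((n : ℝ) + 1) ≤ 1 := by
      rw [div_le_one (by positivity)]
      linarith [Nat.cast_nonneg (α := ℝ) n]
    linarith [hle n g, g.norm_toL2_le]
  · have h1 := hε.add (hproj g.toL2)
    rw [add_zero] at h1
    exact squeeze_zero_norm (fun n => hle n g) h1

end IsDirichletProcess

/-- The closure of the graph of the gradient on cylinder functions. -/
def gradientGraph (Q : Measure GZero) [IsProbabilityMeasure Q] :
    Set (Lp ℝ 2 Q × Lp ℝ 2 (Q.prod unitLeb)) :=
  closure (Set.range fun F : CylZ => ((F.memLp_eval Q).toLp, (F.memLp_grad Q).toLp))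

lemma convex_gradientGraph (Q : Measure GZero) [IsProbabilityMeasure Q] :
    Convex ℝ (gradientGraph Q) := by
  refine Convex.closure ?_
  rintro _ ⟨F, rfl⟩ _ ⟨G, rfl⟩ s t _ _ _
  refine ⟨CylZ.lin s t F G, ?_⟩
  have e1 : (CylZ.lin s t F G).eval = s • F.eval + t • G.eval :=
    funext fun g => CylZ.lin_eval s t F G g
  have e2 : (CylZ.lin s t F G).grad = s • F.grad + t • G.grad :=
    funext fun p => CylZ.lin_grad s t F G p
  simp only [e1, e2]
  rfl

lemma mem_gradientGraph_iff {Q : Measure GZero} [IsProbabilityMeasure Q] {u : GZero → ℝ}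
    {V : GZero × ℝ → ℝ} (hu : MemLp u 2 Q) (hV : MemLp V 2 (Q.prod unitLeb)) :
    (hu.toLp, hV.toLp) ∈ gradientGraph Q ↔ IsClosedGradient Q u V := by
  have key : ∀ F : ℕ → CylZ,
      Tendsto (fun n => (((F n).memLp_eval Q).toLp, ((F n).memLp_grad Q).toLp)) atTop
        (𝓝 (hu.toLp, hV.toLp)) ↔
      Tendsto (fun n => eLpNorm (fun g => (F n).eval g - u g) 2 Q) atTop (𝓝 0) ∧
      Tendsto (fun n => eLpNorm (fun p => (F n).grad p - V p) 2 (Q.prod unitLeb)) atTop (𝓝 0) := by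
    intro F
    rw [Prod.tendsto_iff]
    exact and_congr
      (Lp.tendsto_Lp_iff_tendsto_eLpNorm'' (fun n => (F n).eval) (fun n => (F n).memLp_eval Q) u hu)
      (Lp.tendsto_Lp_iff_tendsto_eLpNorm'' (fun n => (F n).grad) (fun n => (F n).memLp_grad Q) V hV)
  rw [gradientGraph, mem_closure_iff_seq_limit]
  constructor
  · rintro ⟨x, hx, hlim⟩
    choose F hF using hx
    obtain rfl : (fun n => (((F n).memLp_eval Q).toLp, ((F n).memLp_grad Q).toLp)) = x :=
      funext hF
    exact ⟨hu, hV, F, (key F).1 hlim⟩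
  · rintro ⟨-, -, F, hF⟩
    exact ⟨_, fun n => ⟨F n, rfl⟩, (key F).2 hF⟩

/-- The fields `V` with `∫₀¹ V(g,t)² dt ≤ 1` for almost all `g`. -/
def unitFields (Q : Measure GZero) : Set (Lp ℝ 2 (Q.prod unitLeb)) :=
  ⋂ (A : Set GZero) (_ : MeasurableSet A),
    LpToLpRestrictCLM (GZero × ℝ) ℝ ℝ (Q.prod unitLeb) 2 (A ×ˢ Set.univ) ⁻¹'
      Metric.closedBall 0 (Real.sqrt (Q.real A))

lemma isClosed_unitFields (Q : Measure GZero) : IsClosed (unitFields Q) :=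
  isClosed_iInter fun _ => isClosed_iInter fun _ =>
    Metric.isClosed_closedBall.preimage (ContinuousLinearMap.continuous _)

lemma convex_unitFields (Q : Measure GZero) : Convex ℝ (unitFields Q) :=
  convex_iInter fun _ => convex_iInter fun _ =>
    (convex_closedBall _ _).linear_preimage
      (LpToLpRestrictCLM (GZero × ℝ) ℝ ℝ (Q.prod unitLeb) 2 _).toLinearMap

lemma mem_unitFields_iff {Q : Measure GZero} [IsProbabilityMeasure Q]
    {V : Lp ℝ 2 (Q.prod unitLeb)} :
    V ∈ unitFields Q ↔ ∀ A, MeasurableSet A →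
      ∫ g in A, ∫ t, V (g, t) ^ 2 ∂unitLeb ∂Q ≤ Q.real A := by
  simp only [unitFields, Set.mem_iInter, Set.mem_preimage, mem_closedBall_zero_iff]
  refine forall_congr' fun A => forall_congr' fun hA => ?_
  have hi : Integrable (fun p => V p ^ 2) (Q.prod unitLeb) := (Lp.memLp V).integrable_sq
  have h1 : ‖LpToLpRestrictCLM (GZero × ℝ) ℝ ℝ (Q.prod unitLeb) 2 (A ×ˢ Set.univ) V‖ ^ 2 =
      ∫ g in A, ∫ t, V (g, t) ^ 2 ∂unitLeb ∂Q := by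
    have h2 := setIntegral_prod (μ := Q) (ν := unitLeb) (fun p => V p ^ 2) (s := A)
      (t := Set.univ) hi.integrableOn
    rw [Measure.restrict_univ] at h2
    rw [← h2, Lp.norm_def,
      eLpNorm_congr_ae (LpToLpRestrictCLM_coeFn ℝ (A ×ˢ (Set.univ : Set ℝ)) V),
      integral_sq_eq_eLpNorm ((Lp.memLp V).restrict _)]
  rw [← h1]
  exact Real.le_sqrt (norm_nonneg _) measureReal_nonneg

theorem mainTheorem8 (β : ℝ) (hβ : 0 < β) (Q : Measure GZero) (hQ : IsDirichletProcess β Q)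
    (u : GZero → ℝ) (hu : ∀ g h : GZero, |u g - u h| ≤ dist g h) :
    MemDomE Q u ∧
      ∃ V : GZero × ℝ → ℝ, IsClosedGradient Q u V ∧
        (∀ W : GZero × ℝ → ℝ, IsClosedGradient Q u W → W =ᵐ[Q.prod unitLeb] V) ∧
        ∀ᵐ g ∂Q, squareField V V g ≤ 1 := by
  have := hQ.isProbabilityMeasure
  obtain ⟨v, hv, hvu⟩ : ∃ v : Lp ℝ 2 unitLeb → ℝ, LipschitzWith 1 v ∧
      ∀ g : GZero, v g.toL2 = u g := by
    have he : ∀ g : GZero, Function.extend GZero.toL2 u 0 g.toL2 = u g :=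
      GZero.toL2_injective.extend_apply u 0
    have hl : LipschitzOnWith 1 (Function.extend GZero.toL2 u 0) (Set.range GZero.toL2) := by
      refine LipschitzOnWith.of_dist_le_mul ?_
      rintro _ ⟨g, rfl⟩ _ ⟨h, rfl⟩
      rw [he, he, NNReal.coe_one, one_mul, GZero.dist_toL2]
      exact hu g h
    obtain ⟨v, hv, hvu⟩ := hl.extend_real
    exact ⟨v, hv, fun g => (hvu ⟨g, rfl⟩).symm.trans (he g)⟩
  obtain ⟨a, B, hB, hB1, ha⟩ := hQ.exists_seq_isClosedGradient hv
  simp only [hvu] at ha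
  have hum : MemLp u 2 Q := by
    have hc : Continuous u := by
      have : u = fun g => v g.toL2 := funext fun g => (hvu g).symm
      rw [this]
      exact hv.continuous.comp GZero.continuous_toL2
    refine MemLp.of_bound hc.aestronglyMeasurable (|v 0| + 1) (Eventually.of_forall fun g => ?_)
    have h1 := hv.dist_le_mul g.toL2 0
    rw [NNReal.coe_one, one_mul, dist_zero_right, Real.dist_eq, hvu] at h1
    have h2 := abs_sub_abs_le_abs_sub (u g) (v 0)
    rw [Real.norm_eq_abs]
    linarith [g.norm_toL2_le]
  have hK : ∀ n, (hB n).2.1.toLp ∈ unitFields Q := by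
    intro n
    rw [mem_unitFields_iff]
    intro A hA
    have hae := (hB n).2.1.coeFn_toLp
    have h1 : ∀ᵐ g ∂Q, ∫ t, (hB n).2.1.toLp (B n) (g, t) ^ 2 ∂unitLeb =
        ∫ t, B n (g, t) ^ 2 ∂unitLeb := by
      filter_upwards [Measure.ae_ae_of_ae_prod hae] with g hg
      refine integral_congr_ae ?_
      filter_upwards [hg] with t ht
      rw [ht]
    have hi := (Lp.memLp (hB n).2.1.toLp).integrable_sq.integral_prod_left
    calc _ ≤ ∫ g in A, (1 : ℝ) ∂Q := by
          refine setIntegral_mono_ae hi.integrableOn (integrable_const _).integrableOn ?_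
          filter_upwards [h1] with g hg
          rw [hg]
          exact hB1 n g
      _ = Q.real A := by simp
  have hbdd : ∀ n, ‖(hB n).2.1.toLp‖ ≤ 1 := by
    intro n
    have h1 := (mem_unitFields_iff.1 (hK n)) Set.univ MeasurableSet.univ
    rw [Measure.restrict_univ, probReal_univ,
      ← integral_prod _ (Lp.memLp (hB n).2.1.toLp).integrable_sq,
      integral_sq_eq_eLpNorm (Lp.memLp _), ← Lp.norm_def] at h1
    nlinarith [norm_nonneg (hB n).2.1.toLp]
  have hlim : Tendsto (fun n => (hB n).1.toLp) atTop (𝓝 hum.toLp) :=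
    (Lp.tendsto_Lp_iff_tendsto_eLpNorm'' a (fun n => (hB n).1) u hum).2 ha
  obtain ⟨V, hVK, hVC⟩ := exists_mem_of_tendsto_of_bounded (C := gradientGraph Q) isClosed_closure
    (convex_gradientGraph Q) (isClosed_unitFields Q) (convex_unitFields Q) hlim hK
    (fun n => (mem_gradientGraph_iff (hB n).1 (hB n).2.1).2 (hB n)) hbdd
  have hV : IsClosedGradient Q u V := by
    rw [← mem_gradientGraph_iff hum (Lp.memLp V), Lp.toLp_coeFn]
    exact hVC
  refine ⟨hV.memDomE, V, hV, fun W hW => hV.ae_eq hQ hβ hW, ?_⟩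
  have hi := (Lp.memLp V).integrable_sq.integral_prod_left
  have h1 := ae_le_of_forall_setIntegral_le hi (integrable_const (1 : ℝ)) fun A hA _ => by
    refine ((mem_unitFields_iff.1 hVK) A hA).trans (le_of_eq ?_)
    simp
  filter_upwards [h1] with g hg
  have e : squareField V V g = ∫ t, V (g, t) ^ 2 ∂unitLeb := by
    simp only [squareField, unitLeb, sq]
  rw [e]
  exact hg

end
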